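/- Conventions. An $\omega$-category is a strict globular $\omega$-category all of whose morphisms are of finite dimension: a set with maps $s_n,t_n$ ($n\ge 0$) and partial compositions $*_n$ ($x*_ny$ is defined iff $t_nx=s_ny$) subject to the usual axioms; $\dim x$ is the least $n$ with $s_nx=t_nx=x$. An $\omega$-category $C$ is non-contracting if $s_1x$ and $t_1x$ are $1$-dimensional whenever $\dim x\ge 1$. For such a $C$, let $\mathbb P C$ be its path $\omega$-category: its morphisms are the morphisms of $C$ of dimension at least $1$, with the operations $s_{n+1},t_{n+1},*_{n+1}$ of $C$ as $n$-source, $n$-target and $n$-composition. Let $\mathcal R^-$ be the equivalence relation on $\mathbb P C$ generated by $x\sim x*_0y$ for $x,y,x*_0y\in\mathbb P C$. Let $U$ be the forgetful functor from $\omega$-categories to globular sets (the $n$-cells of $UD$ being the morphisms of $D$ of dimension at most $n$), let $F$ be its left adjoint, and let $\phi:U\mathbb P C\to U\mathbb P C/\mathcal R^-$ be the quotient morphism. The negative semi-path $\omega$-category $\mathbb P^-C$ is the pushout, in the category of $\omega$-categories, of $F(\phi):FU\mathbb P C\to F(U\mathbb P C/\mathcal R^-)$ and of the counit $FU\mathbb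 P C\to\mathbb P C$. The faces of the $n$-cube are the words of length $n$ in $\{-,0,+\}$, the dimension of a face being its number of $0$'s; the faces of the $n$-simplex are the nonempty subsets of $\{0,\dots,n\}$, the dimension of a face being its number of elements minus $1$. For a face $x$, $R(x)$ is the set of its subfaces, and $R(X)=\bigcup_{x\in X}R(x)$. For a face $x$ of dimension $p\ge 1$ of the cube, $s_x$ (resp. $t_x$) is the set of the faces obtained by replacing, for some $i$, the $i$-th $0$ of $x$ by $(-)^i$ (resp. $(-)^{i+1}$); for a face of dimension $p\ge1$ of the simplex, $s_x$ (resp. $t_x$) is the set of the faces obtained by removing an element in odd (resp. even) position, positions being counted from $1$. Then $I^n$ (resp. $\Delta^n$) is the $\omega$-category of sets of faces of the $n$-cube (resp. the $n$-simplex) generated by the atoms $R(x)$, where $s_{p-1}R(x)=R(s_x)$ and $t_{p-1}R(x)=R(t_x)$ for a face $x$ of dimension $p\ge1$ (and, more generally, $d_n^\alpha R(x)=\bigcup_{a\subseteq x,\ \dim a\le n}R(a)\setminus\bigcup_{b\subseteq x,\ \dim b=n+1}\left(R(b)\setminus R(d^\alpha_b)\right)$, where $d^-_n=s_n$, $d^+_n=t_n$,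 $d^-_b=s_b$, $d^+_b=t_b$), and where $X*_nY=X\cup Y$ when $t_nX=s_nY$. Statement. The $\omega$-categories $I^{n+1}$, $n\ge 0$, are non-contracting, so that $\mathbb P^-(I^{n+1})$ is defined. For every $n\ge 0$ there is an isomorphism of $\omega$-categories $$\mathbb P^-(I^{n+1})\;\cong\;\bigoplus_{1\le p\le n+1}\left(\Delta^{p-1}\right)^{\oplus\binom{n+1}{p}},$$ where $\oplus$ is the direct sum (coproduct) in the category of $\omega$-categories, whose underlying set is the disjoint union of the underlying sets. -/

import Mathlib

open CategoryTheory CategoryTheory.Limits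

universe u

/-! ### Strict globular omega-categories -/

/-- The two directions: `src` stands for `-`, and `tgt` for `+`. -/
inductive Dir : Type
  | src : Dir
  | tgt : Dir

/-- A (strict, globular) omega-category in the one-sorted form: `d .src n` is the `n`-source map,
`d .tgt n` the `n`-target map and `comp n` the partially defined composition `*_n`. -/
structure OmegaCat : Type (u + 1) where
  carrier : Type u
  d : Dir → ℕ → carrier → carrier
  comp : ∀ (n : ℕ) (x y : carrier), d .tgt n x = d .src n y → carrier
  d_d_lt : ∀ (α β : Dir) (m n : ℕ) (x : carrier), m < n → d β m (d α n x) = d β m x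
  d_d_ge : ∀ (α β : Dir) (m n : ℕ) (x : carrier), n ≤ m → d β m (d α n x) = d α n x
  src_unit : ∀ (n : ℕ) (x : carrier) (h : d .tgt n (d .src n x) = d .src n x),
    comp n (d .src n x) x h = x
  tgt_unit : ∀ (n : ℕ) (x : carrier) (h : d .tgt n x = d .src n (d .tgt n x)),
    comp n x (d .tgt n x) h = x
  src_comp : ∀ (n : ℕ) (x y : carrier) (h : d .tgt n x = d .src n y),
    d .src n (comp n x y h) = d .src n x
  tgt_comp : ∀ (n : ℕ) (x y : carrier) (h : d .tgt n x = d .src n y),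
    d .tgt n (comp n x y h) = d .tgt n y
  d_comp : ∀ (α : Dir) (m n : ℕ) (x y : carrier) (h : d .tgt n x = d .src n y), m ≠ n →
    ∃ h' : d .tgt n (d α m x) = d .src n (d α m y),
      d α m (comp n x y h) = comp n (d α m x) (d α m y) h'
  assoc : ∀ (n : ℕ) (x y z : carrier) (hxy : d .tgt n x = d .src n y)
    (hyz : d .tgt n y = d .src n z) (h₁ : d .tgt n (comp n x y hxy) = d .src n z)
    (h₂ : d .tgt n x = d .src n (comp n y z hyz)),
    comp n (comp n x y hxy) z h₁ = comp n x (comp n y z hyz) h₂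
  interchange : ∀ (m n : ℕ) (x y z w : carrier) (hxy : d .tgt n x = d .src n y)
    (hzw : d .tgt n z = d .src n w)
    (h₁ : d .tgt m (comp n x y hxy) = d .src m (comp n z w hzw))
    (hxz : d .tgt m x = d .src m z) (hyw : d .tgt m y = d .src m w)
    (h₂ : d .tgt n (comp m x z hxz) = d .src n (comp m y w hyw)), m ≠ n →
    comp m (comp n x y hxy) (comp n z w hzw) h₁ = comp n (comp m x z hxz) (comp m y w hyw) h₂
  finite : ∀ x : carrier, ∃ n : ℕ, ∀ α : Dir, d α n x = x

namespace OmegaCat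

/-- The dimension of a morphism: the least `n` such that its `n`-source and its `n`-target are
the morphism itself. -/
noncomputable def dim (C : OmegaCat.{u}) (x : C.carrier) : ℕ :=
  sInf {n : ℕ | ∀ α : Dir, C.d α n x = x}

/-- An omega-functor. -/
@[ext]
structure Hom (C D : OmegaCat.{u}) : Type u where
  toFun : C.carrier → D.carrier
  map_d : ∀ (α : Dir) (n : ℕ) (x : C.carrier), toFun (C.d α n x) = D.d α n (toFun x)
  map_comp : ∀ (n : ℕ) (x y : C.carrier) (h : C.d .tgt n x = C.d .src n y)
    (h' : D.d .tgt n (toFun x) = D.d .src n (toFun y)),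
    toFun (C.comp n x y h) = D.comp n (toFun x) (toFun y) h'

theorem Hom.compat {C D : OmegaCat.{u}} (f : Hom C D) {n : ℕ} {x y : C.carrier}
    (h : C.d .tgt n x = C.d .src n y) : D.d .tgt n (f.toFun x) = D.d .src n (f.toFun y) := by
  rw [← f.map_d, ← f.map_d, h]

/-- The category of omega-categories and omega-functors. -/
instance : Category OmegaCat.{u} where
  Hom := Hom
  id C := ⟨id, fun _ _ _ => rfl, fun _ _ _ _ _ => rfl⟩
  comp {C D E} f g :=
    { toFun := fun x => g.toFun (f.toFun x)
      map_d := fun α n x => by rw [f.map_d, g.map_d]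
      map_comp := fun n x y h h' => by
        rw [f.map_comp n x y h (f.compat h), g.map_comp] }

theorem hom_ext {C D : OmegaCat.{u}} {f g : C ⟶ D} (h : ∀ x, f.toFun x = g.toFun x) : f = g :=
  Hom.ext (funext h)

theorem comp_toFun {C D E : OmegaCat.{u}} (f : C ⟶ D) (g : D ⟶ E) (x : C.carrier) :
    (f ≫ g).toFun x = g.toFun (f.toFun x) := rfl

theorem comp_congr (C : OmegaCat.{u}) (n : ℕ) {x x' y y' : C.carrier} (hx : x = x') (hy : y = y')
    (h : C.d .tgt n x = C.d .src n y) (h' : C.d .tgt n x' = C.d .src n y') :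
    C.comp n x y h = C.comp n x' y' h' := by
  subst hx hy; rfl

/-! ### Omega-categories given by generators and relations -/

/-- Formal expressions in the operations of omega-categories, with variables in `X`. -/
inductive Expr (X : Type u) : Type u
  | of : X → Expr X
  | d : Dir → ℕ → Expr X → Expr X
  | comp : ℕ → Expr X → Expr X → Expr X

/-- `Rel E a b` : the axioms of omega-categories and the relations `E` imply that both `a` and `b`
are defined, and are equal. In particular `Rel E a a` means that `a` is defined. -/
inductive Rel {X : Type u} (E : Expr X → Expr X → Prop) : Expr X → Expr X → Prop
  | of (x : X) : Rel E (.of x) (.of x)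
  | rel {a b} : E a b → Rel E a b
  | symm {a b} : Rel E a b → Rel E b a
  | trans {a b c} : Rel E a b → Rel E b c → Rel E a c
  | d_congr {a b} (α : Dir) (n : ℕ) : Rel E a b → Rel E (.d α n a) (.d α n b)
  | comp_congr {a a' b b'} (n : ℕ) : Rel E a a' → Rel E b b' →
      Rel E (.d .tgt n a) (.d .src n b) → Rel E (.comp n a b) (.comp n a' b')
  | d_arg {a} {α : Dir} {n : ℕ} : Rel E (.d α n a) (.d α n a) → Rel E a a
  | comp_left {a b} {n : ℕ} : Rel E (.comp n a b) (.comp n a b) → Rel E a a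
  | comp_right {a b} {n : ℕ} : Rel E (.comp n a b) (.comp n a b) → Rel E b b
  | comp_def {a b} {n : ℕ} : Rel E (.comp n a b) (.comp n a b) →
      Rel E (.d .tgt n a) (.d .src n b)
  | d_d_lt {a} (α β : Dir) (m n : ℕ) : Rel E a a → m < n →
      Rel E (.d β m (.d α n a)) (.d β m a)
  | d_d_ge {a} (α β : Dir) (m n : ℕ) : Rel E a a → n ≤ m →
      Rel E (.d β m (.d α n a)) (.d α n a)
  | src_unit {a} (n : ℕ) : Rel E a a → Rel E (.comp n (.d .src n a) a) a
  | tgt_unit {a} (n : ℕ) : Rel E a a → Rel E (.comp n a (.d .tgt n a)) a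
  | src_comp {a b} {n : ℕ} : Rel E (.comp n a b) (.comp n a b) →
      Rel E (.d .src n (.comp n a b)) (.d .src n a)
  | tgt_comp {a b} {n : ℕ} : Rel E (.comp n a b) (.comp n a b) →
      Rel E (.d .tgt n (.comp n a b)) (.d .tgt n b)
  | d_comp {a b} (α : Dir) (m : ℕ) {n : ℕ} : Rel E (.comp n a b) (.comp n a b) → m ≠ n →
      Rel E (.d α m (.comp n a b)) (.comp n (.d α m a) (.d α m b))
  | assoc {a b c} {n : ℕ} : Rel E (.comp n (.comp n a b) c) (.comp n (.comp n a b) c) →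
      Rel E (.comp n a (.comp n b c)) (.comp n a (.comp n b c)) →
      Rel E (.comp n (.comp n a b) c) (.comp n a (.comp n b c))
  | interchange {a b c e} {m n : ℕ} :
      Rel E (.comp m (.comp n a b) (.comp n c e)) (.comp m (.comp n a b) (.comp n c e)) →
      Rel E (.comp n (.comp m a c) (.comp m b e)) (.comp n (.comp m a c) (.comp m b e)) →
      m ≠ n → Rel E (.comp m (.comp n a b) (.comp n c e)) (.comp n (.comp m a c) (.comp m b e))

namespace Rel

variable {X : Type u} {E : Expr X → Expr X → Prop}

theorem left {a b : Expr X} (h : Rel E a b) : Rel E a a := h.trans h.symm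

theorem right {a b : Expr X} (h : Rel E a b) : Rel E b b := h.symm.trans h

theorem finite (hE : ∀ x : X, ∃ n : ℕ, ∀ α : Dir, E (.d α n (.of x)) (.of x)) (a : Expr X)
    (ha : Rel E a a) : ∃ N : ℕ, ∀ m, N ≤ m → ∀ α : Dir, Rel E (.d α m a) a := by
  induction a with
  | of x =>
    obtain ⟨n, hn⟩ := hE x
    refine ⟨n, fun m hm α => ?_⟩
    have h := Rel.rel (hn α)
    exact ((d_congr α m h).symm.trans (d_d_ge α α m n ha hm)).trans h
  | d β k a _ => exact ⟨k, fun m hm α => d_d_ge β α m k ha.d_arg hm⟩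
  | comp k a b iha ihb =>
    obtain ⟨N, hN⟩ := iha ha.comp_left
    obtain ⟨M, hM⟩ := ihb ha.comp_right
    refine ⟨max (max N M) (k + 1), fun m hm α => ?_⟩
    have h := d_comp α m ha (by omega)
    exact h.trans (comp_congr k (hN m (by omega) α) (hM m (by omega) α) h.right.comp_def)

end Rel

section Presentation

variable {X : Type u} (E : Expr X → Expr X → Prop)

/-- Equality of defined expressions. -/
def presSetoid : Setoid {a : Expr X // Rel E a a} where
  r a b := Rel E a.1 b.1
  iseqv := ⟨fun a => a.2, fun h => h.symm, fun h h' => h.trans h'⟩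

/-- The element represented by a defined expression. -/
def presMk (a : Expr X) (h : Rel E a a) : Quotient (presSetoid E) := Quotient.mk (presSetoid E) ⟨a, h⟩

variable {E}

theorem presMk_eq {a b : Expr X} (ha : Rel E a a) (hb : Rel E b b) :
    presMk E a ha = presMk E b hb ↔ Rel E a b :=
  ⟨fun h => Quotient.exact h, fun h => Quotient.sound h⟩

theorem pres_ind (x : Quotient (presSetoid E)) : ∃ a, ∃ h : Rel E a a, x = presMk E a h := by
  induction x using Quotient.inductionOn with
  | h a => exact ⟨a.1, a.2, rfl⟩

/-- Sources and targets of classes of expressions. -/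
def presD (α : Dir) (n : ℕ) : Quotient (presSetoid E) → Quotient (presSetoid E) :=
  Quotient.map (fun a => ⟨.d α n a.1, a.2.d_congr α n⟩) (fun _ _ h => Rel.d_congr α n h)

theorem presD_mk (α : Dir) (n : ℕ) (a : Expr X) (h : Rel E a a) :
    presD α n (presMk E a h) = presMk E (.d α n a) (h.d_congr α n) := rfl

theorem presD_out {n : ℕ} {x y : Quotient (presSetoid E)}
    (h : presD .tgt n x = presD .src n y) :
    Rel E (.comp n x.out.1 y.out.1) (.comp n x.out.1 y.out.1) := by
  rw [← x.out_eq, ← y.out_eq] at h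
  exact Rel.comp_congr n x.out.2 y.out.2 (Quotient.exact h)

/-- Composition of classes of expressions. -/
noncomputable def presComp (n : ℕ) (x y : Quotient (presSetoid E))
    (h : presD .tgt n x = presD .src n y) : Quotient (presSetoid E) :=
  presMk E (.comp n x.out.1 y.out.1) (presD_out h)

theorem presComp_mk (n : ℕ) (a b : Expr X) (ha : Rel E a a) (hb : Rel E b b)
    (h : presD .tgt n (presMk E a ha) = presD .src n (presMk E b hb)) :
    ∃ hab : Rel E (.comp n a b) (.comp n a b),
      presComp n (presMk E a ha) (presMk E b hb) h = presMk E (.comp n a b) hab := by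
  have h₀ := (presMk_eq _ _).1 h
  refine ⟨Rel.comp_congr n ha hb h₀, (presMk_eq _ _).2 ?_⟩
  have h₁ : Rel E (presMk E a ha).out.1 a := Quotient.mk_out (s := presSetoid E) ⟨a, ha⟩
  have h₂ : Rel E (presMk E b hb).out.1 b := Quotient.mk_out (s := presSetoid E) ⟨b, hb⟩
  exact Rel.comp_congr n h₁ h₂ (presD_out h).comp_def

variable (E)

/-- The omega-category with generators `X` and relations `E`. -/
noncomputable def pres (hE : ∀ x : X, ∃ n : ℕ, ∀ α : Dir, E (.d α n (.of x)) (.of x)) :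
    OmegaCat.{u} where
  carrier := Quotient (presSetoid E)
  d := presD
  comp := presComp
  d_d_lt α β m n x h := by
    obtain ⟨a, ha, rfl⟩ := pres_ind x
    exact (presMk_eq _ _).2 (ha.d_d_lt α β m n h)
  d_d_ge α β m n x h := by
    obtain ⟨a, ha, rfl⟩ := pres_ind x
    exact (presMk_eq _ _).2 (ha.d_d_ge α β m n h)
  src_unit n x h := by
    obtain ⟨a, ha, rfl⟩ := pres_ind x
    obtain ⟨hab, e⟩ := presComp_mk n _ _ _ _ h
    exact e.trans ((presMk_eq _ _).2 (ha.src_unit n))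
  tgt_unit n x h := by
    obtain ⟨a, ha, rfl⟩ := pres_ind x
    obtain ⟨hab, e⟩ := presComp_mk n _ _ _ _ h
    exact e.trans ((presMk_eq _ _).2 (ha.tgt_unit n))
  src_comp n x y h := by
    obtain ⟨a, ha, rfl⟩ := pres_ind x
    obtain ⟨b, hb, rfl⟩ := pres_ind y
    obtain ⟨hab, e⟩ := presComp_mk n _ _ _ _ h
    rw [e]
    exact (presMk_eq _ _).2 hab.src_comp
  tgt_comp n x y h := by
    obtain ⟨a, ha, rfl⟩ := pres_ind x
    obtain ⟨b, hb, rfl⟩ := pres_ind y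
    obtain ⟨hab, e⟩ := presComp_mk n _ _ _ _ h
    rw [e]
    exact (presMk_eq _ _).2 hab.tgt_comp
  d_comp α m n x y h hmn := by
    obtain ⟨a, ha, rfl⟩ := pres_ind x
    obtain ⟨b, hb, rfl⟩ := pres_ind y
    obtain ⟨hab, e⟩ := presComp_mk n _ _ _ _ h
    have h₀ := hab.d_comp α m hmn
    have h₁ : presD .tgt n (presD α m (presMk E a ha)) = presD .src n (presD α m (presMk E b hb)) :=
      (presMk_eq _ _).2 h₀.right.comp_def
    refine ⟨h₁, ?_⟩
    obtain ⟨hab', e'⟩ := presComp_mk n (.d α m a) (.d α m b) (ha.d_congr α m) (hb.d_congr α m) h₁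
    rw [e]
    exact ((presMk_eq _ _).2 h₀).trans e'.symm
  assoc n x y z hxy hyz h₁ h₂ := by
    obtain ⟨a, ha, rfl⟩ := pres_ind x
    obtain ⟨b, hb, rfl⟩ := pres_ind y
    obtain ⟨c, hc, rfl⟩ := pres_ind z
    obtain ⟨hab, e₁⟩ := presComp_mk n _ _ _ _ hxy
    obtain ⟨hbc, e₂⟩ := presComp_mk n _ _ _ _ hyz
    simp only [e₁, e₂] at h₁ h₂ ⊢
    obtain ⟨k₁, e₃⟩ := presComp_mk n _ _ _ _ h₁
    obtain ⟨k₂, e₄⟩ := presComp_mk n _ _ _ _ h₂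
    rw [e₃, e₄]
    exact (presMk_eq _ _).2 (k₁.assoc k₂)
  interchange m n x y z w hxy hzw h₁ hxz hyw h₂ hmn := by
    obtain ⟨a, ha, rfl⟩ := pres_ind x
    obtain ⟨b, hb, rfl⟩ := pres_ind y
    obtain ⟨c, hc, rfl⟩ := pres_ind z
    obtain ⟨e, he, rfl⟩ := pres_ind w
    obtain ⟨_, e₁⟩ := presComp_mk n _ _ _ _ hxy
    obtain ⟨_, e₂⟩ := presComp_mk n _ _ _ _ hzw
    obtain ⟨_, e₃⟩ := presComp_mk m _ _ _ _ hxz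
    obtain ⟨_, e₄⟩ := presComp_mk m _ _ _ _ hyw
    simp only [e₁, e₂, e₃, e₄] at h₁ h₂ ⊢
    obtain ⟨k₁, e₅⟩ := presComp_mk m _ _ _ _ h₁
    obtain ⟨k₂, e₆⟩ := presComp_mk n _ _ _ _ h₂
    rw [e₅, e₆]
    exact (presMk_eq _ _).2 (k₁.interchange k₂ hmn)
  finite x := by
    obtain ⟨a, ha, rfl⟩ := pres_ind x
    obtain ⟨N, hN⟩ := Rel.finite hE a ha
    exact ⟨N, fun α => (presMk_eq _ _).2 (hN N le_rfl α)⟩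

variable (hE : ∀ x : X, ∃ n : ℕ, ∀ α : Dir, E (.d α n (.of x)) (.of x))

/-- The generators of the omega-category with generators `X` and relations `E`. -/
noncomputable def presOf (x : X) : (pres E hE).carrier := presMk E (.of x) (.of x)

variable {E}

/-- `Eval D f a v` : the expression `a` is defined in `D` when the variables have the values given
by `f`, and its value is `v`. -/
inductive Eval (D : OmegaCat.{u}) (f : X → D.carrier) : Expr X → D.carrier → Prop
  | of (x : X) : Eval D f (.of x) (f x)
  | d {a v} (α : Dir) (n : ℕ) : Eval D f a v → Eval D f (.d α n a) (D.d α n v)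
  | comp {a b v w} (n : ℕ) (h : D.d .tgt n v = D.d .src n w) : Eval D f a v → Eval D f b w →
      Eval D f (.comp n a b) (D.comp n v w h)

theorem Eval.unique {D : OmegaCat.{u}} {f : X → D.carrier} {a : Expr X} {v w : D.carrier}
    (h : Eval D f a v) (h' : Eval D f a w) : v = w := by
  induction h generalizing w with
  | of x => cases h'; rfl
  | d α n _ ih => cases h' with | d _ _ h' => rw [ih h']
  | comp n h _ _ iha ihb =>
    cases h' with | comp _ h' h₁ h₂ => exact D.comp_congr n (iha h₁) (ihb h₂) h h'

theorem Eval.sound {D : OmegaCat.{u}} {f : X → D.carrier}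
    (hf : ∀ a b, E a b → ∃ v, Eval D f a v ∧ Eval D f b v) {a b : Expr X} (h : Rel E a b) :
    ∃ v, Eval D f a v ∧ Eval D f b v := by
  induction h with
  | of x => exact ⟨_, .of x, .of x⟩
  | rel h => exact hf _ _ h
  | symm _ ih => obtain ⟨v, h₁, h₂⟩ := ih; exact ⟨v, h₂, h₁⟩
  | trans _ _ ih ih' =>
    obtain ⟨v, h₁, h₂⟩ := ih
    obtain ⟨w, h₃, h₄⟩ := ih'
    obtain rfl := h₂.unique h₃
    exact ⟨v, h₁, h₄⟩
  | d_congr α n _ ih => obtain ⟨v, h₁, h₂⟩ := ih; exact ⟨_, h₁.d α n, h₂.d α n⟩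
  | comp_congr n _ _ _ ih₁ ih₂ ih₃ =>
    obtain ⟨v, h₁, h₂⟩ := ih₁
    obtain ⟨w, h₃, h₄⟩ := ih₂
    obtain ⟨z, h₅, h₆⟩ := ih₃
    have e := ((h₁.d .tgt n).unique h₅).trans (h₆.unique (h₃.d .src n))
    exact ⟨_, .comp n e h₁ h₃, .comp n e h₂ h₄⟩
  | d_arg _ ih => obtain ⟨v, h₁, _⟩ := ih; cases h₁ with | d _ _ h => exact ⟨_, h, h⟩
  | comp_left _ ih => obtain ⟨v, h₁, _⟩ := ih; cases h₁ with | comp _ _ h _ => exact ⟨_, h, h⟩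
  | comp_right _ ih => obtain ⟨v, h₁, _⟩ := ih; cases h₁ with | comp _ _ _ h => exact ⟨_, h, h⟩
  | comp_def _ ih =>
    obtain ⟨v, h₁, _⟩ := ih
    cases h₁ with | comp _ e h h' => exact ⟨_, h.d .tgt _, e ▸ h'.d .src _⟩
  | d_d_lt α β m n _ hmn ih =>
    obtain ⟨v, h, _⟩ := ih
    exact ⟨_, (h.d α n).d β m, D.d_d_lt α β m n v hmn ▸ h.d β m⟩
  | d_d_ge α β m n _ hmn ih =>
    obtain ⟨v, h, _⟩ := ih
    exact ⟨_, D.d_d_ge α β m n v hmn ▸ (h.d α n).d β m, h.d α n⟩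
  | src_unit n _ ih =>
    obtain ⟨v, h, _⟩ := ih
    have e := D.d_d_ge .src .tgt n n v le_rfl
    exact ⟨v, by simpa only [D.src_unit n v e] using Eval.comp n e (h.d .src n) h, h⟩
  | tgt_unit n _ ih =>
    obtain ⟨v, h, _⟩ := ih
    have e := (D.d_d_ge .tgt .src n n v le_rfl).symm
    exact ⟨v, by simpa only [D.tgt_unit n v e] using Eval.comp n e h (h.d .tgt n), h⟩
  | src_comp _ ih =>
    obtain ⟨v, h₁, _⟩ := ih
    cases h₁ with
    | comp _ e h h' => exact ⟨_, D.src_comp _ _ _ e ▸ (Eval.comp _ e h h').d .src _, h.d .src _⟩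
  | tgt_comp _ ih =>
    obtain ⟨v, h₁, _⟩ := ih
    cases h₁ with
    | comp _ e h h' => exact ⟨_, D.tgt_comp _ _ _ e ▸ (Eval.comp _ e h h').d .tgt _, h'.d .tgt _⟩
  | d_comp α m _ hmn ih =>
    obtain ⟨v, h₁, _⟩ := ih
    cases h₁ with
    | comp _ e h h' =>
      obtain ⟨e', he⟩ := D.d_comp α m _ _ _ e hmn
      exact ⟨_, he ▸ (Eval.comp _ e h h').d α m, .comp _ e' (h.d α m) (h'.d α m)⟩
  | assoc _ _ ih₁ ih₂ =>
    obtain ⟨v, h, _⟩ := ih₁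
    obtain ⟨w, h', _⟩ := ih₂
    suffices v = w by subst this; exact ⟨v, h, h'⟩
    cases h with
    | comp _ e₁ h₁ h₂ =>
      cases h₁ with
      | comp _ e₂ h₃ h₄ =>
        cases h' with
        | comp _ e₃ k₁ k₂ =>
          cases k₂ with
          | comp _ e₄ k₃ k₄ =>
            obtain rfl := h₃.unique k₁
            obtain rfl := h₄.unique k₃
            obtain rfl := h₂.unique k₄
            exact D.assoc _ _ _ _ _ _ _ _
  | interchange _ _ hmn ih₁ ih₂ =>
    obtain ⟨v, h, _⟩ := ih₁
    obtain ⟨w, h', _⟩ := ih₂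
    suffices v = w by subst this; exact ⟨v, h, h'⟩
    cases h with
    | comp _ e₁ h₁ h₂ =>
      cases h₁ with
      | comp _ e₂ a₁ b₁ =>
        cases h₂ with
        | comp _ e₃ c₁ d₁ =>
          cases h' with
          | comp _ e₄ k₁ k₂ =>
            cases k₁ with
            | comp _ e₅ a₂ c₂ =>
              cases k₂ with
              | comp _ e₆ b₂ d₂ =>
                obtain rfl := a₁.unique a₂
                obtain rfl := b₁.unique b₂
                obtain rfl := c₁.unique c₂
                obtain rfl := d₁.unique d₂
                exact D.interchange _ _ _ _ _ _ _ _ _ _ _ _ hmn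

/-- A map on the generators that respects the relations extends to an omega-functor. -/
noncomputable def presLift {D : OmegaCat.{u}} (f : X → D.carrier)
    (hf : ∀ a b, E a b → ∃ v, Eval D f a v ∧ Eval D f b v) : pres E hE ⟶ D where
  toFun := Quotient.lift (fun a => (Eval.sound hf a.2).choose) (fun a b h => by
    obtain ⟨v, h₁, h₂⟩ := Eval.sound hf h
    rw [(Eval.sound hf a.2).choose_spec.1.unique h₁, (Eval.sound hf b.2).choose_spec.1.unique h₂])
  map_d α n x := by
    obtain ⟨a, ha, rfl⟩ := pres_ind x
    exact (Eval.sound hf (ha.d_congr α n)).choose_spec.1.unique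
      ((Eval.sound hf ha).choose_spec.1.d α n)
  map_comp n x y h h' := by
    obtain ⟨a, ha, rfl⟩ := pres_ind x
    obtain ⟨b, hb, rfl⟩ := pres_ind y
    obtain ⟨hab, e⟩ := presComp_mk n _ _ _ _ h
    refine (congrArg _ e).trans ?_
    exact (Eval.sound hf hab).choose_spec.1.unique
      (.comp n h' (Eval.sound hf ha).choose_spec.1 (Eval.sound hf hb).choose_spec.1)

theorem presLift_of {D : OmegaCat.{u}} (f : X → D.carrier)
    (hf : ∀ a b, E a b → ∃ v, Eval D f a v ∧ Eval D f b v) (x : X) :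
    (presLift hE f hf).toFun (presOf E hE x) = f x :=
  (Eval.sound hf (.of x)).choose_spec.1.unique (.of x)

theorem presHom_ext {D : OmegaCat.{u}} {f g : pres E hE ⟶ D}
    (h : ∀ x, f.toFun (presOf E hE x) = g.toFun (presOf E hE x)) : f = g := by
  apply hom_ext
  intro x
  obtain ⟨a, ha, rfl⟩ := pres_ind x
  induction a with
  | of x => exact h x
  | d α n a ih =>
    exact (f.map_d α n (presMk E a ha.d_arg)).trans
      ((congrArg _ (ih ha.d_arg)).trans (g.map_d α n (presMk E a ha.d_arg)).symm)
  | comp n a b iha ihb =>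
    have h₀ : (pres E hE).d .tgt n (presMk E a ha.comp_left) =
      (pres E hE).d .src n (presMk E b ha.comp_right) := (presMk_eq _ _).2 ha.comp_def
    obtain ⟨hab, e⟩ := presComp_mk n _ _ _ _ h₀
    have hf : D.d .tgt n (f.toFun (presMk E a ha.comp_left)) =
        D.d .src n (f.toFun (presMk E b ha.comp_right)) := f.compat h₀
    have hg : D.d .tgt n (g.toFun (presMk E a ha.comp_left)) =
        D.d .src n (g.toFun (presMk E b ha.comp_right)) := g.compat h₀
    have h₁ := f.map_comp n _ _ h₀ hf
    have h₂ := g.map_comp n _ _ h₀ hg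
    have e' : (pres E hE).comp n _ _ h₀ = presMk E (.comp n a b) ha := e
    rw [e'] at h₁ h₂
    rw [h₁, h₂]
    exact D.comp_congr n (iha _) (ihb _) _ _

end Presentation

/-! ### Pushouts and direct sums of omega-categories -/

section Pushout

variable {A B C : OmegaCat.{u}} (f : A ⟶ B) (g : A ⟶ C)

/-- The relations of the pushout of `B` and `C` under `A`: those of `B`, those of `C`, and the
identification of the two images of every element of `A`. -/
inductive PushoutRel : Expr (B.carrier ⊕ C.carrier) → Expr (B.carrier ⊕ C.carrier) → Prop
  | inl_d (α : Dir) (n : ℕ) (x : B.carrier) :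
      PushoutRel (.d α n (.of (.inl x))) (.of (.inl (B.d α n x)))
  | inl_comp (n : ℕ) (x y : B.carrier) (h : B.d .tgt n x = B.d .src n y) :
      PushoutRel (.comp n (.of (.inl x)) (.of (.inl y))) (.of (.inl (B.comp n x y h)))
  | inr_d (α : Dir) (n : ℕ) (x : C.carrier) :
      PushoutRel (.d α n (.of (.inr x))) (.of (.inr (C.d α n x)))
  | inr_comp (n : ℕ) (x y : C.carrier) (h : C.d .tgt n x = C.d .src n y) :
      PushoutRel (.comp n (.of (.inr x)) (.of (.inr y))) (.of (.inr (C.comp n x y h)))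
  | glue (a : A.carrier) : PushoutRel (.of (.inl (f.toFun a))) (.of (.inr (g.toFun a)))

theorem pushoutRel_finite (x : B.carrier ⊕ C.carrier) :
    ∃ n : ℕ, ∀ α : Dir, PushoutRel f g (.d α n (.of x)) (.of x) := by
  rcases x with x | x
  · obtain ⟨n, hn⟩ := B.finite x
    exact ⟨n, fun α => by simpa only [hn α] using PushoutRel.inl_d (f := f) (g := g) α n x⟩
  · obtain ⟨n, hn⟩ := C.finite x
    exact ⟨n, fun α => by simpa only [hn α] using PushoutRel.inr_d (f := f) (g := g) α n x⟩

/-- The pushout of omega-categories. -/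
noncomputable def pushoutObj : OmegaCat.{u} := pres (PushoutRel f g) (pushoutRel_finite f g)

/-- The first coprojection. -/
noncomputable def pushoutInl : B ⟶ pushoutObj f g where
  toFun x := presOf _ _ (.inl x)
  map_d α n x := ((presMk_eq _ _).2 (.rel (.inl_d α n x))).symm
  map_comp n x y h h' := by
    obtain ⟨_, e⟩ := presComp_mk n _ _ _ _ h'
    exact ((presMk_eq _ _).2 (.symm (.rel (.inl_comp n x y h)))).trans e.symm

/-- The second coprojection. -/
noncomputable def pushoutInr : C ⟶ pushoutObj f g where
  toFun x := presOf _ _ (.inr x)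
  map_d α n x := ((presMk_eq _ _).2 (.rel (.inr_d α n x))).symm
  map_comp n x y h h' := by
    obtain ⟨_, e⟩ := presComp_mk n _ _ _ _ h'
    exact ((presMk_eq _ _).2 (.symm (.rel (.inr_comp n x y h)))).trans e.symm

variable {f g}

/-- The omega-functor out of the pushout given by a commutative square. -/
noncomputable def pushoutDesc {D : OmegaCat.{u}} (h : B ⟶ D) (k : C ⟶ D) (w : f ≫ h = g ≫ k) :
    pushoutObj f g ⟶ D :=
  presLift _ (Sum.elim h.toFun k.toFun) (by
    have key : ∀ (y : B.carrier ⊕ C.carrier) (v : D.carrier), Sum.elim h.toFun k.toFun y = v →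
        Eval D (Sum.elim h.toFun k.toFun) (.of y) v := by
      rintro y v rfl
      exact .of y
    intro a b hab
    cases hab with
    | inl_d α n x => exact ⟨_, .d α n (.of _), key _ _ (h.map_d α n x)⟩
    | inl_comp n x y e =>
      exact ⟨_, .comp n (h.compat e) (.of (Sum.inl x)) (.of (Sum.inl y)),
        key _ _ (h.map_comp n x y e (h.compat e))⟩
    | inr_d α n x => exact ⟨_, .d α n (.of _), key _ _ (k.map_d α n x)⟩
    | inr_comp n x y e =>
      exact ⟨_, .comp n (k.compat e) (.of (Sum.inr x)) (.of (Sum.inr y)),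
        key _ _ (k.map_comp n x y e (k.compat e))⟩
    | glue a => exact ⟨_, .of _, key _ _ (congrArg (fun l => Hom.toFun l a) w).symm⟩)

theorem pushoutDesc_of {D : OmegaCat.{u}} (h : B ⟶ D) (k : C ⟶ D) (w : f ≫ h = g ≫ k)
    (x : B.carrier ⊕ C.carrier) :
    (pushoutDesc h k w).toFun (presOf _ _ x) = Sum.elim h.toFun k.toFun x :=
  presLift_of _ _ _ x

variable (f g)

theorem pushout_isPushout : IsPushout f g (pushoutInl f g) (pushoutInr f g) where
  w := hom_ext fun a => (presMk_eq _ _).2 (.rel (.glue a))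
  isColimit' := ⟨PushoutCocone.IsColimit.mk _
    (fun s => pushoutDesc s.inl s.inr s.condition)
    (fun s => hom_ext fun x => pushoutDesc_of _ _ s.condition (.inl x))
    (fun s => hom_ext fun x => pushoutDesc_of _ _ s.condition (.inr x))
    (fun s m h₁ h₂ => presHom_ext _ (by
      rintro (x | x)
      · exact (congrArg (fun k => Hom.toFun k x) h₁).trans
          (pushoutDesc_of _ _ s.condition (.inl x)).symm
      · exact (congrArg (fun k => Hom.toFun k x) h₂).trans
          (pushoutDesc_of _ _ s.condition (.inr x)).symm))⟩

instance : HasPushouts OmegaCat.{u} :=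
  haveI : ∀ {A B C : OmegaCat.{u}} {f : A ⟶ B} {g : A ⟶ C}, HasColimit (span f g) :=
    fun {_ _ _ f g} => (pushout_isPushout f g).hasPushout
  hasPushouts_of_hasColimit_span _

end Pushout

section DirectSum

variable {ι : Type u} (D : ι → OmegaCat.{u})

/-- The direct sum of a family of omega-categories: the disjoint union of the underlying sets. -/
def directSum : OmegaCat.{u} where
  carrier := Σ i, (D i).carrier
  d α n x := ⟨x.1, (D x.1).d α n x.2⟩
  comp n x y h := ⟨x.1, (D x.1).comp n x.2 ((Sigma.mk.inj h).1.symm ▸ y.2) (by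
    obtain ⟨i, x⟩ := x
    obtain ⟨j, y⟩ := y
    obtain rfl : i = j := (Sigma.mk.inj h).1
    exact eq_of_heq (Sigma.mk.inj h).2)⟩
  d_d_lt α β m n x h := by rw [(D x.1).d_d_lt α β m n x.2 h]
  d_d_ge α β m n x h := by rw [(D x.1).d_d_ge α β m n x.2 h]
  src_unit n x h := congrArg (Sigma.mk x.1) ((D x.1).src_unit n x.2 (eq_of_heq (Sigma.mk.inj h).2))
  tgt_unit n x h := congrArg (Sigma.mk x.1) ((D x.1).tgt_unit n x.2 (eq_of_heq (Sigma.mk.inj h).2))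
  src_comp n x y h := by
    obtain ⟨i, x⟩ := x
    obtain ⟨j, y⟩ := y
    obtain rfl : i = j := (Sigma.mk.inj h).1
    exact congrArg (Sigma.mk i) ((D i).src_comp n x y (eq_of_heq (Sigma.mk.inj h).2))
  tgt_comp n x y h := by
    obtain ⟨i, x⟩ := x
    obtain ⟨j, y⟩ := y
    obtain rfl : i = j := (Sigma.mk.inj h).1
    exact congrArg (Sigma.mk i) ((D i).tgt_comp n x y (eq_of_heq (Sigma.mk.inj h).2))
  d_comp α m n x y h hmn := by
    obtain ⟨i, x⟩ := x
    obtain ⟨j, y⟩ := y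
    obtain rfl : i = j := (Sigma.mk.inj h).1
    obtain ⟨h', e⟩ := (D i).d_comp α m n x y (eq_of_heq (Sigma.mk.inj h).2) hmn
    exact ⟨congrArg (Sigma.mk i) h', congrArg (Sigma.mk i) e⟩
  assoc n x y z hxy hyz h₁ h₂ := by
    obtain ⟨i, x⟩ := x
    obtain ⟨j, y⟩ := y
    obtain ⟨k, z⟩ := z
    obtain rfl : i = j := (Sigma.mk.inj hxy).1
    obtain rfl : i = k := (Sigma.mk.inj hyz).1
    exact congrArg (Sigma.mk i) ((D i).assoc n x y z (eq_of_heq (Sigma.mk.inj hxy).2)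
      (eq_of_heq (Sigma.mk.inj hyz).2) (eq_of_heq (Sigma.mk.inj h₁).2)
      (eq_of_heq (Sigma.mk.inj h₂).2))
  interchange m n x y z w hxy hzw h₁ hxz hyw h₂ hmn := by
    obtain ⟨i, x⟩ := x
    obtain ⟨j, y⟩ := y
    obtain ⟨k, z⟩ := z
    obtain ⟨l, w⟩ := w
    obtain rfl : i = j := (Sigma.mk.inj hxy).1
    obtain rfl : i = k := (Sigma.mk.inj hxz).1
    obtain rfl : i = l := (Sigma.mk.inj hyw).1
    exact congrArg (Sigma.mk i) ((D i).interchange m n x y z w (eq_of_heq (Sigma.mk.inj hxy).2)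
      (eq_of_heq (Sigma.mk.inj hzw).2) (eq_of_heq (Sigma.mk.inj h₁).2)
      (eq_of_heq (Sigma.mk.inj hxz).2) (eq_of_heq (Sigma.mk.inj hyw).2)
      (eq_of_heq (Sigma.mk.inj h₂).2) hmn)
  finite x := by
    obtain ⟨n, hn⟩ := (D x.1).finite x.2
    exact ⟨n, fun α => congrArg (Sigma.mk x.1) (hn α)⟩

/-- The coprojections of the direct sum. -/
def directSumIncl (i : ι) : D i ⟶ directSum D where
  toFun x := ⟨i, x⟩
  map_d _ _ _ := rfl
  map_comp _ _ _ _ _ := rfl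

/-- The direct sum is the coproduct in the category of omega-categories. -/
def directSumIsColimit : IsColimit (Cofan.mk (directSum D) (directSumIncl D)) :=
  Cofan.IsColimit.mk _
    (fun s =>
      { toFun := fun x => (s.inj x.1).toFun x.2
        map_d := fun α n x => (s.inj x.1).map_d α n x.2
        map_comp := fun n x y h h' => by
          obtain ⟨i, x⟩ := x
          obtain ⟨j, y⟩ := y
          obtain rfl : i = j := (Sigma.mk.inj h).1
          exact (s.inj i).map_comp n x y (eq_of_heq (Sigma.mk.inj h).2) h' })
    (fun _ _ => rfl)
    (fun s m h => hom_ext fun x => congrArg (fun k => Hom.toFun k x.2) (h x.1))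

end DirectSum

end OmegaCat

/-! ### Globular sets and free omega-categories -/

/-- A globular set. -/
structure GlobSet : Type (u + 1) where
  cells : ℕ → Type u
  s : ∀ n, cells (n + 1) → cells n
  t : ∀ n, cells (n + 1) → cells n
  s_s : ∀ n (x : cells (n + 2)), s n (s (n + 1) x) = s n (t (n + 1) x)
  t_s : ∀ n (x : cells (n + 2)), t n (s (n + 1) x) = t n (t (n + 1) x)

namespace GlobSet

/-- A morphism of globular sets. -/
@[ext]
structure Hom (G H : GlobSet.{u}) : Type u where
  toFun : ∀ n, G.cells n → H.cells n
  map_s : ∀ n (x : G.cells (n + 1)), toFun n (G.s n x) = H.s n (toFun (n + 1) x)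
  map_t : ∀ n (x : G.cells (n + 1)), toFun n (G.t n x) = H.t n (toFun (n + 1) x)

/-- The category of globular sets. -/
instance : Category GlobSet.{u} where
  Hom := Hom
  id G := ⟨fun _ => id, fun _ _ => rfl, fun _ _ => rfl⟩
  comp f g :=
    { toFun := fun n x => g.toFun n (f.toFun n x)
      map_s := fun n x => by rw [f.map_s, g.map_s]
      map_t := fun n x => by rw [f.map_t, g.map_t] }

theorem hom_ext {G H : GlobSet.{u}} {f g : G ⟶ H} (h : ∀ n x, f.toFun n x = g.toFun n x) :
    f = g :=
  Hom.ext (funext fun n => funext fun x => h n x)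

end GlobSet

namespace OmegaCat

/-- The forgetful functor from omega-categories to globular sets: the `n`-cells of the globular
set are the morphisms `x` with `s_n x = t_n x = x`, that is, those of dimension at most `n`. -/
def toGlob : OmegaCat.{u} ⥤ GlobSet.{u} where
  obj C :=
    { cells := fun n => {x : C.carrier // ∀ α, C.d α n x = x}
      s := fun n x => ⟨C.d .src n x.1, fun _ => C.d_d_ge _ _ _ _ _ le_rfl⟩
      t := fun n x => ⟨C.d .tgt n x.1, fun _ => C.d_d_ge _ _ _ _ _ le_rfl⟩
      s_s := fun n x => Subtype.ext (by
        simp only [C.d_d_lt _ _ n (n + 1) _ (Nat.lt_succ_self n)])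
      t_s := fun n x => Subtype.ext (by
        simp only [C.d_d_lt _ _ n (n + 1) _ (Nat.lt_succ_self n)]) }
  map {C D} f :=
    { toFun := fun n x => ⟨f.toFun x.1, fun α => by rw [← f.map_d, x.2 α]⟩
      map_s := fun n x => Subtype.ext (f.map_d _ _ _)
      map_t := fun n x => Subtype.ext (f.map_d _ _ _) }
  map_id _ := rfl
  map_comp _ _ := rfl

section Free

variable (G : GlobSet.{u})

/-- The relations of the free omega-category on a globular set: every `n`-cell is its own
`n`-source and `n`-target, and the sources and targets of cells are those of the globular set. -/
inductive FreeRel : Expr (Σ n, G.cells n) → Expr (Σ n, G.cells n) → Prop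
  | top (α : Dir) (n : ℕ) (x : G.cells n) : FreeRel (.d α n (.of ⟨n, x⟩)) (.of ⟨n, x⟩)
  | src (n : ℕ) (x : G.cells (n + 1)) : FreeRel (.d .src n (.of ⟨n + 1, x⟩)) (.of ⟨n, G.s n x⟩)
  | tgt (n : ℕ) (x : G.cells (n + 1)) : FreeRel (.d .tgt n (.of ⟨n + 1, x⟩)) (.of ⟨n, G.t n x⟩)

/-- The free omega-category generated by a globular set. -/
noncomputable def freeObj : OmegaCat.{u} :=
  pres (FreeRel G) (fun x => ⟨x.1, fun α => .top α x.1 x.2⟩)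

variable {G}

/-- The extension of a morphism of globular sets to the free omega-category. -/
noncomputable def freeLift {D : OmegaCat.{u}} (k : G ⟶ toGlob.obj D) : freeObj G ⟶ D :=
  presLift _ (fun x => (k.toFun x.1 x.2).1) (by
    have key : ∀ (y : Σ n, G.cells n) (v : D.carrier), (k.toFun y.1 y.2).1 = v →
        Eval D (fun x : Σ n, G.cells n => (k.toFun x.1 x.2).1) (.of y) v := by
      rintro y v rfl
      exact .of y
    intro a b hab
    cases hab with
    | top α n x => exact ⟨_, .d α n (.of _), key _ _ ((k.toFun n x).2 α).symm⟩
    | src n x => exact ⟨_, .d .src n (.of _), key _ _ (congrArg Subtype.val (k.map_s n x))⟩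
    | tgt n x => exact ⟨_, .d .tgt n (.of _), key _ _ (congrArg Subtype.val (k.map_t n x))⟩)

theorem freeLift_of {D : OmegaCat.{u}} (k : G ⟶ toGlob.obj D) (x : Σ n, G.cells n) :
    (freeLift k).toFun (presOf _ _ x) = (k.toFun x.1 x.2).1 :=
  presLift_of _ _ _ x

variable (G)

/-- Omega-functors out of the free omega-category on `G` are morphisms of globular sets
out of `G`. -/
noncomputable def freeEquiv (D : OmegaCat.{u}) : (freeObj G ⟶ D) ≃ (G ⟶ toGlob.obj D) where
  toFun f :=
    { toFun := fun n x => ⟨f.toFun (presOf _ _ ⟨n, x⟩), fun α =>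
        (f.map_d α n _).symm.trans (congrArg f.toFun ((presMk_eq _ _).2 (.rel (.top α n x))))⟩
      map_s := fun n x => Subtype.ext
        ((congrArg f.toFun ((presMk_eq _ _).2 (.symm (.rel (.src n x))))).trans
          (f.map_d .src n (presOf _ _ ⟨n + 1, x⟩)))
      map_t := fun n x => Subtype.ext
        ((congrArg f.toFun ((presMk_eq _ _).2 (.symm (.rel (.tgt n x))))).trans
          (f.map_d .tgt n (presOf _ _ ⟨n + 1, x⟩))) }
  invFun k := freeLift k
  left_inv _ := presHom_ext _ fun x => freeLift_of _ x
  right_inv k := GlobSet.hom_ext fun n x => Subtype.ext (freeLift_of k ⟨n, x⟩)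

theorem freeEquiv_naturality (D D' : OmegaCat.{u}) (g : D ⟶ D') (h : freeObj G ⟶ D) :
    freeEquiv G D' (h ≫ g) = freeEquiv G D h ≫ toGlob.map g := rfl

/-- The free omega-category functor. -/
noncomputable def free : GlobSet.{u} ⥤ OmegaCat.{u} :=
  Adjunction.leftAdjointOfEquiv (G := toGlob) (F_obj := freeObj) freeEquiv
    freeEquiv_naturality

/-- The free omega-category functor is left adjoint to the forgetful functor. -/
noncomputable def freeAdj : free.{u} ⊣ toGlob.{u} :=
  Adjunction.adjunctionOfEquivLeft freeEquiv freeEquiv_naturality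

end Free

/-! ### The path omega-category and the negative semi-path omega-category -/

section Path

variable (C : OmegaCat.{u})

/-- An omega-category is non-contracting when the `1`-source and the `1`-target of every morphism
of dimension at least `1` are of dimension `1`. -/
def NonContracting : Prop :=
  ∀ x : C.carrier, 1 ≤ C.dim x → ∀ α : Dir, C.dim (C.d α 1 x) = 1

variable {C}

theorem one_le_dim_iff (x : C.carrier) : 1 ≤ C.dim x ↔ ¬ ∀ α, C.d α 0 x = x := by
  rw [Nat.one_le_iff_ne_zero, not_iff_not, dim, Nat.sInf_eq_zero]
  refine ⟨fun h => h.resolve_right ?_, Or.inl⟩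
  obtain ⟨n, hn⟩ := C.finite x
  exact Set.Nonempty.ne_empty ⟨n, hn⟩

theorem dim_eq_one {x : C.carrier} (h₁ : ∀ α, C.d α 1 x = x) (h₀ : ¬ ∀ α, C.d α 0 x = x) :
    C.dim x = 1 :=
  le_antisymm (Nat.sInf_le h₁) ((one_le_dim_iff x).2 h₀)

theorem NonContracting.dim_d (hC : C.NonContracting) {x : C.carrier} (hx : 1 ≤ C.dim x) (α : Dir)
    (n : ℕ) : 1 ≤ C.dim (C.d α (n + 1) x) := by
  rcases n with _ | n
  · exact (hC x hx α).ge
  · rw [one_le_dim_iff]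
    intro h
    refine (one_le_dim_iff (C.d .src 1 x)).1 (hC x hx .src).ge fun β => ?_
    have h₁ : C.d .src 1 x = C.d α (n + 2) x := by
      rw [← C.d_d_lt α .src 1 (n + 2) x (by omega), ← h .src, C.d_d_ge _ _ _ _ _ (by omega)]
    rw [h₁, h β]

theorem NonContracting.dim_comp (hC : C.NonContracting) {x y : C.carrier} (hx : 1 ≤ C.dim x)
    (n : ℕ) (h : C.d .tgt (n + 1) x = C.d .src (n + 1) y) :
    1 ≤ C.dim (C.comp (n + 1) x y h) := by
  rw [one_le_dim_iff]
  intro h₀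
  refine (one_le_dim_iff _).1 (hC.dim_d hx .src n) ?_
  have h₁ : C.comp (n + 1) x y h = C.d .src (n + 1) x := by
    rw [← C.src_comp (n + 1) x y h, ← h₀ .src, C.d_d_ge _ _ _ _ _ (by omega)]
  rwa [h₁] at h₀

variable (C)

/-- The path omega-category of a non-contracting omega-category: its morphisms are the morphisms
of dimension at least `1`, and all indices are shifted by `1`. -/
def path (hC : C.NonContracting) : OmegaCat.{u} where
  carrier := {x : C.carrier // 1 ≤ C.dim x}
  d α n x := ⟨C.d α (n + 1) x.1, hC.dim_d x.2 α n⟩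
  comp n x y h := ⟨C.comp (n + 1) x.1 y.1 (congrArg Subtype.val h), hC.dim_comp x.2 n _⟩
  d_d_lt α β m n x h := Subtype.ext (C.d_d_lt α β (m + 1) (n + 1) x.1 (by omega))
  d_d_ge α β m n x h := Subtype.ext (C.d_d_ge α β (m + 1) (n + 1) x.1 (by omega))
  src_unit n x h := Subtype.ext (C.src_unit (n + 1) x.1 (congrArg Subtype.val h))
  tgt_unit n x h := Subtype.ext (C.tgt_unit (n + 1) x.1 (congrArg Subtype.val h))
  src_comp n x y h := Subtype.ext (C.src_comp (n + 1) x.1 y.1 (congrArg Subtype.val h))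
  tgt_comp n x y h := Subtype.ext (C.tgt_comp (n + 1) x.1 y.1 (congrArg Subtype.val h))
  d_comp α m n x y h hmn := by
    obtain ⟨h', e⟩ := C.d_comp α (m + 1) (n + 1) x.1 y.1 (congrArg Subtype.val h) (by omega)
    exact ⟨Subtype.ext h', Subtype.ext e⟩
  assoc n x y z hxy hyz h₁ h₂ := Subtype.ext (C.assoc (n + 1) x.1 y.1 z.1
    (congrArg Subtype.val hxy) (congrArg Subtype.val hyz) (congrArg Subtype.val h₁)
    (congrArg Subtype.val h₂))
  interchange m n x y z w hxy hzw h₁ hxz hyw h₂ hmn := Subtype.ext (C.interchange (m + 1) (n + 1)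
    x.1 y.1 z.1 w.1 (congrArg Subtype.val hxy) (congrArg Subtype.val hzw)
    (congrArg Subtype.val h₁) (congrArg Subtype.val hxz) (congrArg Subtype.val hyw)
    (congrArg Subtype.val h₂) (by omega))
  finite x := by
    obtain ⟨n, hn⟩ := C.finite x.1
    refine ⟨n, fun α => Subtype.ext ?_⟩
    have h := C.d_d_ge .src α (n + 1) n x.1 (by omega)
    rwa [hn .src] at h

variable {C}

/-- The pairs `(x, x *_0 y)`, where `x`, `y` and `x *_0 y` are of dimension at least `1`. -/
def NegStep (hC : C.NonContracting) (x z : (C.path hC).carrier) : Prop :=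
  ∃ (y : (C.path hC).carrier) (h : C.d .tgt 0 x.1 = C.d .src 0 y.1), z.1 = C.comp 0 x.1 y.1 h

/-- The equivalence relation `R^-` on the path omega-category: the reflexive, symmetric and
transitive closure of the set of pairs `(x, x *_0 y)`. -/
def NegRel (hC : C.NonContracting) : (C.path hC).carrier → (C.path hC).carrier → Prop :=
  Relation.EqvGen (NegStep hC)

theorem NegRel.d {hC : C.NonContracting} {x z : (C.path hC).carrier} (h : NegRel hC x z)
    (α : Dir) (n : ℕ) : NegRel hC ((C.path hC).d α n x) ((C.path hC).d α n z) := by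
  induction h with
  | rel x z h =>
    obtain ⟨y, h, e⟩ := h
    obtain ⟨h', e'⟩ := C.d_comp α (n + 1) 0 x.1 y.1 h (by omega)
    exact .rel _ _ ⟨(C.path hC).d α n y, h', (congrArg (C.d α (n + 1)) e).trans e'⟩
  | refl x => exact .refl _
  | symm _ _ _ ih => exact ih.symm
  | trans _ _ _ _ _ ih ih' => exact ih.trans _ _ _ ih'

/-- The relation `R^-` on the `n`-cells of the globular set of the path omega-category. -/
def negSetoid (hC : C.NonContracting) (n : ℕ) : Setoid ((toGlob.obj (C.path hC)).cells n) where
  r x z := NegRel hC x.1 z.1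
  iseqv := ⟨fun _ => .refl _, fun h => h.symm, fun h h' => h.trans _ _ _ h'⟩

/-- The quotient by `R^-` of the globular set of the path omega-category. -/
def negQuot (hC : C.NonContracting) : GlobSet.{u} where
  cells n := Quotient (negSetoid hC n)
  s n := Quotient.map ((toGlob.obj (C.path hC)).s n) (fun _ _ h => NegRel.d h .src n)
  t n := Quotient.map ((toGlob.obj (C.path hC)).t n) (fun _ _ h => NegRel.d h .tgt n)
  s_s n x := by
    induction x using Quotient.inductionOn with
    | h x => exact congrArg (Quotient.mk _) ((toGlob.obj (C.path hC)).s_s n x)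
  t_s n x := by
    induction x using Quotient.inductionOn with
    | h x => exact congrArg (Quotient.mk _) ((toGlob.obj (C.path hC)).t_s n x)

/-- The canonical morphism of globular sets onto the quotient by `R^-`. -/
def negProj (hC : C.NonContracting) : toGlob.obj (C.path hC) ⟶ negQuot hC where
  toFun n x := Quotient.mk (negSetoid hC n) x
  map_s _ _ := rfl
  map_t _ _ := rfl

variable (C)

/-- The negative semi-path omega-category of a non-contracting omega-category: the pushout of
`F(phi) : F U (P C) ⟶ F (U (P C) / R^-)` and of the counit `F U (P C) ⟶ P C`. -/
noncomputable def negSemiPath (hC : C.NonContracting) : OmegaCat.{u} :=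
  pushout (free.map (negProj hC)) (freeAdj.counit.app (C.path hC))

end Path

end OmegaCat

/-! ### Omega-categories of sets of faces -/

/-- A system of faces with a subface relation, dimensions, and for every face `x` the set
`bd .src x` of its source facets and the set `bd .tgt x` of its target facets. The last law, which
cubes and simplices satisfy, says that a proper subface `a` of `c` which is in no `β`-facet of `c`
is in a facet of `c` no `α`-facet of which contains `a`; it makes the sets `d_n^α R(x)` below
increase with `n`. -/
structure FaceSystem : Type 1 where
  face : Type
  sub : face → face → Prop
  dim : face → ℕ
  bd : Dir → face → Set face
  sub_refl : ∀ a, sub a a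
  sub_trans : ∀ a b c, sub a b → sub b c → sub a c
  dim_le : ∀ a b, sub a b → dim a ≤ dim b
  exists_facet : ∀ (α β : Dir) (a c : face), sub a c → dim a < dim c →
    (∀ e ∈ bd β c, ¬ sub a e) →
    ∃ b, sub a b ∧ sub b c ∧ dim b + 1 = dim c ∧ ∀ e ∈ bd α b, ¬ sub a e

namespace FaceSystem

variable (K : FaceSystem)

/-- The set `R(X)` of all subfaces of the elements of `X`. -/
def R (X : Set K.face) : Set K.face := {a | ∃ x ∈ X, K.sub a x}

/-- A set of faces `X`, recorded together with its iterated sources and targets: `lvl n .src` is the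
set of faces `d_n^- X` and `lvl n .tgt` is the set of faces `d_n^+ X`. These sets increase with `n`
and are equal to `X` for `n` large enough. -/
@[ext]
structure Table : Type where
  lvl : ℕ → Dir → Set K.face
  mono : ∀ n α β, lvl n α ⊆ lvl (n + 1) β
  stable : ∃ N, ∀ n, N ≤ n → ∀ α, lvl n α = lvl N .src

namespace Table

variable {K}

theorem mono_lt (x : K.Table) {m n : ℕ} (h : m < n) (α β : Dir) : x.lvl m α ⊆ x.lvl n β := by
  induction n, Nat.succ_le_of_lt h using Nat.le_induction generalizing β with
  | base => exact x.mono m α β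
  | succ n hn ih => exact (ih (Nat.lt_of_succ_le hn) .src).trans (x.mono n .src β)

/-- The sets `d_m^β X`, recorded with their own sources and targets. -/
def d (β : Dir) (m : ℕ) (x : K.Table) : K.Table where
  lvl n α := if n < m then x.lvl n α else x.lvl m β
  mono n α γ := by
    split_ifs with h₁ h₂ h₂
    · exact x.mono n α γ
    · obtain rfl : m = n + 1 := by omega
      exact x.mono n α β
    · omega
    · exact subset_rfl
  stable := ⟨m, fun n hn α => by simp [Nat.not_lt.2 hn]⟩

theorem d_lvl (β : Dir) (m : ℕ) (x : K.Table) (n : ℕ) (α : Dir) :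
    (d β m x).lvl n α = if n < m then x.lvl n α else x.lvl m β := rfl

theorem composable_iff {n : ℕ} {x y : K.Table} : d .tgt n x = d .src n y ↔
    (∀ k < n, ∀ α, x.lvl k α = y.lvl k α) ∧ x.lvl n .tgt = y.lvl n .src := by
  constructor
  · intro h
    refine ⟨fun k hk α => ?_, ?_⟩
    · have := congrArg (fun z => Table.lvl z k α) h
      simpa [d_lvl, hk] using this
    · have := congrArg (fun z => Table.lvl z n .src) h
      simpa [d_lvl] using this
  · rintro ⟨h₁, h₂⟩
    ext k α : 3
    by_cases hk : k < n
    · simp [d_lvl, hk, h₁ k hk α]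
    · simp [d_lvl, hk, h₂]

/-- The composition `X *_n Y`, whose underlying set of faces is `X ∪ Y`. -/
def comp (n : ℕ) (x y : K.Table) (h : d .tgt n x = d .src n y) : K.Table where
  lvl k α := if k < n then x.lvl k α else if k = n then
    (match α with
      | .src => x.lvl n .src
      | .tgt => y.lvl n .tgt) else x.lvl k α ∪ y.lvl k α
  mono k α β := by
    obtain ⟨h₁, h₂⟩ := composable_iff.1 h
    rcases lt_trichotomy (k + 1) n with hk | hk | hk
    · simpa [hk, Nat.lt_of_succ_lt hk] using x.mono k α β
    · subst hk
      cases β with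
      | src => simpa using x.mono k α .src
      | tgt => simpa [h₁ k (Nat.lt_succ_self k) α] using y.mono k α .tgt
    · rcases (Nat.lt_succ_iff.1 hk).eq_or_lt with rfl | hk'
      · cases α with
        | src => simpa using (x.mono n .src β).trans Set.subset_union_left
        | tgt => simpa using (y.mono n .tgt β).trans Set.subset_union_right
      · simp only [hk.not_gt, hk'.not_gt, hk.ne', hk'.ne', if_false]
        exact Set.union_subset_union (x.mono k α β) (y.mono k α β)
  stable := by
    obtain ⟨N, hN⟩ := x.stable
    obtain ⟨M, hM⟩ := y.stable
    refine ⟨max (max N M) (n + 1), fun k hk α => ?_⟩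
    have h₁ : ¬ k < n := by omega
    have h₂ : k ≠ n := by omega
    have h₃ : ¬ max (max N M) (n + 1) < n := by omega
    have h₄ : max (max N M) (n + 1) ≠ n := by omega
    simp only [h₁, h₂, h₃, h₄, if_false]
    rw [hN k (by omega), hM k (by omega), hN (max (max N M) (n + 1)) (by omega),
      hM (max (max N M) (n + 1)) (by omega)]

theorem comp_lvl (n : ℕ) (x y : K.Table) (h : d .tgt n x = d .src n y) (k : ℕ) (α : Dir) :
    (comp n x y h).lvl k α = if k < n then x.lvl k α else if k = n then
      (match α with
        | .src => x.lvl n .src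
        | .tgt => y.lvl n .tgt) else x.lvl k α ∪ y.lvl k α := rfl

end Table

/-- The omega-category of all such families of sets of faces. -/
def tables : OmegaCat.{0} where
  carrier := K.Table
  d := Table.d
  comp := Table.comp
  d_d_lt α β m n x h := by
    ext k γ : 3
    simp only [Table.d_lvl]
    split_ifs <;> first | rfl | omega
  d_d_ge α β m n x h := by
    ext k γ : 3
    simp only [Table.d_lvl]
    split_ifs <;> first | rfl | omega
  src_unit n x h := by
    ext k γ : 3
    simp only [Table.d_lvl, Table.comp_lvl]
    rcases lt_trichotomy k n with hk | rfl | hk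
    · simp [hk]
    · cases γ <;> simp
    · simpa [hk.not_gt, hk.ne'] using x.mono_lt hk _ _
  tgt_unit n x h := by
    ext k γ : 3
    simp only [Table.d_lvl, Table.comp_lvl]
    rcases lt_trichotomy k n with hk | rfl | hk
    · simp [hk]
    · cases γ <;> simp
    · simpa [hk.not_gt, hk.ne'] using x.mono_lt hk _ _
  src_comp n x y h := by
    ext k γ : 3
    simp only [Table.d_lvl, Table.comp_lvl]
    split_ifs <;> rfl
  tgt_comp n x y h := by
    obtain ⟨h₁, h₂⟩ := Table.composable_iff.1 h
    ext k γ : 3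
    simp only [Table.d_lvl, Table.comp_lvl]
    split_ifs with hk <;> first | rw [h₁ k hk] | rfl | omega
  d_comp α m n x y h hmn := by
    obtain ⟨h₁, h₂⟩ := Table.composable_iff.1 h
    refine ⟨Table.composable_iff.2 ⟨fun k hk β => ?_, ?_⟩, ?_⟩
    · simp only [Table.d_lvl]
      split_ifs with h₃
      · exact h₁ k hk β
      · exact h₁ m (by omega) α
    · simp only [Table.d_lvl]
      split_ifs with h₃
      · exact h₂
      · exact h₁ m (by omega) α
    · ext k γ : 3
      simp only [Table.d_lvl, Table.comp_lvl]
      rcases lt_or_gt_of_ne hmn with hm | hm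
      · have e := h₁ m hm α
        cases γ <;> split_ifs <;> first | rfl | omega | simp [e]
      · cases γ <;> split_ifs <;> first | rfl | omega
  assoc n x y z hxy hyz h₁ h₂ := by
    ext k γ : 3
    simp only [Table.comp_lvl]
    cases γ <;> split_ifs <;> first | rfl | omega | rw [Set.union_assoc]
  interchange m n x y z w hxy hzw h₁ hxz hyw h₂ hmn := by
    obtain ⟨a₁, a₂⟩ := Table.composable_iff.1 hxy
    obtain ⟨b₁, b₂⟩ := Table.composable_iff.1 hzw
    obtain ⟨c₁, c₂⟩ := Table.composable_iff.1 hxz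
    obtain ⟨e₁, e₂⟩ := Table.composable_iff.1 hyw
    ext k γ : 3
    simp only [Table.comp_lvl]
    cases γ <;> split_ifs <;> first | rfl | omega | rw [Set.union_union_union_comm]
  finite x := by
    obtain ⟨N, hN⟩ := x.stable
    refine ⟨N, fun α => ?_⟩
    ext k γ : 3
    rw [Table.d_lvl]
    split_ifs with h
    · rfl
    · rw [hN N le_rfl, hN k (not_lt.1 h)]

/-- The sets `d_n^α R(x)` for a face `x`: the union of the `R(a)` for all the subfaces `a` of `x` of
dimension at most `n`, minus the union of `R(b) \ R(bd α b)` for all the subfaces `b` of `x` of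
dimension `n + 1`. -/
def atomLvl (x : K.face) (n : ℕ) (α : Dir) : Set K.face :=
  (⋃ a ∈ {a | a ∈ K.R {x} ∧ K.dim a ≤ n}, K.R {a}) \
    ⋃ b ∈ {b | b ∈ K.R {x} ∧ K.dim b = n + 1}, (K.R {b} \ K.R (K.bd α b))

variable {K}

theorem mem_atomLvl {x a : K.face} {n : ℕ} {α : Dir} : a ∈ K.atomLvl x n α ↔
    K.sub a x ∧ K.dim a ≤ n ∧
      ∀ b, K.sub b x → K.dim b = n + 1 → K.sub a b → ∃ e ∈ K.bd α b, K.sub a e := by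
  simp only [atomLvl, R, Set.mem_sdiff, Set.mem_iUnion, Set.mem_ofPred_eq, Set.mem_singleton_iff,
    exists_eq_left, exists_prop, not_exists, not_and, and_imp]
  constructor
  · rintro ⟨⟨b, ⟨hb, hbn⟩, hab⟩, h⟩
    refine ⟨K.sub_trans _ _ _ hab hb, (K.dim_le _ _ hab).trans hbn,
      fun c hc hcn hac => ?_⟩
    by_contra! hcon
    exact h c hc hcn hac hcon
  · rintro ⟨h₁, h₂, h₃⟩
    refine ⟨⟨a, ⟨h₁, h₂⟩, K.sub_refl a⟩, fun b hb hbn hab hcon => ?_⟩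
    obtain ⟨e, he, hae⟩ := h₃ b hb hbn hab
    exact hcon e he hae

/-- The atom `R(x)`, recorded with its iterated sources and targets. -/
def atom (x : K.face) : K.Table where
  lvl := K.atomLvl x
  mono n α β a ha := by
    rw [mem_atomLvl] at ha ⊢
    obtain ⟨h₁, h₂, h₃⟩ := ha
    refine ⟨h₁, by omega, fun c hc hcn hac => ?_⟩
    by_contra! hcon
    obtain ⟨b, hab, hbc, hbn, hb⟩ := K.exists_facet α β a c hac (by omega) hcon
    obtain ⟨e, he, hae⟩ := h₃ b (K.sub_trans _ _ _ hbc hc) (by omega) hab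
    exact hb e he hae
  stable := ⟨K.dim x, fun n hn α => by
    ext a
    rw [mem_atomLvl, mem_atomLvl]
    refine and_congr_right fun h => ?_
    have h₁ := K.dim_le _ _ h
    exact ⟨fun _ => ⟨h₁, fun b hb hbn => by have := K.dim_le _ _ hb; omega⟩,
      fun _ => ⟨by omega, fun b hb hbn => by have := K.dim_le _ _ hb; omega⟩⟩⟩

end FaceSystem

namespace OmegaCat

/-- Membership in the sub-omega-category generated by a set `S` of morphisms. -/
inductive Gen (C : OmegaCat.{u}) (S : Set C.carrier) : C.carrier → Prop
  | basic (x : C.carrier) : x ∈ S → Gen C S x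
  | d (α : Dir) (n : ℕ) (x : C.carrier) : Gen C S x → Gen C S (C.d α n x)
  | comp (n : ℕ) (x y : C.carrier) (h : C.d .tgt n x = C.d .src n y) : Gen C S x → Gen C S y →
      Gen C S (C.comp n x y h)

/-- The sub-omega-category of `C` generated by a set `S` of morphisms. -/
def generated (C : OmegaCat.{u}) (S : Set C.carrier) : OmegaCat.{u} where
  carrier := {x : C.carrier // Gen C S x}
  d α n x := ⟨C.d α n x.1, .d α n _ x.2⟩
  comp n x y h := ⟨C.comp n x.1 y.1 (congrArg Subtype.val h), .comp n _ _ _ x.2 y.2⟩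
  d_d_lt α β m n x h := Subtype.ext (C.d_d_lt α β m n x.1 h)
  d_d_ge α β m n x h := Subtype.ext (C.d_d_ge α β m n x.1 h)
  src_unit n x h := Subtype.ext (C.src_unit n x.1 (congrArg Subtype.val h))
  tgt_unit n x h := Subtype.ext (C.tgt_unit n x.1 (congrArg Subtype.val h))
  src_comp n x y h := Subtype.ext (C.src_comp n x.1 y.1 (congrArg Subtype.val h))
  tgt_comp n x y h := Subtype.ext (C.tgt_comp n x.1 y.1 (congrArg Subtype.val h))
  d_comp α m n x y h hmn := by
    obtain ⟨h', e⟩ := C.d_comp α m n x.1 y.1 (congrArg Subtype.val h) hmn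
    exact ⟨Subtype.ext h', Subtype.ext e⟩
  assoc n x y z hxy hyz h₁ h₂ := Subtype.ext (C.assoc n x.1 y.1 z.1
    (congrArg Subtype.val hxy) (congrArg Subtype.val hyz) (congrArg Subtype.val h₁)
    (congrArg Subtype.val h₂))
  interchange m n x y z w hxy hzw h₁ hxz hyw h₂ hmn := Subtype.ext (C.interchange m n
    x.1 y.1 z.1 w.1 (congrArg Subtype.val hxy) (congrArg Subtype.val hzw)
    (congrArg Subtype.val h₁) (congrArg Subtype.val hxz) (congrArg Subtype.val hyw)
    (congrArg Subtype.val h₂) hmn)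
  finite x := by
    obtain ⟨n, hn⟩ := C.finite x.1
    exact ⟨n, fun α => Subtype.ext (hn α)⟩

end OmegaCat

/-- The omega-category of a system of faces. Its morphisms are the sets of faces (recorded with their
iterated sources and targets) which are obtained from the atoms `R(x)` by the composition
`X *_n Y = X ∪ Y`, defined when `t_n X = s_n Y`, and by sources and targets. -/
def FaceSystem.omegaCat (K : FaceSystem) : OmegaCat.{0} :=
  K.tables.generated (Set.range (FaceSystem.atom (K := K)))

/-! ### The cubes -/

/-- The sign that replaces, in a source facet (resp. a target facet) of a face of a cube, a zero
preceded by `k` zeros: the `i`-th zero is replaced by `(-1)^i` (resp. `(-1)^(i+1)`). -/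
def cubeSign : Dir → ℕ → SignType
  | .src, k => (-1) ^ (k + 1)
  | .tgt, k => (-1) ^ (k + 2)

theorem cubeSign_ne_zero (α : Dir) (k : ℕ) : cubeSign α k ≠ 0 := by
  cases α <;> exact pow_ne_zero _ (by decide)

theorem cubeSign_succ {α β : Dir} (h : α ≠ β) (k : ℕ) : cubeSign α k = cubeSign β (k + 1) := by
  cases α <;> cases β <;> first | exact absurd rfl h | skip
  · simp [cubeSign, pow_succ]
  · simp [cubeSign, pow_succ]

/-- The number of elements of `Z` which are smaller than `j`. -/
def rankIn {N : ℕ} (Z : Finset (Fin N)) (j : Fin N) : ℕ := (Z.filter (· < j)).card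

theorem rankIn_erase_of_lt {N : ℕ} (Z : Finset (Fin N)) {i j : Fin N} (h : j < i) :
    rankIn (Z.erase i) j = rankIn Z j := by
  unfold rankIn
  congr 1
  ext k
  simp only [Finset.mem_filter, Finset.mem_erase]
  refine ⟨fun ⟨⟨_, h₁⟩, h₂⟩ => ⟨h₁, h₂⟩, fun ⟨h₁, h₂⟩ => ⟨⟨?_, h₁⟩, h₂⟩⟩
  rintro rfl
  exact lt_asymm h h₂

theorem rankIn_erase_of_gt {N : ℕ} (Z : Finset (Fin N)) {i j : Fin N} (hi : i ∈ Z) (h : i < j) :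
    rankIn (Z.erase i) j + 1 = rankIn Z j := by
  unfold rankIn
  rw [Finset.filter_erase]
  exact Finset.card_erase_add_one (Finset.mem_filter.2 ⟨hi, h⟩)

/-- The zeros of a face of the cube. -/
def cubeZeros {N : ℕ} (x : Fin N → SignType) : Finset (Fin N) := Finset.univ.filter (x · = 0)

theorem mem_cubeZeros {N : ℕ} {x : Fin N → SignType} {i : Fin N} : i ∈ cubeZeros x ↔ x i = 0 := by
  simp [cubeZeros]

/-- `a` is a subface of `x`: it is obtained from `x` by replacing zeros. -/
def cubeSub {N : ℕ} (a x : Fin N → SignType) : Prop := ∀ i, x i ≠ 0 → a i = x i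

/-- The source facets and the target facets of a face of the cube. -/
def cubeBd {N : ℕ} (α : Dir) (x : Fin N → SignType) : Set (Fin N → SignType) :=
  {y | ∃ j ∈ cubeZeros x, y = Function.update x j (cubeSign α (rankIn (cubeZeros x) j))}

theorem cubeZeros_update {N : ℕ} (x : Fin N → SignType) (i : Fin N) {s : SignType} (hs : s ≠ 0) :
    cubeZeros (Function.update x i s) = (cubeZeros x).erase i := by
  ext j
  by_cases h : j = i
  · subst h; simp [mem_cubeZeros, hs]
  · simp [mem_cubeZeros, h]

theorem cubeSub_update {N : ℕ} {a x : Fin N → SignType} (h : cubeSub a x) (i : Fin N) {s : SignType}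
    (hs : s ≠ 0) (hx : x i = 0) : cubeSub a (Function.update x i s) ↔ a i = s := by
  constructor
  · intro h'
    simpa using h' i (by simpa using hs)
  · rintro hi j hj
    by_cases hji : j = i
    · subst hji; simpa using hi
    · simp only [Function.update_of_ne hji] at hj ⊢
      exact h j hj

theorem exists_cubeBd_iff {N : ℕ} {a x : Fin N → SignType} (h : cubeSub a x) (α : Dir) :
    (∃ e ∈ cubeBd α x, cubeSub a e) ↔
      ∃ j ∈ cubeZeros x, a j = cubeSign α (rankIn (cubeZeros x) j) := by
  constructor
  · rintro ⟨_, ⟨j, hj, rfl⟩, h'⟩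
    exact ⟨j, hj, (cubeSub_update h j (cubeSign_ne_zero _ _) (mem_cubeZeros.1 hj)).1 h'⟩
  · rintro ⟨j, hj, h'⟩
    exact ⟨_, ⟨j, hj, rfl⟩, (cubeSub_update h j (cubeSign_ne_zero _ _) (mem_cubeZeros.1 hj)).2 h'⟩

/-- An extremal element of a nonempty set `J`: the largest one, or the smallest one. -/
theorem exists_extremal {N : ℕ} (J : Finset (Fin N)) (hJ : J.Nonempty) (α β : Dir) :
    ∃ i ∈ J, ∀ j ∈ J, j ≠ i → (α = β ∧ j < i) ∨ (α ≠ β ∧ i < j) := by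
  by_cases h : α = β
  · exact ⟨J.max' hJ, J.max'_mem hJ, fun j hj hji => .inl ⟨h, lt_of_le_of_ne (J.le_max' j hj) hji⟩⟩
  · exact ⟨J.min' hJ, J.min'_mem hJ,
      fun j hj hji => .inr ⟨h, lt_of_le_of_ne (J.min'_le j hj) hji.symm⟩⟩

theorem cubeZeros_subset {N : ℕ} {a b : Fin N → SignType} (h : cubeSub a b) :
    cubeZeros a ⊆ cubeZeros b := by
  intro i hi
  rw [mem_cubeZeros] at hi ⊢
  by_contra hb
  exact hb (by rw [← h i hb, hi])

/-- The faces of the `N`-cube: words of length `N` in the letters `-`, `0`, `+`. -/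
def cubeFaces (N : ℕ) : FaceSystem where
  face := Fin N → SignType
  sub := cubeSub
  dim x := (cubeZeros x).card
  bd := cubeBd
  sub_refl _ _ _ := rfl
  sub_trans a b c hab hbc i hi := by rw [hab i (by rwa [hbc i hi]), hbc i hi]
  dim_le a b h := Finset.card_le_card (cubeZeros_subset h)
  exists_facet α β a c hac hdim hcon := by
    have hcon' : ¬ ∃ j ∈ cubeZeros c, a j = cubeSign β (rankIn (cubeZeros c) j) := by
      rw [← exists_cubeBd_iff hac]
      rintro ⟨e, he, hae⟩
      exact hcon e he hae
    have hJ : (cubeZeros c \ cubeZeros a).Nonempty := by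
      rw [Finset.sdiff_nonempty]
      intro h
      exact absurd (Finset.card_le_card h) (not_le.2 hdim)
    obtain ⟨i, hi, hmax⟩ := exists_extremal _ hJ α β
    obtain ⟨hic, hia⟩ := Finset.mem_sdiff.1 hi
    have hia' : a i ≠ 0 := fun h => hia (mem_cubeZeros.2 h)
    have hab : cubeSub a (Function.update c i (a i)) :=
      (cubeSub_update hac i hia' (mem_cubeZeros.1 hic)).2 rfl
    have hZ := cubeZeros_update c i hia'
    refine ⟨Function.update c i (a i), hab, ?_, ?_, ?_⟩
    · intro j hj
      have hji : j ≠ i := by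
        rintro rfl
        exact hj (mem_cubeZeros.1 hic)
      exact Function.update_of_ne hji _ _
    · rw [hZ]
      exact Finset.card_erase_add_one hic
    · intro e he hae
      obtain ⟨j, hj, h⟩ := (exists_cubeBd_iff hab α).1 ⟨e, he, hae⟩
      rw [hZ] at hj h
      obtain ⟨hji, hjc⟩ := Finset.mem_erase.1 hj
      have hja : j ∉ cubeZeros a := fun h' =>
        cubeSign_ne_zero _ _ (h.symm.trans (mem_cubeZeros.1 h'))
      refine hcon' ⟨j, hjc, ?_⟩
      rcases hmax j (Finset.mem_sdiff.2 ⟨hjc, hja⟩) hji with ⟨rfl, hlt⟩ | ⟨hne, hlt⟩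
      · rw [h, rankIn_erase_of_lt _ hlt]
      · rw [h, cubeSign_succ hne, rankIn_erase_of_gt _ hic hlt]

/-- The omega-category `I^N` of the `N`-cube. -/
def cube (N : ℕ) : OmegaCat.{0} := (cubeFaces N).omegaCat

/-! ### The simplices -/

/-- The source facets of a face of a simplex are obtained by removing an element in odd position,
and the target facets by removing an element in even position; the first position is `1`. -/
def RemovablePos : Dir → ℕ → Prop
  | .src, p => Odd p
  | .tgt, p => Even p

theorem removablePos_succ {α β : Dir} (h : α ≠ β) (p : ℕ) :
    RemovablePos α p ↔ RemovablePos β (p + 1) := by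
  cases α <;> cases β <;> first | exact absurd rfl h | skip
  · simp [RemovablePos, Nat.even_add_one]
  · simp [RemovablePos, Nat.odd_add_one]

/-- The faces of the simplex with the vertices `0, ..., N`: nonempty sets of vertices, that is,
strictly increasing sequences of vertices. -/
def simplexFaces (N : ℕ) : FaceSystem where
  face := {x : Finset (Fin (N + 1)) // x.Nonempty}
  sub a b := a.1 ⊆ b.1
  dim x := x.1.card - 1
  bd α x := {y | ∃ j ∈ x.1, RemovablePos α (rankIn x.1 j + 1) ∧ y.1 = x.1.erase j}
  sub_refl _ := subset_rfl
  sub_trans _ _ _ h h' := h.trans h'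
  dim_le _ _ h := Nat.sub_le_sub_right (Finset.card_le_card h) 1
  exists_facet α β a c hac hdim hcon := by
    have hJ : (c.1 \ a.1).Nonempty := by
      rw [Finset.sdiff_nonempty]
      intro h
      exact absurd (Nat.sub_le_sub_right (Finset.card_le_card h) 1) (not_le.2 hdim)
    obtain ⟨i, hi, hmax⟩ := exists_extremal _ hJ α β
    obtain ⟨hic, hia⟩ := Finset.mem_sdiff.1 hi
    have hab : a.1 ⊆ c.1.erase i := Finset.subset_erase.2 ⟨hac, hia⟩
    refine ⟨⟨c.1.erase i, a.2.mono hab⟩, hab, Finset.erase_subset _ _, ?_, ?_⟩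
    · have h₁ := Finset.card_erase_add_one hic
      have h₂ := (a.2.mono hab).card_pos
      dsimp only
      omega
    · rintro e ⟨j, hj, hpos, he⟩ hae
      obtain ⟨hji, hjc⟩ := Finset.mem_erase.1 hj
      have hja : j ∉ a.1 := fun h => by
        have := hae h
        rw [he] at this
        exact (Finset.mem_erase.1 this).1 rfl
      have haj : a.1 ⊆ c.1.erase j := Finset.subset_erase.2 ⟨hac, hja⟩
      refine hcon ⟨c.1.erase j, a.2.mono haj⟩ ⟨j, hjc, ?_, rfl⟩ haj
      rcases hmax j (Finset.mem_sdiff.2 ⟨hjc, hja⟩) hji with ⟨rfl, hlt⟩ | ⟨hne, hlt⟩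
      · rwa [rankIn_erase_of_lt _ hlt] at hpos
      · rwa [removablePos_succ hne, rankIn_erase_of_gt _ hic hlt] at hpos

/-- The omega-category `Delta^N` of the `N`-simplex. -/
def simplex (N : ℕ) : OmegaCat.{0} := (simplexFaces N).omegaCat

/-! ### The cubes are non-contracting -/

/-- Edges in the iterated sources and targets of the atoms of the cube. -/
theorem exists_edge {N : ℕ} (x : Fin N → SignType) (hx : 0 < (cubeZeros x).card) (α : Dir) :
    ∃ a ∈ (cubeFaces N).atomLvl x 1 α, (cubeFaces N).dim a ≠ 0 := by
  obtain ⟨i, hi, hmin⟩ := exists_extremal _ (Finset.card_pos.1 hx) .src .tgt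
  have hmin' : ∀ j ∈ cubeZeros x, j ≠ i → i < j := fun j hj hji =>
    (hmin j hj hji).elim (fun h => absurd h.1 (by simp)) (fun h => h.2)
  let a : Fin N → SignType := fun j => if x j ≠ 0 then x j else if j = i then 0 else cubeSign α 1
  have hax : cubeSub a x := fun j hj => by simp [a, hj]
  have hai : a i = 0 := by simp [a, mem_cubeZeros.1 hi]
  have haj : ∀ j ∈ cubeZeros x, j ≠ i → a j = cubeSign α 1 := fun j hj hji => by
    simp [a, mem_cubeZeros.1 hj, hji]
  have hZ : cubeZeros a = {i} := by
    ext j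
    rw [Finset.mem_singleton]
    refine ⟨fun hj => ?_, fun h => h ▸ mem_cubeZeros.2 hai⟩
    by_contra hji
    exact cubeSign_ne_zero α 1 ((haj j (cubeZeros_subset hax hj) hji).symm.trans
      (mem_cubeZeros.1 hj))
  have hdim : (cubeFaces N).dim a = 1 := (congrArg Finset.card hZ).trans (Finset.card_singleton i)
  refine ⟨a, FaceSystem.mem_atomLvl.2 ⟨hax, hdim.le, fun b hb hbn hab => ?_⟩, by omega⟩
  refine (exists_cubeBd_iff hab α).2 ?_
  have hib : i ∈ cubeZeros b := cubeZeros_subset hab (mem_cubeZeros.2 hai)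
  have hcard : (cubeZeros b).card = 2 := hbn
  have hcard' := Finset.card_erase_add_one hib
  obtain ⟨j, hj⟩ := Finset.card_eq_one.1 (show ((cubeZeros b).erase i).card = 1 by omega)
  have hjm : j ∈ (cubeZeros b).erase i := by rw [hj]; exact Finset.mem_singleton_self j
  obtain ⟨hji, hjb⟩ := Finset.mem_erase.1 hjm
  have hjx := cubeZeros_subset hb hjb
  refine ⟨j, hjb, ?_⟩
  have h₁ := rankIn_erase_of_gt _ hib (hmin' j hjx hji)
  have h₂ : rankIn ((cubeZeros b).erase i) j = 0 := by
    rw [hj]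
    simp [rankIn]
  rw [haj j hjx hji, ← h₁, h₂]

theorem OmegaCat.d_of_zero (C : OmegaCat.{u}) {x : C.carrier} (hx : ∀ α, C.d α 0 x = x) (α : Dir)
    (n : ℕ) : C.d α n x = x := by
  have h := C.d_d_ge .src α n 0 x (Nat.zero_le n)
  rwa [hx .src] at h

theorem OmegaCat.comp_of_zero_left (C : OmegaCat.{u}) {x y : C.carrier}
    (hx : ∀ α, C.d α 0 x = x) (n : ℕ) (h : C.d .tgt n x = C.d .src n y) : C.comp n x y h = y := by
  obtain rfl : x = C.d .src n y := by rw [← h, C.d_of_zero hx]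
  exact C.src_unit n y _

theorem OmegaCat.comp_of_zero_right (C : OmegaCat.{u}) {x y : C.carrier}
    (hy : ∀ α, C.d α 0 y = y) (n : ℕ) (h : C.d .tgt n x = C.d .src n y) : C.comp n x y h = x := by
  obtain rfl : y = C.d .tgt n x := by rw [h, C.d_of_zero hy]
  exact C.tgt_unit n x _

theorem gen_cube {N : ℕ} (x : (cubeFaces N).tables.carrier)
    (hx : OmegaCat.Gen (cubeFaces N).tables (Set.range (FaceSystem.atom (K := cubeFaces N))) x) :
    (∀ α, ∀ a ∈ FaceSystem.Table.lvl (K := cubeFaces N) x 0 α, (cubeFaces N).dim a = 0) ∧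
      ((∀ α, (cubeFaces N).tables.d α 0 x = x) ∨
        ∀ α, ∃ a ∈ FaceSystem.Table.lvl (K := cubeFaces N) x 1 α, (cubeFaces N).dim a ≠ 0) := by
  induction hx with
  | basic x hx =>
    obtain ⟨x, rfl⟩ := hx
    refine ⟨fun α a ha => Nat.le_zero.1 (FaceSystem.mem_atomLvl.1 ha).2.1, ?_⟩
    rcases Nat.eq_zero_or_pos (cubeZeros x).card with h | h
    · left
      intro α
      apply FaceSystem.Table.ext
      funext n β
      ext a
      have key : ∀ n β, a ∈ (cubeFaces N).atomLvl x n β ↔ (cubeFaces N).sub a x := by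
        intro n β
        rw [FaceSystem.mem_atomLvl]
        refine ⟨fun h => h.1, fun ha => ⟨ha, ?_, fun b hb hbn => ?_⟩⟩
        · exact (((cubeFaces N).dim_le _ _ ha).trans h.le).trans (Nat.zero_le n)
        · have h₁ : (cubeFaces N).dim b ≤ 0 := ((cubeFaces N).dim_le _ _ hb).trans h.le
          omega
      change (a ∈ if n < 0 then (cubeFaces N).atomLvl x n β else (cubeFaces N).atomLvl x 0 α) ↔
        a ∈ (cubeFaces N).atomLvl x n β
      rw [if_neg (Nat.not_lt_zero n)]
      exact (key 0 α).trans (key n β).symm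
    · exact .inr (exists_edge x h)
  | d α n x _ ih =>
    obtain ⟨h₀, h₁⟩ := ih
    constructor
    · intro β a ha
      replace ha : a ∈ if 0 < n then FaceSystem.Table.lvl (K := cubeFaces N) x 0 β else
        FaceSystem.Table.lvl (K := cubeFaces N) x n α := ha
      split_ifs at ha
      · exact h₀ _ a ha
      · obtain rfl : n = 0 := by omega
        exact h₀ _ a ha
    · rcases Nat.eq_zero_or_pos n with rfl | hn
      · exact .inl fun β => (cubeFaces N).tables.d_d_ge _ _ _ _ _ le_rfl
      · rcases h₁ with h₁ | h₁
        · left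
          intro β
          rw [(cubeFaces N).tables.d_of_zero h₁, h₁ β]
        · right
          intro β
          change ∃ a ∈ if 1 < n then FaceSystem.Table.lvl (K := cubeFaces N) x 1 β else
            FaceSystem.Table.lvl (K := cubeFaces N) x n α, _
          split_ifs with h
          · exact h₁ β
          · obtain rfl : n = 1 := by omega
            exact h₁ α
  | comp n x y h _ _ ihx ihy =>
    obtain ⟨x₀, x₁⟩ := ihx
    obtain ⟨y₀, y₁⟩ := ihy
    constructor
    · intro β a ha
      replace ha := (FaceSystem.Table.comp_lvl (K := cubeFaces N) n x y h 0 β).subset ha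
      split_ifs at ha
      · exact x₀ _ a ha
      · subst n
        cases β with
        | src => exact x₀ _ a ha
        | tgt => exact y₀ _ a ha
      · omega
    · by_cases hx : ∀ α, (cubeFaces N).tables.d α 0 x = x
      · rw [(cubeFaces N).tables.comp_of_zero_left hx]
        exact y₁
      · by_cases hy : ∀ α, (cubeFaces N).tables.d α 0 y = y
        · rw [(cubeFaces N).tables.comp_of_zero_right hy]
          exact x₁
        · have x₂ := x₁.resolve_left hx
          have y₂ := y₁.resolve_left hy
          right
          intro β
          have e := (FaceSystem.Table.comp_lvl (K := cubeFaces N) n x y h 1 β).symm.subset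
          split_ifs at e with h₁ h₂
          · obtain ⟨a, ha, had⟩ := x₂ β
            exact ⟨a, e ha, had⟩
          · subst n
            cases β with
            | src =>
              obtain ⟨a, ha, had⟩ := x₂ .src
              exact ⟨a, e ha, had⟩
            | tgt =>
              obtain ⟨a, ha, had⟩ := y₂ .tgt
              exact ⟨a, e ha, had⟩
          · obtain ⟨a, ha, had⟩ := x₂ β
            exact ⟨a, e (.inl ha), had⟩

theorem cube_nonContracting (N : ℕ) : (cube N).NonContracting := by
  intro x hx α
  rw [OmegaCat.one_le_dim_iff] at hx
  obtain ⟨h₀, h₁⟩ := gen_cube x.1 x.2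
  have h₂ := h₁.resolve_left fun h => hx fun β => Subtype.ext (h β)
  refine OmegaCat.dim_eq_one (fun β => (cube N).d_d_ge _ _ _ _ _ le_rfl) fun h => ?_
  obtain ⟨a, ha, had⟩ := h₂ α
  have e := congrArg (fun z : (cube N).carrier => z.1.lvl 1 .src) (h .src)
  have e' : x.1.lvl 0 .src = x.1.lvl 1 α := e
  exact had (h₀ .src a (e' ▸ ha))

/-! An omega-functor out of `negSemiPath` amounts to an omega-functor out of the path omega-category
that takes the same value on x and on x *_0 y (`negSemiPath_exists_desc`, `toNegSemiPath_eq`,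
`negSemiPath_hom_ext`). So only the beginning of a path matters. A path in the cube I^(n+1) begins
at a vertex with the letter - on a nonempty set S of coordinates and + elsewhere; there are (n+1
choose p) such vertices with p coordinates in S. The positive-dimensional faces beginning there are
obtained by replacing the letters - by 0 on a nonempty subset of S. They form the vertex figure,
which is a simplex on the vertex set S with dimensions lowered by one, and the orientations of cubes
and simplices agree on it (`mem_simplex_atom`). Each such vertex therefore contributes one copy of
the (p-1)-simplex.

The projection `baseHom` keeps from a path the faces of the vertex figure of its initial vertex. It
ignores a second factor y of x *_0 y, because x has already moved some coordinate of S to +, so that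
no face of y belongs to the vertex figure (`baseLink_step`).

In the other direction, sending a simplex σ to the atom of the face `star σ` is not an omega-functor
to paths, since the final vertex of `star σ` depends on σ. The functor `sect` continues these atoms
by canonical paths up to the vertex with all letters +. The main point is `sect_atom_eqv`: `sect` of
the atom of σ is a cell, and it is congruent to the atom of `star σ` for the congruence `NegEqv`
generated by x ~ x *_0 y. Modulo that congruence projection and section are then inverse on atoms,
and `negSemiPath_iso` concludes.

The proof of `sect_atom_eqv` is an induction on dimension: I^(N+1) is the cylinder on I^N, and the
(N+1)-simplex is the cylinder on the N-simplex with the end - collapsed to a point. Cylinders on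
composites decompose explicitly (`IsComp.cyl`). It follows that boundaries of atoms are composites
of atoms (`closed_cube`, `closed_simplex`) and that the congruence is stable under cylinders
(`NegEqv.cyl`). The section over a cone is the cylinder on the section with a cone glued to its end
+ (`toCube_glue_sect`). This gluing is a sequence of compositions with cells that are degenerate
modulo the congruence, so it does not change the class (`ConeCell.partial_eqv`). -/

theorem cubeSign_src_succ (k : ℕ) : cubeSign .src (k + 1) = cubeSign .tgt k :=
  (cubeSign_succ (by simp) k).symm

theorem cubeSign_tgt_succ (k : ℕ) : cubeSign .tgt (k + 1) = cubeSign .src k :=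
  (cubeSign_succ (by simp) k).symm

theorem cubeSign_src_zero : cubeSign .src 0 = -1 := by simp [cubeSign]

theorem cubeSign_tgt_zero : cubeSign .tgt 0 = 1 := by simp [cubeSign]

/-! ### Composition of tables as a relation, and images of tables under relations. -/

namespace FaceSystem

/-- The faces of `K` paired with a sign, without any incidence relation. -/
def prodSign (K : FaceSystem) : FaceSystem where
  face := K.face × SignType
  sub a b := a = b
  dim _ := 0
  bd _ _ := ∅
  sub_refl _ := rfl
  sub_trans _ _ _ h h' := h.trans h'
  dim_le _ _ _ := le_rfl
  exists_facet _ _ _ _ _ h := absurd h (lt_irrefl 0)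

/-- A face paired with a sign. -/
def pair {K : FaceSystem} (b : K.face) (c : SignType) : K.prodSign.face := (b, c)

namespace Table

variable {K L : FaceSystem}

theorem mono_le (x : K.Table) {m n : ℕ} (h : m < n) {α β : Dir} {a : K.face} (ha : a ∈ x.lvl m α) :
    a ∈ x.lvl n β := x.mono_lt h α β ha

theorem ext_mem {x y : K.Table} (h : ∀ k α a, a ∈ x.lvl k α ↔ a ∈ y.lvl k α) : x = y :=
  Table.ext (funext fun k => funext fun α => Set.ext fun a => h k α a)

/-- `z` is the composition `x *_n y`. -/
def IsComp (n : ℕ) (x y z : K.Table) : Prop :=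
  ∃ h : Table.d .tgt n x = Table.d .src n y, z = Table.comp n x y h

/-- Composition is treated as a relation carrying no proof of composability, and is reduced to
membership level by level. Identities between composites thereby become propositional statements. -/
theorem isComp_iff {n : ℕ} {x y z : K.Table} : IsComp n x y z ↔
    (∀ k < n, ∀ α a, (a ∈ x.lvl k α ↔ a ∈ y.lvl k α) ∧ (a ∈ z.lvl k α ↔ a ∈ x.lvl k α)) ∧
    (∀ a, a ∈ x.lvl n .tgt ↔ a ∈ y.lvl n .src) ∧ (∀ a, a ∈ z.lvl n .src ↔ a ∈ x.lvl n .src) ∧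
    (∀ a, a ∈ z.lvl n .tgt ↔ a ∈ y.lvl n .tgt) ∧
    ∀ k, n < k → ∀ α a, (a ∈ z.lvl k α ↔ a ∈ x.lvl k α ∨ a ∈ y.lvl k α) := by
  constructor
  · rintro ⟨h, rfl⟩
    obtain ⟨h₁, h₂⟩ := composable_iff.1 h
    refine ⟨fun k hk α a => ⟨by rw [h₁ k hk], by rw [comp_lvl, if_pos hk]⟩, fun a => by rw [h₂],
      fun a => by simp [comp_lvl], fun a => by simp [comp_lvl], fun k hk α a => ?_⟩
    rw [comp_lvl, if_neg hk.not_gt, if_neg hk.ne']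
    rfl
  · rintro ⟨h₁, h₂, h₃, h₄, h₅⟩
    refine ⟨composable_iff.2 ⟨fun k hk α => Set.ext fun a => (h₁ k hk α a).1, Set.ext h₂⟩, ?_⟩
    apply ext_mem
    intro k α a
    rw [comp_lvl]
    rcases lt_trichotomy k n with hk | rfl | hk
    · rw [if_pos hk]
      exact (h₁ k hk α a).2
    · cases α
      · simpa using h₃ a
      · simpa using h₄ a
    · rw [if_neg hk.not_gt, if_neg hk.ne']
      exact h₅ k hk α a

/-- The table of the faces related to the faces of `x`. -/
def rel (r : L.face → K.face → Prop) (x : K.Table) : L.Table where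
  lvl n α := {w | ∃ a ∈ x.lvl n α, r w a}
  mono n α β w := by
    rintro ⟨a, ha, h⟩
    exact ⟨a, x.mono n α β ha, h⟩
  stable := by
    obtain ⟨N, hN⟩ := x.stable
    exact ⟨N, fun n hn α => by simp only [hN n hn α]⟩

theorem mem_rel {r : L.face → K.face → Prop} {x : K.Table} {n : ℕ} {α : Dir} {w : L.face} :
    w ∈ (rel r x).lvl n α ↔ ∃ a ∈ x.lvl n α, r w a := Iff.rfl

theorem mem_d {x : K.Table} {β : Dir} {m n : ℕ} {α : Dir} {a : K.face} :
    a ∈ (Table.d β m x).lvl n α ↔ (n < m ∧ a ∈ x.lvl n α) ∨ (m ≤ n ∧ a ∈ x.lvl m β) := by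
  rw [d_lvl]
  split_ifs with h
  · simp [h]
  · simp [h, not_lt.1 h]

theorem rel_d (r : L.face → K.face → Prop) (α : Dir) (n : ℕ) (x : K.Table) :
    rel r (Table.d α n x) = Table.d α n (rel r x) := by
  apply ext_mem
  intro k β w
  simp only [mem_d, mem_rel]
  by_cases h : k < n
  · simp [h, h.not_ge]
  · simp [h, not_lt.1 h]

/-- Images under a relation commute with unions and preserve equality of levels, and a composition
involves nothing else. In particular `r` may collapse faces, which is needed for cones. -/
theorem IsComp.rel {n : ℕ} {x y z : K.Table} (h : IsComp n x y z)
    (r : L.face → K.face → Prop) : IsComp n (rel r x) (rel r y) (rel r z) := by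
  rw [isComp_iff] at h ⊢
  obtain ⟨h₁, h₂, h₃, h₄, h₅⟩ := h
  refine ⟨fun k hk α w => ?_, fun w => ?_, fun w => ?_, fun w => ?_, fun k hk α w => ?_⟩
  · simp only [mem_rel]
    exact ⟨exists_congr fun a => and_congr_left fun _ => (h₁ k hk α a).1,
      exists_congr fun a => and_congr_left fun _ => (h₁ k hk α a).2⟩
  · exact exists_congr fun a => and_congr_left fun _ => h₂ a
  · exact exists_congr fun a => and_congr_left fun _ => h₃ a
  · exact exists_congr fun a => and_congr_left fun _ => h₄ a
  · simp only [mem_rel, h₅ k hk α, or_and_right, exists_or]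

theorem IsComp.d {n m : ℕ} {x y z : K.Table} (h : IsComp n x y z) (α : Dir) (hmn : m ≠ n) :
    IsComp n (Table.d α m x) (Table.d α m y) (Table.d α m z) := by
  obtain ⟨h, rfl⟩ := h
  exact K.tables.d_comp α m n x y h hmn

theorem IsComp.d_src {n : ℕ} {x y z : K.Table} (h : IsComp n x y z) :
    Table.d .src n z = Table.d .src n x := by
  obtain ⟨h, rfl⟩ := h
  exact K.tables.src_comp n x y h

theorem IsComp.d_tgt {n : ℕ} {x y z : K.Table} (h : IsComp n x y z) :
    Table.d .tgt n z = Table.d .tgt n y := by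
  obtain ⟨h, rfl⟩ := h
  exact K.tables.tgt_comp n x y h

theorem d_d_lt (x : K.Table) (α β : Dir) {m n : ℕ} (h : m < n) :
    Table.d β m (Table.d α n x) = Table.d β m x := K.tables.d_d_lt α β m n x h

theorem d_d_ge (x : K.Table) (α β : Dir) {m n : ℕ} (h : n ≤ m) :
    Table.d β m (Table.d α n x) = Table.d α n x := K.tables.d_d_ge α β m n x h

theorem exists_d_eq (x : K.Table) : ∃ N, ∀ n, N ≤ n → ∀ α, Table.d α n x = x := by
  obtain ⟨N, hN⟩ := K.tables.finite x
  refine ⟨N, fun n hn α => ?_⟩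
  have h : Table.d .src N x = x := hN .src
  rw [← h]
  exact x.d_d_ge _ _ hn

theorem ext_pair {x y : K.prodSign.Table}
    (h : ∀ k α b c, pair b c ∈ x.lvl k α ↔ pair b c ∈ y.lvl k α) : x = y :=
  ext_mem fun k α p => h k α p.1 p.2

theorem isComp_of_pair {n : ℕ} {x y z : K.prodSign.Table}
    (h₁ : ∀ k < n, ∀ α b c, (pair b c ∈ x.lvl k α ↔ pair b c ∈ y.lvl k α) ∧
      (pair b c ∈ z.lvl k α ↔ pair b c ∈ x.lvl k α))
    (h₂ : ∀ b c, pair b c ∈ x.lvl n .tgt ↔ pair b c ∈ y.lvl n .src)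
    (h₃ : ∀ b c, pair b c ∈ z.lvl n .src ↔ pair b c ∈ x.lvl n .src)
    (h₄ : ∀ b c, pair b c ∈ z.lvl n .tgt ↔ pair b c ∈ y.lvl n .tgt)
    (h₅ : ∀ k, n < k → ∀ α b c,
      (pair b c ∈ z.lvl k α ↔ pair b c ∈ x.lvl k α ∨ pair b c ∈ y.lvl k α)) : IsComp n x y z :=
  isComp_iff.2 ⟨fun k hk α p => h₁ k hk α p.1 p.2, fun p => h₂ p.1 p.2, fun p => h₃ p.1 p.2,
    fun p => h₄ p.1 p.2, fun k hk α p => h₅ k hk α p.1 p.2⟩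

/-! ### Cylinders -/

/-- The cylinder on a table. -/
def cyl (x : K.Table) : K.prodSign.Table where
  lvl m α := {p | (p.2 = cubeSign α m ∧ p.1 ∈ x.lvl m α) ∨ (0 < m ∧ p.1 ∈ x.lvl (m - 1) α)}
  mono m α β p := by
    have e₁ := cubeSign_src_succ m
    have e₂ := cubeSign_tgt_succ m
    have h₀ : 0 < m → x.lvl (m - 1) α ⊆ x.lvl m β := fun h => x.mono_lt (by omega) _ _
    have h₁ := x.mono m α β
    rintro (⟨h, h'⟩ | ⟨h, h'⟩)
    -- For equal directions the signs of the ends in levels `m` and `m + 1` differ, and the face is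
    -- absorbed by the full cylinder on level `m`. For opposite directions the two signs agree.
    · cases α <;> cases β
      · exact .inr ⟨m.succ_pos, h'⟩
      · exact .inl ⟨h.trans e₂.symm, h₁ h'⟩
      · exact .inl ⟨h.trans e₁.symm, h₁ h'⟩
      · exact .inr ⟨m.succ_pos, h'⟩
    · exact .inr ⟨m.succ_pos, h₀ h h'⟩
  stable := by
    obtain ⟨N, hN⟩ := x.stable
    refine ⟨N + 1, fun n hn α => ?_⟩
    rw [hN n (by omega), hN (n - 1) (by omega), hN (N + 1) (by omega), Nat.add_sub_cancel]
    ext p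
    refine ⟨fun h => .inr ⟨by omega, h.elim (fun h => h.2) (fun h => h.2)⟩,
      fun h => .inr ⟨by omega, h.elim (fun h => h.2) (fun h => h.2)⟩⟩

theorem mem_cyl {x : K.Table} {m : ℕ} {α : Dir} {b : K.face} {c : SignType} :
    pair b c ∈ (cyl x).lvl m α ↔
      (c = cubeSign α m ∧ b ∈ x.lvl m α) ∨ (0 < m ∧ b ∈ x.lvl (m - 1) α) := Iff.rfl

/-- The faces of `y` at the end `cubeSign α n` of the cylinder, together with the cylinders on
the iterated sources or targets of `y` of dimension less than `n`. -/
def whisk (α : Dir) (n : ℕ) (y : K.Table) : K.prodSign.Table where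
  lvl k γ := if k < n then (cyl y).lvl k γ else
    {p | (p.2 = cubeSign α n ∧ p.1 ∈ y.lvl k γ) ∨ (0 < n ∧ p.1 ∈ y.lvl (n - 1) α)}
  mono k β γ p hp := by
    rcases lt_trichotomy (k + 1) n with h | h | h
    · rw [if_pos h]
      rw [if_pos (by omega)] at hp
      exact (cyl y).mono k β γ hp
    · subst h
      rw [if_pos (by omega)] at hp
      rw [if_neg (by omega)]
      have e₁ := cubeSign_src_succ k
      have e₂ := cubeSign_tgt_succ k
      rcases hp with ⟨h, h'⟩ | ⟨h, h'⟩
      · cases α <;> cases β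
        · exact .inr ⟨k.succ_pos, h'⟩
        · exact .inl ⟨h.trans e₁.symm, y.mono _ _ _ h'⟩
        · exact .inl ⟨h.trans e₂.symm, y.mono _ _ _ h'⟩
        · exact .inr ⟨k.succ_pos, h'⟩
      · exact .inr ⟨k.succ_pos, y.mono_lt (by omega) _ _ h'⟩
    · rw [if_neg (by omega)] at hp ⊢
      rcases hp with ⟨h, h'⟩ | ⟨h, h'⟩
      · exact .inl ⟨h, y.mono _ _ _ h'⟩
      · exact .inr ⟨h, h'⟩
  stable := by
    obtain ⟨N, hN⟩ := y.stable
    refine ⟨max n N, fun k hk γ => ?_⟩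
    rw [if_neg (by omega), if_neg (by omega), hN k (by omega), hN (max n N) (by omega)]

theorem mem_whisk {α : Dir} {n : ℕ} {y : K.Table} {k : ℕ} {γ : Dir} {b : K.face} {c : SignType} :
    pair b c ∈ (whisk α n y).lvl k γ ↔
      (k < n ∧ ((c = cubeSign γ k ∧ b ∈ y.lvl k γ) ∨ (0 < k ∧ b ∈ y.lvl (k - 1) γ))) ∨
      (n ≤ k ∧ ((c = cubeSign α n ∧ b ∈ y.lvl k γ) ∨ (0 < n ∧ b ∈ y.lvl (n - 1) α))) := by
  change pair b c ∈ (if k < n then (cyl y).lvl k γ else _) ↔ _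
  split_ifs with h
  · rw [mem_cyl]
    simp [h, h.not_ge]
  · simp only [h, not_lt.1 h, false_and, true_and, false_or]
    rfl

/-- The boundary formula for a product with the interval: the α-boundary of X × I in dimension m
consists of that of X, placed at one end, and of the product of I with the (m-1)-dimensional one. -/
theorem d_cyl (α : Dir) (m : ℕ) (x : K.Table) :
    Table.d α m (cyl x) = whisk α m (Table.d α m x) := by
  apply ext_pair
  intro k γ b c
  simp only [mem_d, mem_cyl, mem_whisk]
  grind

/-- Together with `isComp_whisk_src` this is a recursion on `n`: a whiskered table is an end of the
cylinder, for `n = 0`, composed with cylinders on iterated boundaries of `y`. Later properties of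
`whisk` are obtained from this recursion. -/
theorem isComp_whisk_tgt (n : ℕ) (y : K.Table) :
    IsComp n (whisk .src n y) (cyl (Table.d .tgt n y)) (whisk .tgt (n + 1) y) := by
  have e₁ := cubeSign_src_succ n
  have e₂ := cubeSign_tgt_succ n
  have mn := fun {m n : ℕ} (h : m < n) {α β : Dir} {a : K.face} =>
    y.mono_le h (α := α) (β := β) (a := a)
  apply isComp_of_pair <;> intros <;> simp only [mem_d, mem_cyl, mem_whisk] <;> grind

theorem isComp_whisk_src (n : ℕ) (y : K.Table) :
    IsComp n (cyl (Table.d .src n y)) (whisk .tgt n y) (whisk .src (n + 1) y) := by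
  have e₁ := cubeSign_src_succ n
  have e₂ := cubeSign_tgt_succ n
  have mn := fun {m n : ℕ} (h : m < n) {α β : Dir} {a : K.face} =>
    y.mono_le h (α := α) (β := β) (a := a)
  apply isComp_of_pair <;> intros <;> simp only [mem_d, mem_cyl, mem_whisk] <;> grind

theorem IsComp.mem {n : ℕ} {x y z : K.Table} (h : IsComp n x y z) (k : ℕ) (α : Dir) (a : K.face) :
    a ∈ z.lvl k α ↔ (k < n ∧ a ∈ x.lvl k α) ∨ (k = n ∧ α = .src ∧ a ∈ x.lvl k α) ∨
      (k = n ∧ α = .tgt ∧ a ∈ y.lvl k α) ∨ (n < k ∧ (a ∈ x.lvl k α ∨ a ∈ y.lvl k α)) := by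
  obtain ⟨h₁, h₂, h₃, h₄, h₅⟩ := isComp_iff.1 h
  rcases lt_trichotomy k n with hk | rfl | hk
  · rw [(h₁ k hk α a).2]
    simp [hk, hk.ne, hk.not_gt]
  · cases α
    · simp [h₃]
    · simp [h₄]
  · rw [h₅ k hk]
    simp [hk, hk.ne', hk.not_gt]

theorem exists_isComp {n : ℕ} {x y : K.Table}
    (h₁ : ∀ k < n, ∀ α a, (a ∈ x.lvl k α ↔ a ∈ y.lvl k α))
    (h₂ : ∀ a, a ∈ x.lvl n .tgt ↔ a ∈ y.lvl n .src) : ∃ z, IsComp n x y z :=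
  ⟨_, composable_iff.2 ⟨fun k hk α => Set.ext (h₁ k hk α), Set.ext h₂⟩, rfl⟩

theorem exists_isComp_of_pair {n : ℕ} {x y : K.prodSign.Table}
    (h₁ : ∀ k < n, ∀ α b c, (pair b c ∈ x.lvl k α ↔ pair b c ∈ y.lvl k α))
    (h₂ : ∀ b c, pair b c ∈ x.lvl n .tgt ↔ pair b c ∈ y.lvl n .src) : ∃ z, IsComp n x y z :=
  exists_isComp (fun k hk α p => h₁ k hk α p.1 p.2) (fun p => h₂ p.1 p.2)

/-- The cylinder on a composition is a composition of whiskered cylinders. -/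
theorem IsComp.cyl {n : ℕ} {x y z : K.Table} (h : IsComp n x y z) :
    ∃ A B, IsComp n (cyl x) (whisk .tgt n (Table.d .src (n + 1) y)) A ∧
      IsComp n (whisk .src n (Table.d .tgt (n + 1) x)) (cyl y) B ∧ IsComp (n + 1) A B (cyl z) := by
  have e₁ := cubeSign_src_succ n
  have e₂ := cubeSign_tgt_succ n
  have mx := fun {m n : ℕ} (h : m < n) {α β : Dir} {a : K.face} =>
    x.mono_le h (α := α) (β := β) (a := a)
  have my := fun {m n : ℕ} (h : m < n) {α β : Dir} {a : K.face} =>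
    y.mono_le h (α := α) (β := β) (a := a)
  obtain ⟨h₁, h₂, -⟩ := isComp_iff.1 h
  have h₃ : ∀ k < n, ∀ α a, (a ∈ x.lvl k α ↔ a ∈ y.lvl k α) := fun k hk α a => (h₁ k hk α a).1
  clear h₁
  obtain ⟨A, hA⟩ : ∃ A, IsComp n (Table.cyl x) (whisk .tgt n (Table.d .src (n + 1) y)) A := by
    apply exists_isComp_of_pair <;> intros <;> simp only [mem_d, mem_cyl, mem_whisk] <;> grind
  obtain ⟨B, hB⟩ : ∃ A, IsComp n (whisk .src n (Table.d .tgt (n + 1) x)) (Table.cyl y) A := by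
    apply exists_isComp_of_pair <;> intros <;> simp only [mem_d, mem_cyl, mem_whisk] <;> grind
  refine ⟨A, B, hA, hB, ?_⟩
  apply isComp_of_pair
  · rintro k hk (_ | _) b c <;>
    simp only [hA.mem, hB.mem, h.mem, mem_d, mem_cyl, mem_whisk] <;>
    grind
  · intros
    simp only [hA.mem, hB.mem, mem_d, mem_cyl, mem_whisk]
    grind
  · intros
    simp only [hA.mem, h.mem, mem_d, mem_cyl, mem_whisk]
    grind
  · intros
    simp only [hB.mem, h.mem, mem_d, mem_cyl, mem_whisk]
    grind
  · intro k hk α b c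
    have e₃ := cubeSign_src_succ (n + 1)
    have e₄ := cubeSign_tgt_succ (n + 1)
    simp only [hA.mem, hB.mem, h.mem, mem_d, mem_cyl, mem_whisk]
    -- Above level `n + 2` monotonicity absorbs the truncated tables into level `k - 1`. At `k = n +
    -- 2` the levels `n + 1` of both sides meet, and the two directions have to be compared.
    rcases Nat.lt_or_ge (n + 2) k with hk' | hk'
    · have f₁ : b ∈ x.lvl (n+1) .tgt → b ∈ x.lvl (k - 1) α := mx (by omega)
      have f₂ : b ∈ y.lvl (n+1) .src → b ∈ y.lvl (k - 1) α := my (by omega)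
      have f₃ : b ∈ x.lvl (n-1) .src → b ∈ x.lvl (k - 1) α := mx (by omega)
      have f₄ : b ∈ y.lvl (n-1) .tgt → b ∈ y.lvl (k - 1) α := my (by omega)
      grind
    · obtain rfl : k = n + 2 := by omega
      have f₃ : b ∈ x.lvl (n-1) .src → b ∈ x.lvl (n + 1) α := mx (by omega)
      have f₄ : b ∈ y.lvl (n-1) .tgt → b ∈ y.lvl (n + 1) α := my (by omega)
      cases α <;> grind

end Table
end FaceSystem

/-! ### Gluing a cone to the end of sign + of a cylinder. -/

/-- The direction in which the end of a cylinder has the sign `+`, in dimension `m`. -/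
def posDir (m : ℕ) : Dir := if m % 2 = 0 then .tgt else .src

theorem posDir_cases (m : ℕ) :
    (cubeSign .src m = 1 ∧ cubeSign .tgt m = -1 ∧ posDir m = .src ∧ posDir (m + 1) = .tgt ∧
      m % 2 = 1) ∨
    (cubeSign .src m = -1 ∧ cubeSign .tgt m = 1 ∧ posDir m = .tgt ∧ posDir (m + 1) = .src ∧
      m % 2 = 0) := by
  rcases Nat.mod_two_eq_zero_or_one m with h | h
  · right
    have h' : Even m := Nat.even_iff.2 h
    refine ⟨?_, ?_, ?_, ?_, h⟩
    · simp [cubeSign, pow_succ, h'.neg_one_pow]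
    · simp [cubeSign, pow_succ, h'.neg_one_pow]
    · simp [posDir, h]
    · simp only [posDir]
      rw [if_neg (by omega)]
  · left
    have h' : Odd m := Nat.odd_iff.2 h
    refine ⟨?_, ?_, ?_, ?_, h⟩
    · simp [cubeSign, pow_succ, h'.neg_one_pow]
    · simp [cubeSign, pow_succ, h'.neg_one_pow]
    · simp [posDir, h]
    · simp only [posDir]
      rw [if_pos (by omega)]

namespace FaceSystem
namespace Table
variable {K L : FaceSystem}

theorem stable_of {f : ℕ → Dir → Set K.face} {N : ℕ} {S : Set K.face}
    (h : ∀ n, N ≤ n → ∀ α, f n α = S) : ∃ N, ∀ n, N ≤ n → ∀ α, f n α = f N .src :=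
  ⟨N, fun n hn α => by rw [h n hn, h N le_rfl]⟩

theorem exists_stable₂ (x : K.Table) (y : L.Table) : ∃ (N : ℕ) (S : Set K.face) (T : Set L.face),
    ∀ n, N ≤ n → ∀ α, x.lvl n α = S ∧ y.lvl n α = T := by
  obtain ⟨N, hN⟩ := x.stable
  obtain ⟨M, hM⟩ := y.stable
  exact ⟨max N M, _, _, fun n hn α => ⟨hN n (by omega) α, hM n (by omega) α⟩⟩

/-- The tables `t` and `H` can be glued: `H`, shifted by one, is a cone on the end of sign `+` of
the cylinder on `t`. -/
structure Under (t H : K.Table) : Prop where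
  le : ∀ m α, t.lvl m α ⊆ H.lvl m α
  tgt_le : t.lvl 0 .tgt ⊆ H.lvl 0 .src
  le_tgt : H.lvl 0 .tgt ⊆ t.lvl 0 .tgt

/-- Truncation in dimension at least `1` leaves level `0` unchanged, and the last two conditions
only concern that level. -/
theorem Under.d {t H : K.Table} (h : Under t H) (β : Dir) (j : ℕ) :
    Under (Table.d β (j + 1) t) (Table.d β (j + 1) H) := by
  obtain ⟨h₁, h₂, h₃⟩ := h
  refine ⟨fun m α a => ?_, fun a => ?_, fun a => ?_⟩ <;> simp only [mem_d]
  · have := @h₁ m α a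
    have := @h₁ (j + 1) β a
    tauto
  · have := @h₂ a
    simp
    tauto
  · have := @h₃ a
    simp
    tauto

/-- The cone on `t` given by the faces of `H`. -/
def coneOver (t H : K.Table) (h : Under t H) : K.Table where
  lvl m γ := {b | (m = 0 ∧ b ∈ t.lvl 0 γ) ∨
    (0 < m ∧ (b ∈ H.lvl (m - 1) γ ∨ (γ ≠ posDir m ∧ b ∈ t.lvl m γ)))}
  mono m α β b := by
    rcases m with _ | m
    · rintro (⟨-, h₁⟩ | ⟨h₁, -⟩)
      · refine .inr ⟨Nat.one_pos, ?_⟩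
        cases β
        · exact .inl (by cases α; exacts [h.le _ _ h₁, h.tgt_le h₁])
        · exact .inr ⟨by simp [posDir], t.mono _ _ _ h₁⟩
      · exact absurd h₁ (lt_irrefl 0)
    · rintro (⟨h₁, -⟩ | ⟨-, h₁⟩)
      · exact absurd h₁ (Nat.succ_ne_zero m)
      · refine .inr ⟨by omega, ?_⟩
        have a₁ := H.mono m α β (a := b)
        have a₂ := t.mono (m + 1) α β (a := b)
        have a₃ := h.le (m + 1) β (a := b)
        have a₄ := posDir_cases (m + 1)
        have a₅ : b ∈ t.lvl (m + 1) β → b ∈ H.lvl (m + 1) β := fun h => a₃ h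
        simp only [Nat.succ_sub_one] at h₁ ⊢
        rcases h₁ with h₁ | ⟨h₁, h₂⟩
        · exact .inl (a₁ h₁)
        · by_cases hβ : β = α
          · subst hβ
            exact .inl (a₅ h₂)
          -- Here `β` is `posDir (m + 1)`, and `posDir` alternates.
          · refine .inr ⟨?_, a₂ h₂⟩
            rintro rfl
            cases α <;> grind
  stable := by
    obtain ⟨N, S, T, hN⟩ := exists_stable₂ t H
    have hST : S ⊆ T := by
      rw [← (hN N le_rfl .src).1, ← (hN N le_rfl .src).2]
      exact h.le N .src
    refine stable_of (N := N + 1) (S := T) fun n hn γ => ?_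
    rw [(hN n (by omega) γ).1, (hN (n - 1) (by omega) γ).2]
    ext b
    have : b ∈ S → b ∈ T := fun h => hST h
    change (_ ∨ _) ↔ _
    have h₁ : 0 < n := by omega
    have h₂ : n ≠ 0 := by omega
    tauto

theorem mem_coneOver {t H : K.Table} {h : Under t H} {m : ℕ} {γ : Dir} {b : K.face} :
    b ∈ (coneOver t H h).lvl m γ ↔ (m = 0 ∧ b ∈ t.lvl 0 γ) ∨
      (0 < m ∧ (b ∈ H.lvl (m - 1) γ ∨ (γ ≠ posDir m ∧ b ∈ t.lvl m γ))) := Iff.rfl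

/-- The levels of the gluing of the cylinder on `t` and of the cone. -/
def glueLvl (t H : K.Table) (m : ℕ) (γ : Dir) : Set K.prodSign.face :=
  {p | (p.2 = 1 ∧ 0 < m ∧ p.1 ∈ H.lvl (m - 1) γ) ∨ ((p.2 ≠ 1 ∨ m = 0) ∧ p ∈ (cyl t).lvl m γ)}

theorem mem_glueLvl {t H : K.Table} {m : ℕ} {γ : Dir} {b : K.face} {c : SignType} :
    pair b c ∈ glueLvl t H m γ ↔ (c = 1 ∧ 0 < m ∧ b ∈ H.lvl (m - 1) γ) ∨
      ((c ≠ 1 ∨ m = 0) ∧ ((c = cubeSign γ m ∧ b ∈ t.lvl m γ) ∨ (0 < m ∧ b ∈ t.lvl (m - 1) γ))) :=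
  Iff.rfl

/-- The only passage from the cylinder to the cone is out of level `0`, where the final vertices of
the cylinder enter the cone; `tgt_le` and `le` are made for this. -/
theorem glueLvl_mono {t H : K.Table} (h : Under t H) (m : ℕ) (α β : Dir) :
    glueLvl t H m α ⊆ glueLvl t H (m + 1) β := by
  have key : ∀ b c, pair b c ∈ glueLvl t H m α → pair b c ∈ glueLvl t H (m + 1) β := by
    intro b c hp
    by_cases hc : c = 1
    · subst hc
      rw [mem_glueLvl]
      refine .inl ⟨rfl, m.succ_pos, ?_⟩
      rw [Nat.add_sub_cancel]
      rcases hp with ⟨-, h₁, h₂⟩ | ⟨h₁, h₂⟩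
      · exact H.mono_le (by omega) h₂
      · obtain rfl : m = 0 := h₁.resolve_left fun h => h rfl
        rcases h₂ with ⟨h₂, h₃⟩ | ⟨h₂, -⟩
        · cases α
          · exact absurd (h₂.trans cubeSign_src_zero) (show ¬ (1 : SignType) = -1 by decide)
          · cases β
            · exact h.tgt_le h₃
            · exact h.le _ _ h₃
        · exact absurd h₂ (lt_irrefl 0)
    · rcases hp with ⟨h₁, -⟩ | ⟨-, h₂⟩
      · exact absurd h₁ hc
      · exact .inr ⟨.inl hc, (cyl t).mono m α β h₂⟩
  exact fun p hp => key p.1 p.2 hp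

theorem exists_glueLvl_stable {t H : K.Table} :
    ∃ N, ∀ n, N ≤ n → ∀ α, glueLvl t H n α = glueLvl t H N .src := by
  obtain ⟨N, S, T, hN⟩ := exists_stable₂ (cyl t) H
  refine stable_of (N := N + 1)
    (S := ({p | (p.2 = 1 ∧ p.1 ∈ T) ∨ (p.2 ≠ 1 ∧ p ∈ S)} : Set K.prodSign.face)) fun n hn γ => ?_
  have h₁ : 0 < n := by omega
  have h₂ : n ≠ 0 := by omega
  rw [glueLvl, (hN n (by omega) γ).1, (hN (n - 1) (by omega) γ).2]
  simp only [h₁, h₂, true_and, or_false]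

/-- The gluing of the cylinder on `t` and of the cone on its end of sign `+`. -/
def glue (t H : K.Table) (h : Under t H) : K.prodSign.Table where
  lvl := glueLvl t H
  mono := glueLvl_mono h
  stable := exists_glueLvl_stable

theorem mem_glue {t H : K.Table} {h : Under t H} {m : ℕ} {γ : Dir} {b : K.face} {c : SignType} :
    pair b c ∈ (glue t H h).lvl m γ ↔ (c = 1 ∧ 0 < m ∧ b ∈ H.lvl (m - 1) γ) ∨
      ((c ≠ 1 ∨ m = 0) ∧ ((c = cubeSign γ m ∧ b ∈ t.lvl m γ) ∨ (0 < m ∧ b ∈ t.lvl (m - 1) γ))) :=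
  Iff.rfl

/-- The cylinder on `t`, with the cones on the iterated sources and targets of `t` of dimension
less than `j` glued. -/
def partialCyl (j : ℕ) (t H : K.Table) (h : Under t H) : K.prodSign.Table where
  lvl m γ := if m ≤ j then glueLvl t H m γ else
    {p | p ∈ (cyl t).lvl m γ ∨ (p.2 = 1 ∧ p.1 ∈ H.lvl j (posDir j))}
  mono m α β p hp := by
    rcases lt_trichotomy m j with h₁ | rfl | h₁
    · rw [if_pos (by omega)] at hp ⊢
      exact glueLvl_mono h m α β hp
    · rw [if_neg (by omega)]
      rw [if_pos le_rfl] at hp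
      rcases hp with ⟨h₁, h₂, h₃⟩ | ⟨h₁, h₂⟩
      · exact .inr ⟨h₁, H.mono_le (by omega) h₃⟩
      · exact .inl ((cyl t).mono _ _ _ h₂)
    · rw [if_neg (by omega)] at hp ⊢
      exact hp.imp_left fun h => (cyl t).mono _ _ _ h
  stable := by
    obtain ⟨N, S, T, hN⟩ := exists_stable₂ (cyl t) (cyl t)
    refine stable_of (N := max N (j + 1)) (S := {p | p ∈ S ∨ (p.2 = 1 ∧ p.1 ∈ H.lvl j (posDir j))})
      fun n hn γ => ?_
    rw [if_neg (by omega), (hN n (by omega) γ).1]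

theorem mem_partialCyl {j : ℕ} {t H : K.Table} {h : Under t H} {m : ℕ} {γ : Dir} {b : K.face}
    {c : SignType} : pair b c ∈ (partialCyl j t H h).lvl m γ ↔
      (m ≤ j ∧ ((c = 1 ∧ 0 < m ∧ b ∈ H.lvl (m - 1) γ) ∨
      ((c ≠ 1 ∨ m = 0) ∧ ((c = cubeSign γ m ∧ b ∈ t.lvl m γ) ∨ (0 < m ∧ b ∈ t.lvl (m - 1) γ))))) ∨
      (j < m ∧ (((c = cubeSign γ m ∧ b ∈ t.lvl m γ) ∨ (0 < m ∧ b ∈ t.lvl (m - 1) γ)) ∨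
        (c = 1 ∧ b ∈ H.lvl j (posDir j)))) := by
  change pair b c ∈ (if m ≤ j then glueLvl t H m γ else _) ↔ _
  split_ifs with h
  · rw [mem_glueLvl]
    simp [h, h.not_gt]
  · simp only [h, not_le.1 h, false_and, true_and, false_or]
    rfl

/-- The cone on `t`, with the cylinders on the iterated sources and targets of `t` of dimension
less than `j` glued. -/
def partialCone (j : ℕ) (t H : K.Table) (h : Under t H) : K.prodSign.Table where
  lvl m γ := if m ≤ j then glueLvl t H m γ else
    {p | (p.2 = 1 ∧ p.1 ∈ (coneOver t H h).lvl m γ) ∨ p.1 ∈ t.lvl j (posDir (j + 1))}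
  mono m α β p hp := by
    rcases lt_trichotomy m j with h₁ | rfl | h₁
    · rw [if_pos (by omega)] at hp ⊢
      exact glueLvl_mono h m α β hp
    · rw [if_neg (by omega)]
      rw [if_pos le_rfl] at hp
      rcases hp with ⟨h₁, h₂, h₃⟩ | ⟨h₁, ⟨h₂, h₃⟩ | ⟨h₂, h₃⟩⟩
      · exact .inl ⟨h₁, .inr ⟨m.succ_pos, .inl (H.mono_le (by omega) h₃)⟩⟩
      · rcases posDir_cases m with h₄ | h₄ <;> cases α
        · have h₅ : 0 < m := by omega
          exact absurd (h₂.trans h₄.1) (h₁.resolve_right h₅.ne')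
        · exact .inr (by rwa [h₄.2.2.2.1])
        · exact .inr (by rwa [h₄.2.2.2.1])
        · rcases h₁ with h₁ | rfl
          · exact absurd (h₂.trans h₄.2.1) h₁
          · exact .inl ⟨h₂.trans h₄.2.1, (coneOver t H h).mono 0 .tgt β (.inl ⟨rfl, h₃⟩)⟩
      · exact .inr (t.mono_le (by omega) h₃)
    · rw [if_neg (by omega)] at hp ⊢
      exact hp.imp_left fun h' => ⟨h'.1, (coneOver t H h).mono _ _ _ h'.2⟩
  stable := by
    obtain ⟨N, S, T, hN⟩ := exists_stable₂ (coneOver t H h) (coneOver t H h)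
    refine stable_of (N := max N (j + 1))
      (S := {p | (p.2 = 1 ∧ p.1 ∈ S) ∨ p.1 ∈ t.lvl j (posDir (j + 1))}) fun n hn γ => ?_
    rw [if_neg (by omega), (hN n (by omega) γ).1]

theorem mem_partialCone {j : ℕ} {t H : K.Table} {h : Under t H} {m : ℕ} {γ : Dir} {b : K.face}
    {c : SignType} : pair b c ∈ (partialCone j t H h).lvl m γ ↔
      (m ≤ j ∧ ((c = 1 ∧ 0 < m ∧ b ∈ H.lvl (m - 1) γ) ∨
      ((c ≠ 1 ∨ m = 0) ∧ ((c = cubeSign γ m ∧ b ∈ t.lvl m γ) ∨ (0 < m ∧ b ∈ t.lvl (m - 1) γ))))) ∨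
      (j < m ∧ ((c = 1 ∧ (b ∈ H.lvl (m - 1) γ ∨ (γ ≠ posDir m ∧ b ∈ t.lvl m γ))) ∨
        b ∈ t.lvl j (posDir (j + 1)))) := by
  change pair b c ∈ (if m ≤ j then glueLvl t H m γ else
    {p | (p.2 = 1 ∧ p.1 ∈ (coneOver t H h).lvl m γ) ∨ p.1 ∈ t.lvl j (posDir (j + 1))}) ↔ _
  split_ifs with h'
  · rw [mem_glueLvl]
    simp [h', h'.not_gt]
  · simp only [h', not_le.1 h', false_and, true_and, false_or]
    change (_ ∧ b ∈ (coneOver t H h).lvl m γ) ∨ _ ↔ _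
    rw [mem_coneOver]
    have h₁ : 0 < m := by omega
    have h₂ : m ≠ 0 := by omega
    simp only [h₁, h₂, false_and, true_and, false_or]
    rfl

/-- By `le_tgt` the `0`-target of `H` already lies in `t`, so the faces added to the cylinder are
not new. -/
theorem partialCyl_zero {t H : K.Table} (h : Under t H) : partialCyl 0 t H h = cyl t := by
  apply ext_pair
  intro k γ b c
  -- The exceptional case, level `1` on the source side, is the one in which the end of the cylinder
  -- has sign +; `h₂` and `h₃` cover it.
  have h₁ : 0 < k → b ∈ H.lvl 0 .tgt → b ∈ t.lvl (k - 1) γ ∨ (k = 1 ∧ γ = .src) := by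
    intro hk hb
    have hb' := h.le_tgt hb
    by_cases hk' : 1 < k
    · exact .inl (t.mono_le (by omega) hb')
    · obtain rfl : k = 1 := by omega
      cases γ
      · exact .inr ⟨rfl, rfl⟩
      · exact .inl hb'
  have h₂ : b ∈ H.lvl 0 .tgt → b ∈ t.lvl 1 .src := fun hb => t.mono_le Nat.one_pos (h.le_tgt hb)
  have h₃ : cubeSign .src 1 = 1 := by simp [cubeSign]
  have h₄ : posDir 0 = .tgt := rfl
  simp only [mem_partialCyl, mem_cyl, h₄]
  rcases Nat.eq_zero_or_pos k with rfl | hk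
  · simp
  · grind

theorem partialCone_zero {t H : K.Table} (h : Under t H) :
    partialCone 0 t H h = whisk .src 1 (coneOver t H h) := by
  apply ext_pair
  intro k γ b c
  have h₃ : cubeSign .src 1 = 1 := by simp [cubeSign]
  have h₄ : posDir (0 + 1) = .src := rfl
  simp only [mem_partialCone, mem_whisk, mem_coneOver, h₃, h₄]
  rcases Nat.eq_zero_or_pos k with rfl | hk
  · simp
  · have h₁ : 1 ≤ k := hk
    have h₂ : ¬ k < 1 := by omega
    have h₅ : k ≠ 0 := by omega
    simp [hk, h₁, h₂, h₅]

/-- Both tables are stationary in high levels, and there the glued faces are all the faces of `H` at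
the end +. -/
theorem exists_partialCyl_eq {t H : K.Table} (h : Under t H) :
    ∃ N, ∀ j, N ≤ j → partialCyl j t H h = glue t H h := by
  obtain ⟨N, S, T, hN⟩ := exists_stable₂ t H
  have hST : S ⊆ T := by
    rw [← (hN N le_rfl .src).1, ← (hN N le_rfl .src).2]
    exact h.le N .src
  refine ⟨N + 1, fun j hj => ?_⟩
  apply ext_pair
  intro k γ b c
  rw [mem_partialCyl, mem_glue]
  have h₀ : b ∈ S → b ∈ T := fun h => hST h
  by_cases hk : k ≤ j
  · simp [hk, hk.not_gt]
  · rw [(hN k (by omega) γ).1, (hN (k - 1) (by omega) γ).1, (hN (k - 1) (by omega) γ).2,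
      (hN j (by omega) _).2]
    have h₁ : 0 < k := by omega
    have h₂ : k ≠ 0 := by omega
    have h₃ : j < k := by omega
    simp only [hk, h₁, h₂, h₃, false_and, true_and, false_or, or_false]
    by_cases hc : c = 1
    · simp only [hc]
      tauto
    · simp only [hc]
      tauto

/-- In odd dimension `j + 1` the end + is on the source side of the cylinder (`posDir (j + 1) =
.src`). The next cone to be glued is thus the one on the `(j + 1)`-source of `t`, and it is composed
on the left. In even dimension the sides are exchanged. -/
theorem isComp_partialCyl_odd {t H : K.Table} (h : Under t H) {j : ℕ}
    (hj : (j + 1) % 2 = 1) : IsComp (j + 1) (partialCone j _ _ (h.d .src j)) (partialCyl j t H h)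
      (partialCyl (j + 1) t H h) := by
  obtain ⟨a₁, a₂, a₃, a₄, a₅⟩ : cubeSign .src (j + 1) = 1 ∧ cubeSign .tgt (j + 1) = -1 ∧
    posDir (j + 1) = .src ∧ posDir j = .tgt ∧ posDir (j + 2) = .tgt := by
    have e₁ := posDir_cases (j + 1)
    have e₂ := posDir_cases j
    grind
  have hle : ∀ m α b, b ∈ t.lvl m α → b ∈ H.lvl m α := h.le
  have mt := fun {m n : ℕ} (h : m < n) {α β : Dir} {a : K.face} =>
    t.mono_le h (α := α) (β := β) (a := a)
  have mH := fun {m n : ℕ} (h : m < n) {α β : Dir} {a : K.face} =>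
    H.mono_le h (α := α) (β := β) (a := a)
  have ne : (-1 : SignType) ≠ 1 := by decide
  apply isComp_of_pair
  · intro k hk α b c
    simp only [mem_d, mem_partialCyl, mem_partialCone, a₃, a₄]
    grind
  · intro b c
    simp only [mem_d, mem_partialCyl, mem_partialCone, a₁, a₂, a₃, a₄]
    grind
  · intro b c
    simp only [mem_d, mem_partialCyl, mem_partialCone, a₁, a₃]
    grind
  · intro b c
    simp only [mem_partialCyl, a₂, a₃, a₄]
    grind
  · intro k hk α b c
    have f₁ : ∀ β, b ∈ t.lvl j β → b ∈ t.lvl (k - 1) α := fun β => mt (by omega)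
    have f₂ : ∀ β, b ∈ t.lvl (j + 1) β → b ∈ H.lvl (j + 1) β := fun β => hle _ _ _
    simp only [mem_d, mem_partialCyl, mem_partialCone, a₃, a₄]
    grind

theorem isComp_partialCyl_even {t H : K.Table} (h : Under t H) {j : ℕ}
    (hj : (j + 1) % 2 = 0) : IsComp (j + 1) (partialCyl j t H h) (partialCone j _ _ (h.d .tgt j))
      (partialCyl (j + 1) t H h) := by
  obtain ⟨a₁, a₂, a₃, a₄, a₅⟩ : cubeSign .src (j + 1) = -1 ∧ cubeSign .tgt (j + 1) = 1 ∧
    posDir (j + 1) = .tgt ∧ posDir j = .src ∧ posDir (j + 2) = .src := by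
    have e₁ := posDir_cases (j + 1)
    have e₂ := posDir_cases j
    grind
  have hle : ∀ m α b, b ∈ t.lvl m α → b ∈ H.lvl m α := h.le
  have mt := fun {m n : ℕ} (h : m < n) {α β : Dir} {a : K.face} =>
    t.mono_le h (α := α) (β := β) (a := a)
  have mH := fun {m n : ℕ} (h : m < n) {α β : Dir} {a : K.face} =>
    H.mono_le h (α := α) (β := β) (a := a)
  have ne : (-1 : SignType) ≠ 1 := by decide
  apply isComp_of_pair
  · intro k hk α b c
    simp only [mem_d, mem_partialCyl, mem_partialCone, a₃, a₄]
    grind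
  · intro b c
    simp only [mem_d, mem_partialCyl, mem_partialCone, a₁, a₂, a₃, a₄]
    grind
  · intro b c
    simp only [mem_partialCyl, a₁, a₃, a₄]
    grind
  · intro b c
    simp only [mem_d, mem_partialCyl, mem_partialCone, a₂, a₃]
    grind
  · intro k hk α b c
    have f₁ : ∀ β, b ∈ t.lvl j β → b ∈ t.lvl (k - 1) α := fun β => mt (by omega)
    have f₂ : ∀ β, b ∈ t.lvl (j + 1) β → b ∈ H.lvl (j + 1) β := fun β => hle _ _ _
    simp only [mem_d, mem_partialCyl, mem_partialCone, a₃, a₄]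
    grind

/-- The cone has `t` on the side opposite to `posDir`. So in odd dimension `j + 1` the next cylinder
is attached on the target side, and in even dimension on the source side. -/
theorem isComp_partialCone_odd {t H : K.Table} (h : Under t H) {j : ℕ}
    (hj : (j + 1) % 2 = 1) : IsComp (j + 1) (partialCone j t H h) (partialCyl j _ _ (h.d .tgt j))
      (partialCone (j + 1) t H h) := by
  obtain ⟨a₁, a₂, a₃, a₄, a₅⟩ : cubeSign .src (j + 1) = 1 ∧ cubeSign .tgt (j + 1) = -1 ∧
    posDir (j + 1) = .src ∧ posDir j = .tgt ∧ posDir (j + 2) = .tgt := by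
    have e₁ := posDir_cases (j + 1)
    have e₂ := posDir_cases j
    grind
  have hle : ∀ m α b, b ∈ t.lvl m α → b ∈ H.lvl m α := h.le
  have mt := fun {m n : ℕ} (h : m < n) {α β : Dir} {a : K.face} =>
    t.mono_le h (α := α) (β := β) (a := a)
  have mH := fun {m n : ℕ} (h : m < n) {α β : Dir} {a : K.face} =>
    H.mono_le h (α := α) (β := β) (a := a)
  have ne : (-1 : SignType) ≠ 1 := by decide
  apply isComp_of_pair
  · intro k hk α b c
    simp only [mem_d, mem_partialCyl, mem_partialCone, a₃, a₄]
    grind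
  · intro b c
    simp only [mem_d, mem_partialCyl, mem_partialCone, a₁, a₂, a₃, a₄]
    grind
  · intro b c
    simp only [mem_partialCone, a₁, a₃]
    grind
  · intro b c
    simp only [mem_d, mem_partialCyl, mem_partialCone, a₂, a₃, a₄]
    grind
  · intro k hk α b c
    have f₁ : ∀ β, b ∈ t.lvl j β → b ∈ t.lvl (k - 1) α := fun β => mt (by omega)
    have f₂ : ∀ β, b ∈ H.lvl j β → b ∈ H.lvl (k - 1) α := fun β => mH (by omega)
    simp only [mem_d, mem_partialCyl, mem_partialCone, a₃, a₅]
    -- As for cylinders on composites, level `j + 2` is the one where the truncation at `j + 1`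
    -- meets the shift by one, so directions matter there.
    rcases Nat.lt_or_ge (j + 2) k with hk' | hk'
    · have f₃ : ∀ β, b ∈ t.lvl (j + 1) β → b ∈ H.lvl (k - 1) α :=
        fun β hb => hle _ _ _ (mt (by omega) hb)
      have f₄ : ∀ β, b ∈ t.lvl (j + 1) β → b ∈ t.lvl (k - 1) α := fun β => mt (by omega)
      grind
    · obtain rfl : k = j + 2 := by omega
      have f₃ := hle (j + 1) α b
      have f₄ : ∀ β, b ∈ t.lvl (j + 1) β → b ∈ t.lvl (j + 2) α := fun β => mt (by omega)
      cases α <;> grind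

theorem isComp_partialCone_even {t H : K.Table} (h : Under t H) {j : ℕ}
    (hj : (j + 1) % 2 = 0) : IsComp (j + 1) (partialCyl j _ _ (h.d .src j)) (partialCone j t H h)
      (partialCone (j + 1) t H h) := by
  obtain ⟨a₁, a₂, a₃, a₄, a₅⟩ : cubeSign .src (j + 1) = -1 ∧ cubeSign .tgt (j + 1) = 1 ∧
    posDir (j + 1) = .tgt ∧ posDir j = .src ∧ posDir (j + 2) = .src := by
    have e₁ := posDir_cases (j + 1)
    have e₂ := posDir_cases j
    grind
  have hle : ∀ m α b, b ∈ t.lvl m α → b ∈ H.lvl m α := h.le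
  have mt := fun {m n : ℕ} (h : m < n) {α β : Dir} {a : K.face} =>
    t.mono_le h (α := α) (β := β) (a := a)
  have mH := fun {m n : ℕ} (h : m < n) {α β : Dir} {a : K.face} =>
    H.mono_le h (α := α) (β := β) (a := a)
  have ne : (-1 : SignType) ≠ 1 := by decide
  apply isComp_of_pair
  · intro k hk α b c
    simp only [mem_d, mem_partialCyl, mem_partialCone, a₃, a₄]
    grind
  · intro b c
    simp only [mem_d, mem_partialCyl, mem_partialCone, a₁, a₂, a₃, a₄]
    grind
  · intro b c
    simp only [mem_d, mem_partialCyl, mem_partialCone, a₁, a₃, a₄]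
    grind
  · intro b c
    simp only [mem_partialCone, a₂, a₃]
    grind
  · intro k hk α b c
    have f₁ : ∀ β, b ∈ t.lvl j β → b ∈ t.lvl (k - 1) α := fun β => mt (by omega)
    have f₂ : ∀ β, b ∈ H.lvl j β → b ∈ H.lvl (k - 1) α := fun β => mH (by omega)
    simp only [mem_d, mem_partialCyl, mem_partialCone, a₃, a₅]
    rcases Nat.lt_or_ge (j + 2) k with hk' | hk'
    · have f₃ : ∀ β, b ∈ t.lvl (j + 1) β → b ∈ H.lvl (k - 1) α :=
        fun β hb => hle _ _ _ (mt (by omega) hb)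
      have f₄ : ∀ β, b ∈ t.lvl (j + 1) β → b ∈ t.lvl (k - 1) α := fun β => mt (by omega)
      grind
    · obtain rfl : k = j + 2 := by omega
      have f₃ := hle (j + 1) α b
      have f₄ : ∀ β, b ∈ t.lvl (j + 1) β → b ∈ t.lvl (j + 2) α := fun β => mt (by omega)
      cases α <;> grind

end Table
end FaceSystem

/-! ### Composites of atoms, and relations carrying cylinders on atoms to atoms. -/

namespace FaceSystem
open Table

variable {K L : FaceSystem}

/-- The morphisms obtained by composition from the atoms of dimension at most `d`. -/
inductive CGen (K : FaceSystem) (d : ℕ) : K.Table → Prop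
  | atom (a : K.face) : K.dim a ≤ d → CGen K d (K.atom a)
  | comp {n : ℕ} {x y z : K.Table} : CGen K d x → CGen K d y → IsComp n x y z → CGen K d z

theorem CGen.mono {d d' : ℕ} (h : d ≤ d') {x : K.Table} (hx : CGen K d x) : CGen K d' x := by
  induction hx with
  | atom a ha => exact .atom a (ha.trans h)
  | comp _ _ hz ihx ihy => exact .comp ihx ihy hz

/-- Membership in the omega-category generated by the atoms. -/
def IsCell (K : FaceSystem) (x : K.Table) : Prop :=
  OmegaCat.Gen K.tables (Set.range (FaceSystem.atom (K := K))) x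

theorem IsCell.atom (a : K.face) : IsCell K (K.atom a) := .basic _ ⟨a, rfl⟩

theorem IsCell.d {x : K.Table} (hx : IsCell K x) (α : Dir) (n : ℕ) : IsCell K (Table.d α n x) :=
  OmegaCat.Gen.d (C := K.tables) α n x hx

theorem IsCell.comp {n : ℕ} {x y z : K.Table} (hx : IsCell K x) (hy : IsCell K y)
    (h : IsComp n x y z) : IsCell K z := by
  obtain ⟨h, rfl⟩ := h
  exact OmegaCat.Gen.comp (C := K.tables) n x y h hx hy

theorem CGen.isCell {d : ℕ} {x : K.Table} (hx : CGen K d x) : IsCell K x := by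
  induction hx with
  | atom a ha => exact .atom a
  | comp _ _ hz ihx ihy => exact ihx.comp ihy hz

theorem atomLvl_of_dim_le (a : K.face) {n : ℕ} (h : K.dim a ≤ n) (α : Dir) (b : K.face) :
    b ∈ K.atomLvl a n α ↔ K.sub b a := by
  rw [mem_atomLvl]
  refine ⟨fun h => h.1, fun hb => ⟨hb, (K.dim_le _ _ hb).trans h, fun c hc hcn => ?_⟩⟩
  have := K.dim_le _ _ hc
  omega

theorem mem_atom {a b : K.face} {n : ℕ} {α : Dir} :
    b ∈ (K.atom a).lvl n α ↔ b ∈ K.atomLvl a n α := Iff.rfl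

theorem d_atom_of_dim_le (a : K.face) {n : ℕ} (h : K.dim a ≤ n) (α : Dir) :
    Table.d α n (K.atom a) = K.atom a := by
  apply ext_mem
  intro k β b
  simp only [mem_d, mem_atom]
  by_cases hk : k < n
  · simp [hk, hk.not_ge]
  · rw [atomLvl_of_dim_le a h, atomLvl_of_dim_le a (h.trans (not_lt.1 hk))]
    simp [hk, not_lt.1 hk]

/-- The iterated sources and targets of the atoms are compositions of atoms. -/
def Closed (K : FaceSystem) : Prop :=
  ∀ (a : K.face) (j : ℕ) (α : Dir), j < K.dim a → CGen K j (Table.d α j (K.atom a))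

/-- `Closed` treats the atoms, and the globular identities carry the property over to composites. As
a consequence sources and targets are redundant among the generating operations, which gives
`IsCell.induction`. -/
theorem CGen.d (hK : Closed K) {d : ℕ} {x : K.Table} (hx : CGen K d x) (α : Dir) (j : ℕ) :
    CGen K (min d j) (Table.d α j x) := by
  induction hx generalizing α j with
  | atom a ha =>
    rcases lt_or_ge j (K.dim a) with h | h
    · exact (hK a j α h).mono (by omega)
    · rw [d_atom_of_dim_le a h]
      exact .atom a (by omega)
  | @comp n x y z _ _ hz ihx ihy =>
    by_cases h : j = n
    · subst h
      cases α
      · rw [hz.d_src]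
        exact ihx _ _
      · rw [hz.d_tgt]
        exact ihy _ _
    · exact .comp (ihx _ _) (ihy _ _) (hz.d α h)

theorem exists_cGen_of_gen (hK : Closed K) (x : K.tables.carrier)
    (hx : OmegaCat.Gen K.tables (Set.range (FaceSystem.atom (K := K))) x) : ∃ d, CGen K d x := by
  induction hx with
  | basic x hx =>
    obtain ⟨a, rfl⟩ := hx
    exact ⟨_, .atom a le_rfl⟩
  | d α n x _ ih =>
    obtain ⟨d, hd⟩ := ih
    exact ⟨_, hd.d hK α n⟩
  | comp n x y h _ _ ihx ihy =>
    obtain ⟨d, hd⟩ := ihx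
    obtain ⟨d', hd'⟩ := ihy
    exact ⟨max d d', .comp (hd.mono (le_max_left _ _)) (hd'.mono (le_max_right _ _)) ⟨h, rfl⟩⟩

theorem IsCell.exists_cGen (hK : Closed K) {x : K.Table} (hx : IsCell K x) : ∃ d, CGen K d x :=
  exists_cGen_of_gen hK x hx

/-- Induction on the cells: atoms and compositions. -/
theorem IsCell.induction (hK : Closed K) {p : K.Table → Prop} (atom : ∀ a, p (K.atom a))
    (comp : ∀ n x y z, IsCell K x → IsCell K y → IsComp n x y z → p x → p y → p z)
    {x : K.Table} (hx : IsCell K x) : p x := by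
  obtain ⟨d, hd⟩ := hx.exists_cGen hK
  clear hx
  induction hd with
  | atom a ha => exact atom a
  | comp hx hy hz ihx ihy => exact comp _ _ _ _ hx.isCell hy.isCell hz ihx ihy

/-- For index `0` no cylinder is attached: `whisk α 0` is a copy of the table at one end, hence an
image under a relation. -/
theorem Table.IsComp.whisk_zero {n : ℕ} {x y z : K.Table} (h : IsComp n x y z) (α : Dir) :
    IsComp n (whisk α 0 x) (whisk α 0 y) (whisk α 0 z) := by
  have e : ∀ x : K.Table, whisk α 0 x =
      Table.rel (fun (p : K.prodSign.face) (b : K.face) => p.2 = cubeSign α 0 ∧ p.1 = b) x := by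
    intro x
    apply ext_pair
    intro k γ b c
    rw [mem_whisk, mem_rel]
    simp [pair]
    tauto
  rw [e, e, e]
  exact h.rel _

/-- The relation `r` maps the cylinders on the atoms to atoms, and their ends to atoms. -/
structure CylMap (K L : FaceSystem) (r : L.face → K.prodSign.face → Prop) : Prop where
  cyl : ∀ a, ∃ a', rel r (cyl (K.atom a)) = L.atom a' ∧ L.dim a' = K.dim a + 1
  whisk : ∀ α a, ∃ a', rel r (whisk α 0 (K.atom a)) = L.atom a' ∧ L.dim a' ≤ K.dim a

namespace CylMap

variable {r : L.face → K.prodSign.face → Prop}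

theorem cGen_whisk_zero (h : CylMap K L r) {d : ℕ} {x : K.Table} (hx : CGen K d x) (α : Dir) :
    CGen L d (rel r (Table.whisk α 0 x)) := by
  induction hx with
  | atom a ha =>
    obtain ⟨a', e, h'⟩ := h.whisk α a
    rw [e]
    exact .atom a' (h'.trans ha)
  | comp _ _ hz ihx ihy => exact .comp ihx ihy ((hz.whisk_zero α).rel r)

/-- The recursion for `whisk`: a property stable under composition holds for a whiskered table if it
holds for the two ends and for the cylinders on the boundaries of lower dimension. -/
theorem whisk_aux {P : L.Table → Prop} (hP : ∀ n x y z, P x → P y → IsComp n x y z → P z)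
    {n : ℕ} {x : K.Table} (h₀ : ∀ α, P (rel r (Table.whisk α 0 x)))
    (h₁ : ∀ j < n, ∀ α, P (rel r (Table.cyl (Table.d α j x)))) (α : Dir) :
    P (rel r (Table.whisk α n x)) := by
  induction n generalizing α with
  | zero => exact h₀ α
  | succ n ih =>
    have ih' := ih fun j hj => h₁ j (by omega)
    cases α
    · exact hP _ _ _ _ (h₁ n (by omega) _) (ih' _) ((isComp_whisk_src n x).rel r)
    · exact hP _ _ _ _ (ih' _) (h₁ n (by omega) _) ((isComp_whisk_tgt n x).rel r)

/-- `IsComp.cyl` expresses the cylinder on a composite by cylinders on the factors and by whiskers,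
which involve cylinders on boundaries of the factors. This is why all boundaries are carried through
the induction. The outer induction on `d` serves the boundaries of atoms. -/
theorem cGen_cyl_d (hK : Closed K) (h : CylMap K L r) (d : ℕ) : ∀ {x : K.Table}, CGen K d x →
    ∀ j α, CGen L (d + 1) (rel r (Table.cyl (Table.d α j x))) := by
  induction d using Nat.strong_induction_on with
  | _ d ih =>
  have hd : ∀ {x : K.Table}, (∀ j α, CGen L (d + 1) (rel r (Table.cyl (Table.d α j x)))) →
      ∀ i β j α, CGen L (d + 1) (rel r (Table.cyl (Table.d α j (Table.d β i x)))) := by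
    intro x hx i β j α
    rcases lt_or_ge j i with hj | hj
    · rw [d_d_lt _ _ _ hj]
      exact hx j α
    · rw [d_d_ge _ _ _ hj]
      exact hx i β
  have hself : ∀ {x : K.Table}, (∀ j α, CGen L (d + 1) (rel r (Table.cyl (Table.d α j x)))) →
      CGen L (d + 1) (rel r (Table.cyl x)) := by
    intro x hx
    obtain ⟨N, hN⟩ := x.exists_d_eq
    rw [← hN N le_rfl .src]
    exact hx _ _
  intro x hx
  induction hx with
  | atom a ha =>
    intro j α
    rcases lt_or_ge j (K.dim a) with hj | hj
    -- A proper boundary of an atom is a composite of atoms of smaller dimension, so the outer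
    -- hypothesis applies to it; taking its `j`-boundary again changes nothing.
    · have h₁ := ih j (by omega) (hK a j α hj) j α
      rw [d_d_ge _ _ _ le_rfl] at h₁
      exact h₁.mono (by omega)
    · obtain ⟨a', e, h'⟩ := h.cyl a
      rw [d_atom_of_dim_le a hj, e]
      exact .atom a' (by omega)
  | @comp n x y z hx hy hz ihx ihy =>
    intro j α
    by_cases hjn : j = n
    · subst hjn
      cases α
      · rw [hz.d_src]
        exact ihx _ _
      · rw [hz.d_tgt]
        exact ihy _ _
    · obtain ⟨A, B, hA, hB, hAB⟩ := (hz.d α hjn).cyl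
      have hx' := (hx.d hK α j).mono (min_le_left _ _)
      have hy' := (hy.d hK α j).mono (min_le_left _ _)
      have ihx' := hd ihx j α
      have ihy' := hd ihy j α
      refine .comp (.comp (hself ihx') ?_ (hA.rel r)) (.comp ?_ (hself ihy') (hB.rel r))
        (hAB.rel r)
      · refine whisk_aux (P := CGen L (d + 1)) (fun n x y z => .comp) (fun β => ?_)
          (fun i _ β => hd ihy' _ _ _ _) _
        exact (h.cGen_whisk_zero ((hy'.d hK _ _).mono (min_le_left _ _)) β).mono (by omega)
      · refine whisk_aux (P := CGen L (d + 1)) (fun n x y z => .comp) (fun β => ?_)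
          (fun i _ β => hd ihx' _ _ _ _) _
        exact (h.cGen_whisk_zero ((hx'.d hK _ _).mono (min_le_left _ _)) β).mono (by omega)

theorem cGen_cyl (hK : Closed K) (h : CylMap K L r) {d : ℕ} {x : K.Table} (hx : CGen K d x) :
    CGen L (d + 1) (rel r (Table.cyl x)) := by
  obtain ⟨N, hN⟩ := x.exists_d_eq
  rw [← hN N le_rfl .src]
  exact h.cGen_cyl_d hK d hx _ _

theorem cGen_whisk (hK : Closed K) (h : CylMap K L r) {d : ℕ} {x : K.Table} (hx : CGen K d x)
    (α : Dir) (n : ℕ) : CGen L (max d n) (rel r (Table.whisk α n x)) := by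
  refine whisk_aux (P := CGen L (max d n)) (fun n x y z => .comp)
    (fun β => (h.cGen_whisk_zero hx β).mono (by omega)) (fun j hj β => ?_) α
  exact (h.cGen_cyl hK (hx.d hK β j)).mono (by omega)

/-- By `d_cyl` this boundary is a whisker on the `j`-boundary of the atom, and no atom of dimension
above `j` occurs in it. This is the inductive step for `Closed`, for cubes and simplices alike. -/
theorem cGen_d_cyl_atom (hK : Closed K) (h : CylMap K L r) (a : K.face) {j : ℕ}
    (hj : j ≤ K.dim a) (α : Dir) :
    CGen L j (Table.d α j (rel r (Table.cyl (K.atom a)))) := by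
  rw [← rel_d, d_cyl]
  have h₁ : CGen K j (Table.d α j (K.atom a)) :=
    ((CGen.atom a le_rfl).d hK α j).mono (by omega)
  exact (h.cGen_whisk hK h₁ α j).mono (by omega)

theorem isCell_cyl (hK : Closed K) (h : CylMap K L r) {x : K.Table} (hx : IsCell K x) :
    IsCell L (rel r (Table.cyl x)) := by
  obtain ⟨d, hd⟩ := hx.exists_cGen hK
  exact (h.cGen_cyl hK hd).isCell

theorem isCell_whisk (hK : Closed K) (h : CylMap K L r) {x : K.Table} (hx : IsCell K x)
    (α : Dir) (n : ℕ) : IsCell L (rel r (Table.whisk α n x)) := by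
  obtain ⟨d, hd⟩ := hx.exists_cGen hK
  exact (h.cGen_whisk hK hd α n).isCell

end CylMap
end FaceSystem

/-! ### Faces of a cube with a distinguished last letter. -/

/-- The word obtained by adding a last letter. -/
def snocFace {N : ℕ} (b : Fin N → SignType) (c : SignType) : Fin (N + 1) → SignType :=
  Fin.snoc (α := fun _ => SignType) b c

section snocFace

variable {N : ℕ}

@[simp] theorem snocFace_castSucc (b : Fin N → SignType) (c : SignType) (i : Fin N) :
    snocFace b c i.castSucc = b i := Fin.snoc_castSucc (α := fun _ => SignType) c b i

@[simp] theorem snocFace_last (b : Fin N → SignType) (c : SignType) :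
    snocFace b c (Fin.last N) = c := Fin.snoc_last (α := fun _ => SignType) c b

theorem exists_snocFace (w : Fin (N + 1) → SignType) : ∃ b c, w = snocFace b c :=
  ⟨Fin.init w, w (Fin.last N), (Fin.snoc_init_self (α := fun _ => SignType) w).symm⟩

theorem snocFace_inj {b b' : Fin N → SignType} {c c' : SignType} :
    snocFace b c = snocFace b' c' ↔ b = b' ∧ c = c' := by
  constructor
  · intro h
    exact ⟨funext fun i => by simpa using congrFun h i.castSucc,
      by simpa using congrFun h (Fin.last N)⟩
  · rintro ⟨rfl, rfl⟩
    rfl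

theorem forall_fin_last {p : Fin (N + 1) → Prop} :
    (∀ i, p i) ↔ (∀ i : Fin N, p i.castSucc) ∧ p (Fin.last N) :=
  ⟨fun h => ⟨fun _ => h _, h _⟩, fun h i => Fin.lastCases h.2 h.1 i⟩

theorem exists_fin_last {p : Fin (N + 1) → Prop} :
    (∃ i, p i) ↔ (∃ i : Fin N, p i.castSucc) ∨ p (Fin.last N) := by
  constructor
  · rintro ⟨i, hi⟩
    induction i using Fin.lastCases with
    | last => exact .inr hi
    | cast i => exact .inl ⟨i, hi⟩
  · rintro (⟨i, hi⟩ | hi)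
    exacts [⟨_, hi⟩, ⟨_, hi⟩]

theorem cubeSub_snocFace {b x : Fin N → SignType} {c s : SignType} :
    cubeSub (snocFace b c) (snocFace x s) ↔ cubeSub b x ∧ (s ≠ 0 → c = s) := by
  simp [cubeSub, forall_fin_last]

theorem cubeZeros_snocFace (b : Fin N → SignType) (c : SignType) :
    cubeZeros (snocFace b c) = (cubeZeros b).map Fin.castSuccEmb ∪
      (if c = 0 then {Fin.last N} else ∅) := by
  ext i
  induction i using Fin.lastCases with
  | last => split_ifs with h <;> simp [mem_cubeZeros, h]
  | cast i => split_ifs with h <;> simp [mem_cubeZeros, Fin.castSucc_ne_last]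

theorem card_cubeZeros_snocFace (b : Fin N → SignType) (c : SignType) :
    (cubeZeros (snocFace b c)).card = (cubeZeros b).card + if c = 0 then 1 else 0 := by
  rw [cubeZeros_snocFace, Finset.card_union_of_disjoint, Finset.card_map]
  · split_ifs <;> simp
  · split_ifs <;> simp [Fin.castSucc_ne_last]

theorem card_cubeZeros_snocFace_zero (b : Fin N → SignType) :
    (cubeZeros (snocFace b 0)).card = (cubeZeros b).card + 1 := by
  rw [card_cubeZeros_snocFace, if_pos rfl]

theorem card_cubeZeros_snocFace_of_ne (b : Fin N → SignType) {c : SignType} (hc : c ≠ 0) :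
    (cubeZeros (snocFace b c)).card = (cubeZeros b).card := by
  rw [card_cubeZeros_snocFace, if_neg hc, add_zero]

theorem rankIn_snocFace (b : Fin N → SignType) (c : SignType) (i : Fin N) :
    rankIn (cubeZeros (snocFace b c)) i.castSucc = rankIn (cubeZeros b) i := by
  unfold rankIn
  have : (cubeZeros (snocFace b c)).filter (· < i.castSucc) =
      ((cubeZeros b).filter (· < i)).map Fin.castSuccEmb := by
    ext j
    induction j using Fin.lastCases with
    | last =>
      have : ¬ Fin.last N < i.castSucc := (Fin.castSucc_lt_last i).not_gt
      simp [Fin.castSucc_ne_last, this]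
    | cast j => simp [mem_cubeZeros]
  rw [this, Finset.card_map]

theorem rankIn_snocFace_last (b : Fin N → SignType) (c : SignType) :
    rankIn (cubeZeros (snocFace b c)) (Fin.last N) = (cubeZeros b).card := by
  unfold rankIn
  have : (cubeZeros (snocFace b c)).filter (· < Fin.last N) =
      (cubeZeros b).map Fin.castSuccEmb := by
    ext j
    induction j using Fin.lastCases with
    | last => simp [Fin.castSucc_ne_last]
    | cast j => simp [mem_cubeZeros, Fin.castSucc_lt_last]
  rw [this, Finset.card_map]

end snocFace

/-! ### Boundaries of the atoms of a cube. -/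

/-- Some facet in direction `α` of `b` contains `a`, for a subface `a` of `b`. -/
def InFacet {N : ℕ} (α : Dir) (a b : Fin N → SignType) : Prop :=
  ∃ j ∈ cubeZeros b, a j = cubeSign α (rankIn (cubeZeros b) j)

/-- The condition defining the faces of `d_n^α R(x)` in a cube. -/
def CubeLvl {N : ℕ} (x : Fin N → SignType) (n : ℕ) (α : Dir) (a : Fin N → SignType) : Prop :=
  cubeSub a x ∧ (cubeZeros a).card ≤ n ∧
    ∀ b, cubeSub b x → (cubeZeros b).card = n + 1 → cubeSub a b → InFacet α a b

theorem mem_cube_atom {N : ℕ} {x a : (cubeFaces N).face} {n : ℕ} {α : Dir} :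
    a ∈ ((cubeFaces N).atom x).lvl n α ↔ CubeLvl x n α a := by
  refine FaceSystem.mem_atomLvl.trans ?_
  refine and_congr_right fun _ => and_congr_right fun _ => forall_congr' fun b => ?_
  refine imp_congr_right fun _ => imp_congr_right fun _ => forall_congr' fun hab => ?_
  exact exists_cubeBd_iff hab α

section CubeLvl

variable {N : ℕ}

/-- A last letter 0 is preceded by all the zeros of `b`, so its sign in a facet is governed by the
dimension of `b`. The other letters keep their ranks. -/
theorem inFacet_snocFace {α : Dir} {a b : Fin N → SignType} {c e : SignType} :
    InFacet α (snocFace a c) (snocFace b e) ↔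
      InFacet α a b ∨ (e = 0 ∧ c = cubeSign α (cubeZeros b).card) := by
  unfold InFacet
  rw [exists_fin_last]
  simp only [mem_cubeZeros, snocFace_castSucc, snocFace_last, rankIn_snocFace,
    rankIn_snocFace_last]

theorem not_inFacet_self (α : Dir) (a : Fin N → SignType) : ¬ InFacet α a a := by
  rintro ⟨j, hj, h⟩
  exact cubeSign_ne_zero _ _ (h.symm.trans (mem_cubeZeros.1 hj))

theorem cubeSub_refl (a : Fin N → SignType) : cubeSub a a := fun _ _ => rfl

theorem CubeLvl.mono {x a : Fin N → SignType} {n m : ℕ} {α β : Dir} (h : CubeLvl x n α a)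
    (hmn : n < m) : CubeLvl x m β a :=
  mem_cube_atom.1 (((cubeFaces N).atom x).mono_lt hmn α β (mem_cube_atom.2 h))

/-- This is the formula defining `cyl`. Faces of the form `snocFace b' 0` test `b` one dimension
lower; they impose no condition when the last letter of the tested face is already the sign at which
the cylinder ends. -/
theorem cubeLvl_snocFace_zero {x b : Fin N → SignType} {c : SignType} {m : ℕ} {α : Dir} :
    CubeLvl (snocFace x 0) m α (snocFace b c) ↔
      (c = cubeSign α m ∧ CubeLvl x m α b) ∨ (0 < m ∧ CubeLvl x (m - 1) α b) := by
  by_cases hc : c = 0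
  · subst hc
    have h₀ : ∀ k, ¬ (0 : SignType) = cubeSign α k := fun k h => cubeSign_ne_zero _ _ h.symm
    simp only [h₀, false_and, false_or]
    constructor
    · rintro ⟨h₁, h₂, h₃⟩
      rw [card_cubeZeros_snocFace_zero] at h₂
      refine ⟨by omega, (cubeSub_snocFace.1 h₁).1, by omega, fun b' hb' hn hb => ?_⟩
      have h := h₃ (snocFace b' 0) (cubeSub_snocFace.2 ⟨hb', by simp⟩)
        (by rw [card_cubeZeros_snocFace_zero]; omega) (cubeSub_snocFace.2 ⟨hb, by simp⟩)
      rw [inFacet_snocFace] at h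
      exact h.resolve_right fun h => h₀ _ h.2
    · rintro ⟨hm, h₁, h₂, h₃⟩
      refine ⟨cubeSub_snocFace.2 ⟨h₁, by simp⟩, by rw [card_cubeZeros_snocFace_zero]; omega, ?_⟩
      intro w hw hn hb
      obtain ⟨b', e, rfl⟩ := exists_snocFace w
      rw [cubeSub_snocFace] at hw hb
      obtain rfl : e = 0 := by
        by_contra he
        exact he (hb.2 he).symm
      rw [card_cubeZeros_snocFace_zero] at hn
      exact inFacet_snocFace.2 (.inl (h₃ b' hw.1 (by omega) hb.1))
  · constructor
    · rintro ⟨h₁, h₂, h₃⟩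
      rw [card_cubeZeros_snocFace_of_ne _ hc] at h₂
      have k₁ := (cubeSub_snocFace.1 h₁).1
      by_cases hs : c = cubeSign α m
      · refine .inl ⟨hs, k₁, h₂, fun b' hb' hn hb => ?_⟩
        have h := h₃ (snocFace b' c) (cubeSub_snocFace.2 ⟨hb', by simp⟩)
          (by rw [card_cubeZeros_snocFace_of_ne _ hc]; omega)
          (cubeSub_snocFace.2 ⟨hb, fun _ => rfl⟩)
        rw [inFacet_snocFace] at h
        exact h.resolve_right fun h => hc h.1
      -- The letter `c` is not the boundary sign, so a face `snocFace b' 0` can satisfy the facet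
      -- condition only through `b'`. Applied to `b` itself this rules out dimension `m`.
      · have key : ∀ b', cubeSub b' x → (cubeZeros b').card = m → cubeSub b b' →
            InFacet α b b' := by
          intro b' hb' hn hb
          have h := h₃ (snocFace b' 0) (cubeSub_snocFace.2 ⟨hb', by simp⟩)
            (by rw [card_cubeZeros_snocFace_zero]; omega) (cubeSub_snocFace.2 ⟨hb, by simp⟩)
          rw [inFacet_snocFace, hn] at h
          exact h.resolve_right fun h => hs h.2
        have hne : (cubeZeros b).card ≠ m := fun h =>
          not_inFacet_self α b (key b k₁ h (cubeSub_refl b))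
        exact .inr ⟨by omega, k₁, by omega, fun b' hb' hn hb => key b' hb' (by omega) hb⟩
    · intro h
      have h₁ : CubeLvl x m α b := by
        rcases h with h | h
        · exact h.2
        · exact h.2.mono (by omega)
      refine ⟨cubeSub_snocFace.2 ⟨h₁.1, by simp⟩, ?_, ?_⟩
      · rw [card_cubeZeros_snocFace_of_ne _ hc]
        exact h₁.2.1
      · intro w hw hn hb
        obtain ⟨b', e, rfl⟩ := exists_snocFace w
        rw [cubeSub_snocFace] at hw hb
        rw [inFacet_snocFace]
        by_cases he : e = 0
        · subst he
          rw [card_cubeZeros_snocFace_zero] at hn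
          rcases h with h | h
          · exact .inr ⟨rfl, by rw [h.1]; congr 1; omega⟩
          · exact .inl (h.2.2.2 b' hw.1 (by omega) hb.1)
        · rw [card_cubeZeros_snocFace_of_ne _ he] at hn
          exact .inl (h₁.2.2 b' hw.1 hn hb.1)

/-- The face of an `N`-cube in the position given by an embedding `e` and the word `u`. -/
noncomputable def embFace {p : ℕ} (e : Fin p ↪o Fin N) (u : Fin N → SignType)
    (b : Fin p → SignType) :
    Fin N → SignType := Function.extend e b u

variable {p : ℕ} (e : Fin p ↪o Fin N) (u : Fin N → SignType)

@[simp] theorem embFace_apply (b : Fin p → SignType) (i : Fin p) : embFace e u b (e i) = b i :=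
  e.injective.extend_apply _ _ _

theorem embFace_of_notMem (b : Fin p → SignType) {i : Fin N} (hi : i ∉ Set.range e) :
    embFace e u b i = u i := Function.extend_apply' _ _ _ hi

theorem embFace_injective : Function.Injective (embFace e u) := by
  intro a b h
  funext i
  rw [← embFace_apply e u a, h, embFace_apply]

variable {u}

theorem cubeSub_embFace {a b : Fin p → SignType} :
    cubeSub (embFace e u a) (embFace e u b) ↔ cubeSub a b := by
  constructor
  · intro h i hi
    have h' := h (e i) (by rwa [embFace_apply])
    rwa [embFace_apply, embFace_apply] at h'
  · intro h i hi
    by_cases hi' : i ∈ Set.range e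
    · obtain ⟨j, rfl⟩ := hi'
      rw [embFace_apply] at hi ⊢
      rw [embFace_apply]
      exact h j hi
    · rw [embFace_of_notMem _ _ _ hi', embFace_of_notMem _ _ _ hi']

theorem cubeZeros_embFace (hu : ∀ i ∉ Set.range e, u i ≠ 0) (b : Fin p → SignType) :
    cubeZeros (embFace e u b) = (cubeZeros b).map e.toEmbedding := by
  ext i
  rw [mem_cubeZeros, Finset.mem_map]
  constructor
  · intro h
    by_cases hi : i ∈ Set.range e
    · obtain ⟨j, rfl⟩ := hi
      exact ⟨j, by rwa [mem_cubeZeros, ← embFace_apply e u b], rfl⟩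
    · exact absurd h (by rw [embFace_of_notMem _ _ _ hi]; exact hu i hi)
  · rintro ⟨j, hj, rfl⟩
    exact (embFace_apply e u b j).trans (mem_cubeZeros.1 hj)

theorem card_cubeZeros_embFace (hu : ∀ i ∉ Set.range e, u i ≠ 0) (b : Fin p → SignType) :
    (cubeZeros (embFace e u b)).card = (cubeZeros b).card := by
  rw [cubeZeros_embFace e hu, Finset.card_map]

/-- The embedding is increasing and the letters outside its range are nonzero, so the number of
preceding zeros, and with it every boundary sign, is unchanged. -/
theorem rankIn_embFace (hu : ∀ i ∉ Set.range e, u i ≠ 0) (b : Fin p → SignType) (i : Fin p) :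
    rankIn (cubeZeros (embFace e u b)) (e i) = rankIn (cubeZeros b) i := by
  unfold rankIn
  rw [cubeZeros_embFace e hu, Finset.filter_map, Finset.card_map]
  congr 1
  ext j
  simp

theorem exists_of_cubeSub_embFace (hu : ∀ i ∉ Set.range e, u i ≠ 0) {w : Fin N → SignType}
    {x : Fin p → SignType} (h : cubeSub w (embFace e u x)) : ∃ b, w = embFace e u b ∧ cubeSub b x := by
  refine ⟨w ∘ e, ?_, fun i hi => ?_⟩
  · funext i
    by_cases hi : i ∈ Set.range e
    · obtain ⟨j, rfl⟩ := hi
      simp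
    · have h' := h i (by rw [embFace_of_notMem _ _ _ hi]; exact hu i hi)
      rw [h', embFace_of_notMem _ _ _ hi, embFace_of_notMem _ _ _ hi]
  · have h' := h (e i) (by rwa [embFace_apply])
    rwa [embFace_apply] at h'

theorem inFacet_embFace (hu : ∀ i ∉ Set.range e, u i ≠ 0) {α : Dir} {a b : Fin p → SignType} :
    InFacet α (embFace e u a) (embFace e u b) ↔ InFacet α a b := by
  unfold InFacet
  rw [cubeZeros_embFace e hu]
  simp only [Finset.mem_map, RelEmbedding.coe_toEmbedding, exists_exists_and_eq_and]
  simp only [← cubeZeros_embFace e hu, rankIn_embFace e hu, embFace_apply]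

theorem cubeLvl_embFace (hu : ∀ i ∉ Set.range e, u i ≠ 0) {x b : Fin p → SignType} {n : ℕ}
    {α : Dir} :
    CubeLvl (embFace e u x) n α (embFace e u b) ↔ CubeLvl x n α b := by
  unfold CubeLvl
  rw [cubeSub_embFace, card_cubeZeros_embFace e hu]
  refine and_congr_right fun _ => and_congr_right fun _ => ⟨fun h b' h₁ h₂ h₃ => ?_,
    fun h w h₁ h₂ h₃ => ?_⟩
  · rw [← inFacet_embFace e hu]
    exact h _ ((cubeSub_embFace e).2 h₁) (by rwa [card_cubeZeros_embFace e hu])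
      ((cubeSub_embFace e).2 h₃)
  · obtain ⟨b', rfl, h₄⟩ := exists_of_cubeSub_embFace e hu h₁
    rw [inFacet_embFace e hu]
    exact h b' h₄ (by rwa [card_cubeZeros_embFace e hu] at h₂) ((cubeSub_embFace e).1 h₃)

end CubeLvl

/-! ### The cube as an iterated cylinder. -/

namespace FaceSystem
open Table

section

variable {N p : ℕ}

/-- The face of a cube obtained by adding a last letter. -/
def snoc (b : (cubeFaces N).face) (c : SignType) : (cubeFaces (N + 1)).face := snocFace b c

theorem exists_snoc (w : (cubeFaces (N + 1)).face) : ∃ b c, w = snoc b c := exists_snocFace w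

theorem snoc_castSucc (b : (cubeFaces N).face) (c : SignType) (i : Fin N) :
    snoc b c i.castSucc = b i := snocFace_castSucc b c i

theorem snoc_last (b : (cubeFaces N).face) (c : SignType) :
    snoc b c (Fin.last N) = c := snocFace_last b c

theorem snoc_inj {b b' : (cubeFaces N).face} {c c' : SignType} :
    snoc b c = snoc b' c' ↔ b = b' ∧ c = c' := snocFace_inj

/-- The face of a cube in the position given by an embedding `e` and a word `u`. -/
noncomputable def emb (e : Fin p ↪o Fin N) (u : (cubeFaces N).face) (b : (cubeFaces p).face) :
    (cubeFaces N).face := embFace e u b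

theorem emb_injective (e : Fin p ↪o Fin N) (u : (cubeFaces N).face) :
    Function.Injective (emb e u) := embFace_injective e u

theorem dim_snoc_zero (a : (cubeFaces N).face) :
    (cubeFaces (N + 1)).dim (snoc a 0) = (cubeFaces N).dim a + 1 :=
  card_cubeZeros_snocFace_zero a

theorem dim_snoc_of_ne (a : (cubeFaces N).face) {c : SignType} (hc : c ≠ 0) :
    (cubeFaces (N + 1)).dim (snoc a c) = (cubeFaces N).dim a :=
  card_cubeZeros_snocFace_of_ne a hc

/-- The vertex all of whose letters are `+`. -/
def topFace (N : ℕ) : (cubeFaces N).face := fun _ : Fin N => (1 : SignType)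

/-- The vertex all of whose letters are `-`. -/
def botFace (N : ℕ) : (cubeFaces N).face := fun _ : Fin N => (-1 : SignType)

/-- The identification of the faces of `I^N × I` with those of `I^(N+1)`. -/
def SnocRel (w : (cubeFaces (N + 1)).face) (q : (cubeFaces N).prodSign.face) : Prop :=
  ∃ b c, q = pair b c ∧ w = snoc b c

/-- A table on `I^N × I` as a table on `I^(N+1)`. -/
def toCube (z : (cubeFaces N).prodSign.Table) : (cubeFaces (N + 1)).Table :=
  Table.rel SnocRel z

theorem mem_toCube {z : (cubeFaces N).prodSign.Table} {k : ℕ} {α : Dir} {b : (cubeFaces N).face}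
    {c : SignType} : snoc b c ∈ (toCube z).lvl k α ↔ pair b c ∈ z.lvl k α := by
  refine mem_rel.trans ⟨?_, fun h => ⟨_, h, b, c, rfl, rfl⟩⟩
  rintro ⟨_, h, b', c', rfl, h'⟩
  obtain ⟨rfl, rfl⟩ := snoc_inj.1 h'
  exact h

theorem ext_snoc {x y : (cubeFaces (N + 1)).Table} (h : ∀ k α b c,
    snoc b c ∈ x.lvl k α ↔ snoc b c ∈ y.lvl k α) : x = y := by
  apply ext_mem
  intro k α w
  obtain ⟨b, c, rfl⟩ := exists_snoc w
  exact h k α b c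

theorem mem_atom_snoc_zero {x b : (cubeFaces N).face} {c : SignType} {k : ℕ} {α : Dir} :
    snoc b c ∈ ((cubeFaces (N + 1)).atom (snoc x 0)).lvl k α ↔
      (c = cubeSign α k ∧ b ∈ ((cubeFaces N).atom x).lvl k α) ∨
        (0 < k ∧ b ∈ ((cubeFaces N).atom x).lvl (k - 1) α) :=
  mem_cube_atom.trans (cubeLvl_snocFace_zero.trans
    (or_congr (and_congr_right fun _ => mem_cube_atom.symm)
      (and_congr_right fun _ => mem_cube_atom.symm)))

theorem atom_snoc_zero (a : (cubeFaces N).face) :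
    (cubeFaces (N + 1)).atom (snoc a 0) = toCube (Table.cyl ((cubeFaces N).atom a)) := by
  apply ext_snoc
  intro k α b c
  rw [mem_toCube, mem_cyl, mem_atom_snoc_zero]

/-- The image of a table in a face of a cube. -/
noncomputable def faceMap (e : Fin p ↪o Fin N) (u : (cubeFaces N).face) (x : (cubeFaces p).Table) :
    (cubeFaces N).Table :=
  Table.rel (fun w b => w = emb e u b) x

variable {e : Fin p ↪o Fin N} {u : (cubeFaces N).face}

theorem mem_faceMap {x : (cubeFaces p).Table} {k : ℕ} {α : Dir} {w : (cubeFaces N).face} :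
    w ∈ (faceMap e u x).lvl k α ↔ ∃ b ∈ x.lvl k α, w = emb e u b := mem_rel

theorem emb_mem_faceMap {x : (cubeFaces p).Table} {k : ℕ} {α : Dir} {b : (cubeFaces p).face} :
    emb e u b ∈ (faceMap e u x).lvl k α ↔ b ∈ x.lvl k α := by
  refine mem_faceMap.trans ⟨?_, fun h => ⟨_, h, rfl⟩⟩
  rintro ⟨b', h, h'⟩
  rwa [emb_injective e u h']

theorem faceMap_d (α : Dir) (n : ℕ) (x : (cubeFaces p).Table) :
    faceMap e u (Table.d α n x) = Table.d α n (faceMap e u x) := rel_d _ _ _ _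

theorem faceMap_atom (hu : ∀ i ∉ Set.range e, u i ≠ 0) (a : (cubeFaces p).face) :
    faceMap e u ((cubeFaces p).atom a) = (cubeFaces N).atom (emb e u a) := by
  apply ext_mem
  intro k α w
  rw [mem_faceMap]
  constructor
  · rintro ⟨b, hb, rfl⟩
    exact mem_cube_atom.2 ((cubeLvl_embFace e hu).2 (mem_cube_atom.1 hb))
  · intro hw
    have hw' := mem_cube_atom.1 hw
    obtain ⟨b, rfl, -⟩ := exists_of_cubeSub_embFace e hu hw'.1
    exact ⟨b, mem_cube_atom.2 ((cubeLvl_embFace e hu).1 hw'), rfl⟩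

theorem CGen.faceMap (hu : ∀ i ∉ Set.range e, u i ≠ 0) {d : ℕ} {x : (cubeFaces p).Table}
    (hx : CGen (cubeFaces p) d x) : CGen (cubeFaces N) d (faceMap e u x) := by
  induction hx with
  | atom a ha =>
    rw [faceMap_atom hu]
    exact .atom _ (le_of_eq_of_le (card_cubeZeros_embFace e hu a) ha)
  | comp _ _ hz ihx ihy => exact .comp ihx ihy (hz.rel _)

/-- The end of a cylinder in direction `c`. -/
noncomputable def endMap (c : SignType) (x : (cubeFaces N).Table) : (cubeFaces (N + 1)).Table :=
  faceMap Fin.castSuccOrderEmb (snoc (topFace N) c) x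

theorem snoc_one_ne_zero {c : SignType} (hc : c ≠ 0) :
    ∀ i ∉ Set.range (Fin.castSuccOrderEmb (n := N)), snoc (topFace N) c i ≠ 0 := by
  intro i hi
  induction i using Fin.lastCases with
  | last => exact (snocFace_last (topFace N) c).trans_ne hc
  | cast i => exact absurd ⟨i, rfl⟩ hi

theorem emb_castSucc (b b' : (cubeFaces N).face) (c : SignType) :
    emb Fin.castSuccOrderEmb (snoc b' c) b = snoc b c := by
  refine funext fun i => ?_
  induction i using Fin.lastCases with
  | last =>
    refine (embFace_of_notMem Fin.castSuccOrderEmb (snocFace b' c) b ?_).trans ?_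
    · rintro ⟨i, hi⟩
      exact Fin.castSucc_ne_last i hi
    · exact (snocFace_last b' c).trans (snocFace_last b c).symm
  | cast i => exact (embFace_apply Fin.castSuccOrderEmb _ b i).trans (snocFace_castSucc b c i).symm

theorem mem_endMap {x : (cubeFaces N).Table} {k : ℕ} {α : Dir} {b : (cubeFaces N).face}
    {c s : SignType} : snoc b c ∈ (endMap s x).lvl k α ↔ c = s ∧ b ∈ x.lvl k α := by
  refine mem_faceMap.trans ⟨?_, ?_⟩
  · rintro ⟨b', h, h'⟩
    rw [emb_castSucc] at h'
    obtain ⟨rfl, rfl⟩ := snoc_inj.1 h'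
    exact ⟨rfl, h⟩
  · rintro ⟨rfl, h⟩
    exact ⟨b, h, (emb_castSucc _ _ _).symm⟩

theorem endMap_atom {c : SignType} (hc : c ≠ 0) (a : (cubeFaces N).face) :
    endMap c ((cubeFaces N).atom a) = (cubeFaces (N + 1)).atom (snoc a c) := by
  rw [endMap, faceMap_atom (snoc_one_ne_zero hc), emb_castSucc]

theorem toCube_whisk_zero (α : Dir) (x : (cubeFaces N).Table) :
    toCube (Table.whisk α 0 x) = endMap (cubeSign α 0) x := by
  apply ext_snoc
  intro k γ b c
  rw [mem_toCube, mem_whisk, mem_endMap]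
  simp

theorem cylMap_cube (N : ℕ) : CylMap (cubeFaces N) (cubeFaces (N + 1)) SnocRel where
  cyl a := ⟨snoc a 0, (atom_snoc_zero a).symm, dim_snoc_zero a⟩
  whisk α a := ⟨snoc a (cubeSign α 0),
    (toCube_whisk_zero α _).trans (endMap_atom (cubeSign_ne_zero _ _) a),
    (dim_snoc_of_ne a (cubeSign_ne_zero _ _)).le⟩

/-- Induction on the last letter: if it is 0 the atom is a cylinder on an atom, and otherwise it is
the image of an atom in an end of the cylinder. -/
theorem closed_cube : ∀ N, Closed (cubeFaces N)
  | 0 => fun a j α hj => absurd hj (Nat.not_lt.2 ((Finset.card_le_univ (cubeZeros a)).trans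
      (Nat.zero_le j)))
  | N + 1 => fun w j α hj => by
    have hN := closed_cube N
    obtain ⟨a, c, rfl⟩ := exists_snoc w
    by_cases hc : c = 0
    · subst hc
      rw [dim_snoc_zero] at hj
      rw [atom_snoc_zero]
      exact (cylMap_cube N).cGen_d_cyl_atom hN a (Nat.lt_succ_iff.1 hj) α
    · rw [dim_snoc_of_ne _ hc] at hj
      rw [← endMap_atom hc, endMap, ← faceMap_d]
      exact (hN a j α hj).faceMap (snoc_one_ne_zero hc)

theorem IsCell.faceMap (hu : ∀ i ∉ Set.range e, u i ≠ 0) {x : (cubeFaces p).Table}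
    (hx : IsCell (cubeFaces p) x) : IsCell (cubeFaces N) (faceMap e u x) := by
  obtain ⟨d, hd⟩ := hx.exists_cGen (closed_cube p)
  exact (hd.faceMap hu).isCell

theorem IsCell.toCube_cyl {x : (cubeFaces N).Table} (hx : IsCell (cubeFaces N) x) :
    IsCell (cubeFaces (N + 1)) (toCube (Table.cyl x)) :=
  (cylMap_cube N).isCell_cyl (closed_cube N) hx

theorem IsCell.toCube_whisk {x : (cubeFaces N).Table} (hx : IsCell (cubeFaces N) x) (α : Dir)
    (n : ℕ) : IsCell (cubeFaces (N + 1)) (toCube (Table.whisk α n x)) :=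
  (cylMap_cube N).isCell_whisk (closed_cube N) hx α n

end

end FaceSystem

/-! ### Initial and final vertices, and cells of positive dimension. -/

namespace FaceSystem
open Table

namespace Table.IsComp

variable {K : FaceSystem} {n : ℕ} {x y z : K.Table}

theorem lvl_lt_left (h : IsComp n x y z) {k : ℕ} (hk : k < n) (α : Dir) :
    z.lvl k α = x.lvl k α := Set.ext fun a => ((isComp_iff.1 h).1 k hk α a).2

theorem lvl_lt_right (h : IsComp n x y z) {k : ℕ} (hk : k < n) (α : Dir) :
    z.lvl k α = y.lvl k α := Set.ext fun a => by
  have h := (isComp_iff.1 h).1 k hk α a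
  exact h.2.trans h.1

theorem lvl_src (h : IsComp n x y z) : z.lvl n .src = x.lvl n .src :=
  Set.ext (isComp_iff.1 h).2.2.1

theorem lvl_tgt (h : IsComp n x y z) : z.lvl n .tgt = y.lvl n .tgt :=
  Set.ext (isComp_iff.1 h).2.2.2.1

theorem lvl_mid (h : IsComp n x y z) : x.lvl n .tgt = y.lvl n .src :=
  Set.ext (isComp_iff.1 h).2.1

theorem mem_or (h : IsComp n x y z) {k : ℕ} {α : Dir} {a : K.face} (ha : a ∈ z.lvl k α) :
    a ∈ x.lvl k α ∨ a ∈ y.lvl k α := by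
  rw [h.mem] at ha
  tauto

end Table.IsComp

theorem Table.lvl_d_of_lt {K : FaceSystem} (x : K.Table) {k n : ℕ} (h : k < n) (α β : Dir) :
    (Table.d α n x).lvl k β = x.lvl k β := by
  rw [d_lvl, if_pos h]

theorem isComp_tgt_unit {K : FaceSystem} (n : ℕ) (x : K.Table) :
    IsComp n x (Table.d .tgt n x) x :=
  ⟨(d_d_ge x .tgt .src le_rfl).symm,
    (K.tables.tgt_unit n x (d_d_ge x .tgt .src le_rfl).symm).symm⟩

theorem isComp_src_unit {K : FaceSystem} (n : ℕ) (x : K.Table) :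
    IsComp n (Table.d .src n x) x x :=
  ⟨d_d_ge x .src .tgt le_rfl, (K.tables.src_unit n x (d_d_ge x .src .tgt le_rfl)).symm⟩

section

variable {N : ℕ}

/-- The initial or final vertex of a face. -/
def corner (α : Dir) (a : (cubeFaces N).face) : (cubeFaces N).face :=
  fun i : Fin N => if a i = 0 then cubeSign α 0 else a i

theorem corner_snoc (α : Dir) (a : (cubeFaces N).face) (c : SignType) :
    corner α (snoc a c) = snoc (corner α a) (if c = 0 then cubeSign α 0 else c) := by
  refine funext fun i => ?_
  induction i using Fin.lastCases with
  | last => simp only [corner, snoc_last]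
  | cast i => simp only [corner, snoc_castSucc]

/-- One letter at a time: in level `0` a cylinder contributes only the end of sign `cubeSign α 0`.
-/
theorem atom_lvl_zero : ∀ {N : ℕ} (a : (cubeFaces N).face) (α : Dir),
    ((cubeFaces N).atom a).lvl 0 α = {corner α a}
  | 0, a, α => by
    have e : ∀ b : (cubeFaces 0).face, b = a := fun b => funext fun i : Fin 0 => i.elim0
    refine Set.ext fun b => ⟨fun _ => (e b).trans (e _).symm, fun _ => ?_⟩
    rw [e b]
    exact (atomLvl_of_dim_le a ((Finset.card_le_univ (cubeZeros (N := 0) a)).trans le_rfl) α a).2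
      ((cubeFaces 0).sub_refl a)
  | N + 1, w, α => by
    obtain ⟨a, c, rfl⟩ := exists_snoc w
    refine Set.ext fun w => ?_
    obtain ⟨b, e, rfl⟩ := exists_snoc w
    rw [corner_snoc, Set.mem_singleton_iff, snoc_inj]
    by_cases hc : c = 0
    · subst hc
      rw [mem_atom_snoc_zero, atom_lvl_zero a]
      simp [and_comm]
    · rw [← endMap_atom hc, mem_endMap, atom_lvl_zero a, if_neg hc]
      simp [and_comm]

/-- The `0`-source of `x` is the vertex `v`, its `0`-target is the vertex `w`, and all its faces lie
between `v` and `w`. -/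
structure Oriented (x : (cubeFaces N).Table) (v w : (cubeFaces N).face) : Prop where
  src : x.lvl 0 .src = {v}
  tgt : x.lvl 0 .tgt = {w}
  le : ∀ k α, ∀ b ∈ x.lvl k α, ∀ i : Fin N, v i ≤ b i ∧ b i ≤ w i

theorem SignType.neg_one_le' (s : SignType) : (-1 : SignType) ≤ s := by revert s; decide

theorem SignType.le_one' (s : SignType) : s ≤ (1 : SignType) := by revert s; decide

theorem oriented_atom (a : (cubeFaces N).face) :
    Oriented ((cubeFaces N).atom a) (corner .src a) (corner .tgt a) where
  src := atom_lvl_zero a .src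
  tgt := atom_lvl_zero a .tgt
  le k α b hb i := by
    have hb' := (mem_cube_atom.1 hb).1 i
    unfold corner
    by_cases h : a i = 0
    · rw [if_pos h, if_pos h, cubeSign_src_zero, cubeSign_tgt_zero]
      exact ⟨SignType.neg_one_le' _, SignType.le_one' _⟩
    · rw [if_neg h, if_neg h]
      exact ⟨(hb' h).ge, (hb' h).le⟩

/-- A composition `*_0` passes through a common vertex, so the coordinatewise bounds of the two
factors combine. In higher compositions the factors have the same end vertices. -/
theorem IsCell.oriented {x : (cubeFaces N).Table} (hx : IsCell (cubeFaces N) x) :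
    ∃ v w, Oriented x v w := by
  refine hx.induction (closed_cube N) (p := fun x => ∃ v w, Oriented x v w)
    (fun a => ⟨_, _, oriented_atom a⟩) ?_
  rintro n x y z - - h ⟨v, w, hx⟩ ⟨v', w', hy⟩
  rcases Nat.eq_zero_or_pos n with rfl | hn
  · have e : w = v' := by
      have := h.lvl_mid
      rw [hx.tgt, hy.src] at this
      exact Set.singleton_injective this
    subst e
    have h₁ := fun i => (hx.le 0 .tgt w (hx.tgt ▸ rfl) i).1
    have h₂ := fun i => (hy.le 0 .src w (hy.src ▸ rfl) i).2
    refine ⟨v, w', h.lvl_src.trans hx.src, h.lvl_tgt.trans hy.tgt, fun k α b hb i => ?_⟩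
    rcases h.mem_or hb with hb | hb
    · exact ⟨(hx.le k α b hb i).1, (hx.le k α b hb i).2.trans (h₂ i)⟩
    · exact ⟨(h₁ i).trans (hy.le k α b hb i).1, (hy.le k α b hb i).2⟩
  · have e₁ := (h.lvl_lt_left hn .src).symm.trans (h.lvl_lt_right hn .src)
    have e₂ := (h.lvl_lt_left hn .tgt).symm.trans (h.lvl_lt_right hn .tgt)
    rw [hx.src, hy.src] at e₁
    rw [hx.tgt, hy.tgt] at e₂
    obtain rfl := Set.singleton_injective e₁
    obtain rfl := Set.singleton_injective e₂
    refine ⟨v, w, (h.lvl_lt_left hn _).trans hx.src, (h.lvl_lt_left hn _).trans hx.tgt,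
      fun k α b hb i => ?_⟩
    rcases h.mem_or hb with hb | hb
    · exact hx.le k α b hb i
    · exact hy.le k α b hb i

theorem IsCell.nonempty {x : (cubeFaces N).Table} (hx : IsCell (cubeFaces N) x) (k : ℕ) (α : Dir) :
    (x.lvl k α).Nonempty := by
  obtain ⟨v, w, h⟩ := hx.oriented
  rcases Nat.eq_zero_or_pos k with rfl | hk
  · cases α
    · exact ⟨v, h.src ▸ rfl⟩
    · exact ⟨w, h.tgt ▸ rfl⟩
  · exact ⟨v, x.mono_le (α := .src) hk (h.src ▸ rfl)⟩

/-- All faces lie coordinatewise between the initial and the final vertex; if these coincide, no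
other face is left. -/
theorem IsCell.d_zero {x : (cubeFaces N).Table} (hx : IsCell (cubeFaces N) x)
    (e : x.lvl 0 .src = x.lvl 0 .tgt) (α : Dir) : Table.d α 0 x = x := by
  obtain ⟨v, w, h⟩ := hx.oriented
  obtain rfl : v = w := by
    rw [h.src, h.tgt] at e
    exact Set.singleton_injective e
  have h₀ : ∀ α, x.lvl 0 α = {v} := by
    rintro (_ | _)
    exacts [h.src, h.tgt]
  apply ext_mem
  intro k β b
  rw [mem_d, h₀]
  constructor
  · rintro (⟨hk, -⟩ | ⟨-, rfl⟩)
    · omega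
    · rcases Nat.eq_zero_or_pos k with rfl | hk
      · rw [h₀]
        rfl
      · exact x.mono_le (α := α) hk (h₀ α ▸ rfl)
  · intro hb
    exact .inr ⟨Nat.zero_le k, funext fun i : Fin N =>
      le_antisymm (h.le k β b hb i).2 (h.le k β b hb i).1⟩

/-- The cells of positive dimension. -/
structure Proper (x : (cubeFaces N).Table) : Prop where
  isCell : IsCell (cubeFaces N) x
  ne : x.lvl 0 .src ≠ x.lvl 0 .tgt

theorem Proper.d {x : (cubeFaces N).Table} (hx : Proper x) (α : Dir) (n : ℕ) :
    Proper (Table.d α (n + 1) x) where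
  isCell := hx.isCell.d α _
  ne := by
    rw [lvl_d_of_lt _ (Nat.succ_pos n), lvl_d_of_lt _ (Nat.succ_pos n)]
    exact hx.ne

theorem Proper.comp {n : ℕ} {x y z : (cubeFaces N).Table} (hx : Proper x) (hy : Proper y)
    (h : IsComp (n + 1) x y z) : Proper z where
  isCell := hx.isCell.comp hy.isCell h
  ne := by
    rw [h.lvl_lt_left (Nat.succ_pos n), h.lvl_lt_left (Nat.succ_pos n)]
    exact hx.ne

/-- The last coordinate goes from - to +, so the two end vertices differ. -/
theorem Proper.of_snoc {z : (cubeFaces (N + 1)).Table} (hz : IsCell _ z)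
    (hs : ∀ b c, snoc b c ∈ z.lvl 0 .src → c = -1) (ht : ∀ b c, snoc b c ∈ z.lvl 0 .tgt → c = 1) :
    Proper z := by
  refine ⟨hz, fun e => ?_⟩
  obtain ⟨w, hw⟩ := hz.nonempty 0 .src
  obtain ⟨b, c, rfl⟩ := exists_snoc w
  have h := (hs b c hw).symm.trans (ht b c (e ▸ hw))
  exact absurd h (by decide)

theorem Proper.faceMap {p : ℕ} {e : Fin p ↪o Fin N} {u : (cubeFaces N).face}
    (hu : ∀ i ∉ Set.range e, u i ≠ 0) {x : (cubeFaces p).Table} (hx : Proper x) :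
    Proper (faceMap e u x) where
  isCell := hx.isCell.faceMap hu
  ne h := hx.ne <| Set.ext fun b => by
    rw [← emb_mem_faceMap (e := e) (u := u), h, emb_mem_faceMap]

theorem Proper.endMap {c : SignType} (hc : c ≠ 0) {x : (cubeFaces N).Table} (hx : Proper x) :
    Proper (endMap c x) := hx.faceMap (snoc_one_ne_zero hc)

theorem Proper.toCube_cyl {x : (cubeFaces N).Table} (hx : IsCell _ x) :
    Proper (toCube (Table.cyl x)) := by
  refine .of_snoc hx.toCube_cyl (fun b c h => ?_) (fun b c h => ?_)
  · rw [mem_toCube, mem_cyl, cubeSign_src_zero] at h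
    simp at h
    exact h.1
  · rw [mem_toCube, mem_cyl, cubeSign_tgt_zero] at h
    simp at h
    exact h.1

theorem Proper.toCube_whisk {x : (cubeFaces N).Table} (hx : IsCell _ x) (α : Dir) (n : ℕ) :
    Proper (toCube (Table.whisk α (n + 1) x)) := by
  refine .of_snoc (hx.toCube_whisk α _) (fun b c h => ?_) (fun b c h => ?_)
  · rw [mem_toCube, mem_whisk, cubeSign_src_zero] at h
    simp at h
    exact h.1
  · rw [mem_toCube, mem_whisk, cubeSign_tgt_zero] at h
    simp at h
    exact h.1

/-! ### The congruence generated by x ~ x *_0 y, and its stability under cylinders. -/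

/-- The congruence on the cells of positive dimension generated by `x ~ x *_0 y`. -/
inductive NegEqv : (cubeFaces N).Table → (cubeFaces N).Table → Prop
  | refl {x} : Proper x → NegEqv x x
  | symm {x y} : NegEqv x y → NegEqv y x
  | trans {x y z} : NegEqv x y → NegEqv y z → NegEqv x z
  | comp {n x y z x' y' z'} : NegEqv x x' → NegEqv y y' → IsComp (n + 1) x y z →
      IsComp (n + 1) x' y' z' → NegEqv z z'
  | step {x y z} : Proper x → Proper y → Proper z → IsComp 0 x y z → NegEqv x z

namespace NegEqv

theorem proper {x y : (cubeFaces N).Table} (h : NegEqv x y) : Proper x ∧ Proper y := by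
  induction h with
  | refl h => exact ⟨h, h⟩
  | symm _ ih => exact ih.symm
  | trans _ _ ih ih' => exact ⟨ih.1, ih'.2⟩
  | comp _ _ h h' ih ih' => exact ⟨ih.1.comp ih'.1 h, ih.2.comp ih'.2 h'⟩
  | step hx _ hz _ => exact ⟨hx, hz⟩

theorem faceMap {p : ℕ} {e : Fin p ↪o Fin N} {u : (cubeFaces N).face}
    (hu : ∀ i ∉ Set.range e, u i ≠ 0) {x y : (cubeFaces p).Table} (h : NegEqv x y) :
    NegEqv (faceMap e u x) (faceMap e u y) := by
  induction h with
  | refl h => exact .refl (h.faceMap hu)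
  | symm _ ih => exact ih.symm
  | trans _ _ ih ih' => exact ih.trans ih'
  | comp _ _ h h' ih ih' => exact .comp ih ih' (h.rel _) (h'.rel _)
  | step hx hy hz h => exact .step (hx.faceMap hu) (hy.faceMap hu) (hz.faceMap hu) (h.rel _)

theorem endMap {c : SignType} (hc : c ≠ 0) {x y : (cubeFaces N).Table} (h : NegEqv x y) :
    NegEqv (endMap c x) (endMap c y) := h.faceMap (snoc_one_ne_zero hc)

theorem d {x y : (cubeFaces N).Table} (h : NegEqv x y) (α : Dir) (m : ℕ) :
    NegEqv (Table.d α (m + 1) x) (Table.d α (m + 1) y) := by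
  induction h with
  | refl h => exact .refl (h.d α m)
  | symm _ ih => exact ih.symm
  | trans _ _ ih ih' => exact ih.trans ih'
  | @comp n x y z x' y' z' _ _ h h' ih ih' =>
    by_cases hmn : m + 1 = n + 1
    · obtain rfl : m = n := by omega
      cases α
      · rwa [h.d_src, h'.d_src]
      · rwa [h.d_tgt, h'.d_tgt]
    · exact .comp ih ih' (h.d α hmn) (h'.d α hmn)
  | step hx hy hz h =>
    exact .step (hx.d α m) (hy.d α m) (hz.d α m) (h.d α (Nat.succ_ne_zero m))

end NegEqv

/-- The source and the target of `x` in dimension `n` are equivalent to `x`. -/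
def DimLe (n : ℕ) (x : (cubeFaces N).Table) : Prop := ∀ α, NegEqv (Table.d α n x) x

theorem DimLe.of_eqv {n : ℕ} {x y : (cubeFaces N).Table} (h : NegEqv x y)
    (hx : DimLe (n + 1) x) : DimLe (n + 1) y :=
  fun α => ((h.d α n).symm.trans (hx α)).trans h

theorem DimLe.of_d_eq {n : ℕ} {x : (cubeFaces N).Table} (hx : Proper x)
    (h : ∀ α, Table.d α n x = x) : DimLe n x := fun α => by
  rw [h]
  exact .refl hx

/-- Composition with a degenerate morphism on the right. -/
theorem isComp_eqv_left {n : ℕ} {x y z : (cubeFaces N).Table} (h : IsComp (n + 1) x y z)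
    (hx : Proper x) (hy : DimLe (n + 1) y) : NegEqv z x := by
  refine .comp (.refl hx) (hy .src).symm h ?_
  -- The `(n + 1)`-source that replaces `y` is the `(n + 1)`-target of `x`, so what remains is
  -- composition with an identity.
  rw [← h.choose]
  exact isComp_tgt_unit _ x

/-- Composition with a degenerate morphism on the left. -/
theorem isComp_eqv_right {n : ℕ} {x y z : (cubeFaces N).Table} (h : IsComp (n + 1) x y z)
    (hx : DimLe (n + 1) x) (hy : Proper y) : NegEqv z y := by
  refine .comp (hx .tgt).symm (.refl hy) h ?_
  rw [h.choose]
  exact isComp_src_unit _ y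

theorem toCube_isComp {n : ℕ} {x y z : (cubeFaces N).prodSign.Table} (h : IsComp n x y z) :
    IsComp n (toCube x) (toCube y) (toCube z) := h.rel _

namespace NegEqv

/-- The whisker is `endMap (-1) x` followed by an edge over the final vertex of `x`, and the
congruence drops what follows. In `toCube_whisk_one'` the order is reversed: only an edge over the
initial vertex survives. -/
theorem toCube_whisk_one {x : (cubeFaces N).Table} (hx : Proper x) :
    NegEqv (FaceSystem.endMap (-1) x) (toCube (Table.whisk .tgt 1 x)) := by
  have h := toCube_isComp (isComp_whisk_tgt 0 x)
  rw [toCube_whisk_zero, cubeSign_src_zero] at h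
  exact .step (hx.endMap (by decide)) (.toCube_cyl (hx.isCell.d _ _))
    (.toCube_whisk hx.isCell _ _) h

theorem toCube_whisk_one' {x : (cubeFaces N).Table} (hx : Proper x) :
    NegEqv (toCube (Table.cyl (Table.d .src 0 x))) (toCube (Table.whisk .src 1 x)) := by
  have h := toCube_isComp (isComp_whisk_src 0 x)
  rw [toCube_whisk_zero, cubeSign_tgt_zero] at h
  exact .step (.toCube_cyl (hx.isCell.d _ _)) (hx.endMap (by decide))
    (.toCube_whisk hx.isCell _ _) h

/-- Steps only change what comes after the first factor. Thus congruent cells have the same initial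
vertex, and the edges over it coincide in `whisk_of_cyl`. -/
theorem lvl_zero_src {x y : (cubeFaces N).Table} (h : NegEqv x y) :
    x.lvl 0 .src = y.lvl 0 .src := by
  induction h with
  | refl h => rfl
  | symm _ ih => exact ih.symm
  | trans _ _ ih ih' => exact ih.trans ih'
  | @comp n x y z x' y' z' _ _ h h' ih ih' =>
    rw [h.lvl_lt_left (Nat.succ_pos n), h'.lvl_lt_left (Nat.succ_pos n), ih]
  | step hx hy hz h => exact h.lvl_src.symm

theorem d_zero_src {x y : (cubeFaces N).Table} (h : NegEqv x y) :
    Table.d .src 0 x = Table.d .src 0 y := by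
  apply ext_mem
  intro k α a
  rw [mem_d, mem_d, h.lvl_zero_src]
  simp

/-- By `IsComp.cyl` the cylinder on `z` is `A *_1 B`. Here `A` begins with the cylinder on `x`, and
is congruent to it. The factor `B` begins with the `1`-target of `x` in the end -, so it is
degenerate in dimension `1` modulo the congruence and can be dropped. -/
theorem cyl_step {x y z : (cubeFaces N).Table} (hx : Proper x) (hy : Proper y)
    (h : IsComp 0 x y z) : NegEqv (toCube (Table.cyl x)) (toCube (Table.cyl z)) := by
  obtain ⟨A, B, hA, hB, hAB⟩ := h.cyl
  have hA' := toCube_isComp hA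
  have hB' := toCube_isComp hB
  rw [toCube_whisk_zero, cubeSign_tgt_zero] at hA'
  rw [toCube_whisk_zero, cubeSign_src_zero] at hB'
  have hx' := Proper.toCube_cyl hx.isCell
  have hy' := Proper.toCube_cyl hy.isCell
  have hx₁ := (hx.d .tgt 0).endMap (c := -1) (by decide)
  have hy₁ := (hy.d .src 0).endMap (c := 1) (by decide)
  have pA : Proper (toCube A) := by
    refine .of_snoc (hx'.isCell.comp hy₁.isCell hA') (fun b c h => ?_) (fun b c h => ?_)
    · rw [hA'.lvl_src, mem_toCube, mem_cyl, cubeSign_src_zero] at h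
      simp at h
      exact h.1
    · rw [hA'.lvl_tgt, mem_endMap] at h
      exact h.1
  have pB : Proper (toCube B) := by
    refine .of_snoc (hx₁.isCell.comp hy'.isCell hB') (fun b c h => ?_) (fun b c h => ?_)
    · rw [hB'.lvl_src, mem_endMap] at h
      exact h.1
    · rw [hB'.lvl_tgt, mem_toCube, mem_cyl, cubeSign_tgt_zero] at h
      simp at h
      exact h.1
  have dB : DimLe 1 (toCube B) := by
    refine .of_eqv (.step hx₁ hy' pB hB') (.of_d_eq hx₁ fun α => ?_)
    rw [FaceSystem.endMap, ← faceMap_d, d_d_ge _ _ _ le_rfl]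
  exact (NegEqv.step hx' hy₁ pA hA').trans (isComp_eqv_left (toCube_isComp hAB) pA dB).symm

/-- The recursion for `whisk`, started in dimension `1` instead of `0`. There the whisker is
congruent to the end - of the cylinder in direction `.tgt`, and to the edge over the common initial
vertex in direction `.src`. -/
theorem whisk_of_cyl {x y : (cubeFaces N).Table} (h : NegEqv x y)
    (hc : ∀ i α, NegEqv (toCube (Table.cyl (Table.d α (i + 1) x)))
      (toCube (Table.cyl (Table.d α (i + 1) y)))) (n : ℕ) (α : Dir) :
    NegEqv (toCube (Table.whisk α (n + 1) x)) (toCube (Table.whisk α (n + 1) y)) := by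
  induction n generalizing α with
  | zero =>
    cases α
    · refine (toCube_whisk_one' h.proper.1).symm.trans ?_
      rw [h.d_zero_src]
      exact toCube_whisk_one' h.proper.2
    · exact (toCube_whisk_one h.proper.1).symm.trans
        ((h.endMap (by decide)).trans (toCube_whisk_one h.proper.2))
  | succ n ih =>
    cases α
    · exact .comp (hc n .src) (ih .tgt) (toCube_isComp (isComp_whisk_src (n + 1) x))
        (toCube_isComp (isComp_whisk_src (n + 1) y))
    · exact .comp (ih .src) (hc n .tgt) (toCube_isComp (isComp_whisk_tgt (n + 1) x))
        (toCube_isComp (isComp_whisk_tgt (n + 1) y))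

theorem cyl_d_d {x y : (cubeFaces N).Table}
    (hc : ∀ i α, NegEqv (toCube (Table.cyl (Table.d α (i + 1) x)))
      (toCube (Table.cyl (Table.d α (i + 1) y)))) (m : ℕ) (β : Dir) (i : ℕ) (α : Dir) :
    NegEqv (toCube (Table.cyl (Table.d α (i + 1) (Table.d β (m + 1) x))))
      (toCube (Table.cyl (Table.d α (i + 1) (Table.d β (m + 1) y)))) := by
  rcases lt_or_ge (i + 1) (m + 1) with h | h
  · rw [d_d_lt _ _ _ h, d_d_lt _ _ _ h]
    exact hc i α
  · rw [d_d_ge _ _ _ h, d_d_ge _ _ _ h]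
    exact hc m β

/-- The statement is about all boundaries because the whiskers in `IsComp.cyl` contain cylinders on
the boundaries of the factors. A statement about `x` and `y` alone would not pass through
compositions. -/
theorem cyl_d {x y : (cubeFaces N).Table} (h : NegEqv x y) : ∀ i α,
    NegEqv (toCube (Table.cyl (Table.d α (i + 1) x)))
      (toCube (Table.cyl (Table.d α (i + 1) y))) := by
  induction h with
  | refl h => exact fun i α => .refl (.toCube_cyl (h.isCell.d _ _))
  | symm _ ih => exact fun i α => (ih i α).symm
  | trans _ _ ih ih' => exact fun i α => (ih i α).trans (ih' i α)
  | step hx hy hz h =>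
    exact fun i α => cyl_step (hx.d α i) (hy.d α i) (h.d α (Nat.succ_ne_zero i))
  | @comp n x y z x' y' z' hx hy h h' ihx ihy =>
    intro i α
    by_cases hin : i + 1 = n + 1
    · obtain rfl : i = n := by omega
      cases α
      · rw [h.d_src, h'.d_src]
        exact ihx _ _
      · rw [h.d_tgt, h'.d_tgt]
        exact ihy _ _
    · obtain ⟨A, B, hA, hB, hAB⟩ := (h.d α hin).cyl
      obtain ⟨A', B', hA', hB', hAB'⟩ := (h'.d α hin).cyl
      refine .comp (.comp (ihx i α) ?_ (toCube_isComp hA) (toCube_isComp hA'))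
        (.comp ?_ (ihy i α) (toCube_isComp hB) (toCube_isComp hB'))
        (toCube_isComp hAB) (toCube_isComp hAB')
      · exact whisk_of_cyl ((hy.d α i).d _ _) (cyl_d_d (cyl_d_d ihy i α) _ _) n _
      · exact whisk_of_cyl ((hx.d α i).d _ _) (cyl_d_d (cyl_d_d ihx i α) _ _) n _

/-- The congruence is compatible with cylinders. -/
theorem cyl {x y : (cubeFaces N).Table} (h : NegEqv x y) :
    NegEqv (toCube (Table.cyl x)) (toCube (Table.cyl y)) := by
  obtain ⟨n, hn⟩ := x.exists_d_eq
  obtain ⟨m, hm⟩ := y.exists_d_eq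
  -- In large dimension the boundary is the cell itself.
  have := h.cyl_d (n + m) .src
  rwa [hn _ (by omega), hm _ (by omega)] at this

end NegEqv
end
end FaceSystem

/-! ### Gluing a cone does not change the class of a cylinder. -/

namespace FaceSystem
open Table

theorem Table.d_cyl_of_d_eq {K : FaceSystem} {x : K.Table} {n : ℕ}
    (h : ∀ α, Table.d α n x = x) (α : Dir) :
    Table.d α (n + 1) (Table.cyl x) = Table.cyl x := by
  have e : ∀ k, n ≤ k → ∀ α β b, b ∈ x.lvl k α ↔ b ∈ x.lvl n β := by
    intro k hk α β b
    conv_lhs => rw [← h β]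
    rw [mem_d]
    simp [hk, hk.not_gt]
  apply ext_pair
  intro k γ b c
  simp only [mem_d, mem_cyl]
  rcases lt_or_ge k (n + 1) with hk | hk
  · simp [hk, hk.not_ge]
  · rw [e k (by omega) γ γ, e (k - 1) (by omega) γ γ, e (n + 1) (by omega) α γ,
      e (n + 1 - 1) (by omega) α γ]
    have h₁ : 0 < k := by omega
    simp only [hk, hk.not_gt, h₁]
    grind

theorem coneOver_congr {K : FaceSystem} {t t' H H' : K.Table} (ht : t = t') (hH : H = H')
    (h : Under t H) (h' : Under t' H') : coneOver t H h = coneOver t' H' h' := by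
  subst ht hH
  rfl

section

variable {N : ℕ}

theorem DimLe.proper {n : ℕ} {x : (cubeFaces N).Table} (hx : DimLe n x) : Proper x :=
  (hx .src).proper.2

theorem DimLe.succ {n : ℕ} {x : (cubeFaces N).Table} (hx : DimLe (n + 1) x) :
    DimLe (n + 2) x := fun α => by
  have h := (hx α).d α (n + 1)
  rw [d_d_ge _ _ _ (by omega)] at h
  exact h.symm.trans (hx α)

/-- When `m = n + 1` the boundary of the composite is that of one factor, and the other factor,
being degenerate, may be dropped from the composite. -/
theorem DimLe.comp {n m : ℕ} {x y z : (cubeFaces N).Table} (hx : DimLe m x) (hy : DimLe m y)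
    (h : IsComp (n + 1) x y z) : DimLe m z := fun α => by
  by_cases hm : m = n + 1
  · subst hm
    cases α
    · rw [h.d_src]
      exact (hx .src).trans (isComp_eqv_left h hx.proper hy).symm
    · rw [h.d_tgt]
      exact (hy .tgt).trans (isComp_eqv_right h hx hy.proper).symm
  · exact .comp (hx α) (hy α) (h.d α hm) h

theorem dimLe_cyl {n : ℕ} {x : (cubeFaces N).Table} (hx : IsCell _ x)
    (h : ∀ α, Table.d α n x = x) : DimLe (n + 1) (toCube (Table.cyl x)) :=
  .of_d_eq (.toCube_cyl hx) fun α => by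
    rw [toCube, ← rel_d, d_cyl_of_d_eq h]

/-- `t` and the cones on its iterated sources and targets are cells. -/
structure ConeCell (t H : (cubeFaces N).Table) (h : Under t H) : Prop where
  proper : Proper t
  cone : ∀ β j, IsCell _ (coneOver _ _ (h.d β j))

/-- The cone on `t` is the cone on a boundary of `t` of large dimension. It is proper because it has
the same level `0` as `t`. -/
theorem ConeCell.coneOver {t H : (cubeFaces N).Table} {h : Under t H} (hc : ConeCell t H h) :
    Proper (coneOver t H h) := by
  refine ⟨?_, fun e => hc.proper.ne ?_⟩
  · obtain ⟨n, hn⟩ := t.exists_d_eq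
    obtain ⟨m, hm⟩ := H.exists_d_eq
    have := hc.cone .src (n + m)
    rwa [coneOver_congr (hn _ (by omega) _) (hm _ (by omega) _)] at this
  · refine Set.ext fun b => ?_
    have := Set.ext_iff.1 e b
    simpa [mem_coneOver] using this

theorem ConeCell.d {t H : (cubeFaces N).Table} {h : Under t H} (hc : ConeCell t H h) (β : Dir)
    (j : ℕ) : ConeCell _ _ (h.d β j) := by
  refine ⟨hc.proper.d β j, fun γ m => ?_⟩
  rcases lt_or_ge (m + 1) (j + 1) with hm | hm
  · rw [coneOver_congr (d_d_lt _ _ _ hm) (d_d_lt _ _ _ hm) _ (h.d γ m)]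
    exact hc.cone γ m
  · rw [coneOver_congr (d_d_ge _ _ _ hm) (d_d_ge _ _ _ hm) _ (h.d β j)]
    exact hc.cone β j

/-- Both claims go up together. Passing to `j + 1` composes the partial cylinder with a partial cone
on a boundary, degenerate in dimension `j + 1`, so the class is unchanged. It composes the partial
cone with a partial cylinder on a `(j + 1)`-boundary, which is congruent to an honest cylinder of
dimension at most `j + 2`. -/
theorem ConeCell.partial_eqv (j : ℕ) {t H : (cubeFaces N).Table} {h : Under t H}
    (hc : ConeCell t H h) :
    NegEqv (toCube (partialCyl j t H h)) (toCube (Table.cyl t)) ∧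
      DimLe (j + 1) (toCube (partialCone j t H h)) := by
  induction j generalizing t H with
  | zero =>
    have hy := hc.coneOver
    rw [partialCyl_zero, partialCone_zero]
    refine ⟨.refl (.toCube_cyl hc.proper.isCell), ?_⟩
    -- The partial cone of index `0` is congruent to the edge over an initial vertex, which has
    -- dimension `1`.
    exact .of_eqv (.toCube_whisk_one' hy)
      (dimLe_cyl (hy.isCell.d _ _) fun α => d_d_ge _ _ _ le_rfl)
  | succ j ih =>
    have key : ∀ β, DimLe (j + 2) (toCube (partialCyl j _ _ (h.d β j))) := fun β =>
      .of_eqv (ih (hc.d β j)).1.symm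
        (dimLe_cyl (hc.proper.isCell.d _ _) fun α => d_d_ge _ _ _ le_rfl)
    have h₁ := (ih hc).1
    have h₂ := (ih hc).2
    rcases Nat.mod_two_eq_zero_or_one (j + 1) with hj | hj
    · exact ⟨(isComp_eqv_left (toCube_isComp (isComp_partialCyl_even h hj)) h₁.proper.1
        (ih (hc.d .tgt j)).2).trans h₁,
        .comp (key .src) h₂.succ (toCube_isComp (isComp_partialCone_even h hj))⟩
    · exact ⟨(isComp_eqv_right (toCube_isComp (isComp_partialCyl_odd h hj))
        (ih (hc.d .src j)).2 h₁.proper.1).trans h₁,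
        .comp h₂.succ (key .tgt) (toCube_isComp (isComp_partialCone_odd h hj))⟩

theorem ConeCell.glue_eqv {t H : (cubeFaces N).Table} {h : Under t H} (hc : ConeCell t H h) :
    NegEqv (toCube (glue t H h)) (toCube (Table.cyl t)) := by
  obtain ⟨n, hn⟩ := exists_partialCyl_eq h
  rw [← hn n le_rfl]
  exact (hc.partial_eqv n).1

end
end FaceSystem

/-! ### The simplex as a vertex figure of the cube. -/

/-- Here the two sign conventions meet: replacing a zero by - in a word without + removes an element
from its set of zeros, and the facet has the same direction in the cube and in the simplex. The
shift by one is due to positions being counted from `1` and ranks from `0`. -/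
theorem cubeSign_eq_neg_one_iff (α : Dir) (r : ℕ) : cubeSign α r = -1 ↔ RemovablePos α (r + 1) := by
  have h : (1 : SignType) ≠ -1 := by decide
  cases α
  · rcases Nat.even_or_odd (r + 1) with h' | h'
    · simp [cubeSign, RemovablePos, h'.neg_one_pow, h, Nat.not_odd_iff_even.2 h']
    · simp [cubeSign, RemovablePos, h'.neg_one_pow, h']
  · rcases Nat.even_or_odd (r + 1) with h' | h'
    · simp [cubeSign, RemovablePos, pow_succ _ (r + 1), h'.neg_one_pow, h']
    · simp [cubeSign, RemovablePos, pow_succ _ (r + 1), h'.neg_one_pow, h,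
        Nat.not_even_iff_odd.2 h']

theorem neg_one_eq_cubeSign_succ (α : Dir) (k : ℕ) :
    -1 = cubeSign α (k + 1) ↔ 1 = cubeSign α k := by
  have h : cubeSign α (k + 1) = -cubeSign α k := by cases α <;> simp [cubeSign, pow_succ]
  rw [h]
  generalize cubeSign α k = s
  revert s
  decide

/-- The word with the set of zeros `τ` and no letter `+`. -/
def starWord {N : ℕ} (τ : Finset (Fin N)) : Fin N → SignType := fun i => if i ∈ τ then 0 else -1

section starWord

variable {N : ℕ}

theorem starWord_eq_zero {τ : Finset (Fin N)} {i : Fin N} : starWord τ i = 0 ↔ i ∈ τ := by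
  simp [starWord]

theorem starWord_eq_neg_one {τ : Finset (Fin N)} {i : Fin N} : starWord τ i = -1 ↔ i ∉ τ := by
  unfold starWord
  split_ifs with h <;> simp [h]

theorem cubeZeros_starWord (τ : Finset (Fin N)) : cubeZeros (starWord τ) = τ := by
  ext i
  rw [mem_cubeZeros, starWord_eq_zero]

theorem cubeSub_starWord {τ σ : Finset (Fin N)} : cubeSub (starWord τ) (starWord σ) ↔ τ ⊆ σ := by
  constructor
  · intro h
    simpa only [cubeZeros_starWord] using cubeZeros_subset h
  · intro h i hi
    have hi' : i ∉ σ := fun h => hi (starWord_eq_zero.2 h)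
    rw [starWord_eq_neg_one.2 hi', starWord_eq_neg_one.2 fun h' => hi' (h h')]

/-- Passing to a larger face only turns letters into zeros, so no + can appear. The faces to be
tested in the cube are therefore those of the simplex. -/
theorem exists_starWord {τ : Finset (Fin N)} {b : Fin N → SignType}
    (h₁ : cubeSub (starWord τ) b) : ∃ ρ, b = starWord ρ := by
  refine ⟨cubeZeros b, funext fun i => ?_⟩
  by_cases hi : b i = 0
  · rw [hi, eq_comm, starWord_eq_zero, mem_cubeZeros, hi]
  · have e := h₁ i hi
    rw [starWord_eq_neg_one.2 fun h => hi (mem_cubeZeros.1 h), ← e, starWord_eq_neg_one]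
    exact fun h => hi (e.symm.trans (starWord_eq_zero.2 h))

theorem inFacet_starWord {α : Dir} {τ ρ : Finset (Fin N)} :
    InFacet α (starWord τ) (starWord ρ) ↔
      ∃ j ∈ ρ, RemovablePos α (rankIn ρ j + 1) ∧ j ∉ τ := by
  unfold InFacet
  rw [cubeZeros_starWord]
  refine exists_congr fun j => and_congr_right fun _ => ?_
  rw [← cubeSign_eq_neg_one_iff]
  constructor
  · intro h
    have hj : j ∉ τ := fun h' => cubeSign_ne_zero _ _ (h.symm.trans (starWord_eq_zero.2 h'))
    exact ⟨h.symm.trans (starWord_eq_neg_one.2 hj), hj⟩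
  · rintro ⟨h, hj⟩
    rw [h, starWord_eq_neg_one.2 hj]

end starWord

namespace FaceSystem
open Table

variable {N : ℕ}

/-- The face of the cube with the set of zeros `τ` and no letter `+`. -/
def star (τ : Finset (Fin N)) : (cubeFaces N).face := starWord τ

theorem star_empty : star (∅ : Finset (Fin N)) = botFace N :=
  funext fun i : Fin N => starWord_eq_neg_one.2 (Finset.notMem_empty i)

/-- A simplex as a vertex figure of a cube. -/
theorem mem_simplex_atom {σ τ : (simplexFaces N).face} {k : ℕ} {α : Dir} :
    τ ∈ ((simplexFaces N).atom σ).lvl k α ↔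
      star τ.1 ∈ ((cubeFaces (N + 1)).atom (star σ.1)).lvl (k + 1) α := by
  refine mem_atomLvl.trans (Iff.trans ?_ mem_cube_atom.symm)
  have hτ := τ.2.card_pos
  refine and_congr cubeSub_starWord.symm (and_congr ?_ ?_)
  · change τ.1.card - 1 ≤ k ↔ (cubeZeros (starWord τ.1)).card ≤ k + 1
    rw [cubeZeros_starWord]
    omega
  · have key : ∀ ρ : (simplexFaces N).face,
        (∃ e ∈ (simplexFaces N).bd α ρ, (simplexFaces N).sub τ e) ↔
          (τ.1 ⊆ ρ.1 → InFacet α (starWord τ.1) (starWord ρ.1)) ∧ τ.1 ⊆ ρ.1 := by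
      intro ρ
      rw [inFacet_starWord]
      constructor
      · rintro ⟨e, ⟨j, hj, h₁, h₂⟩, h₃⟩
        have h₃' : τ.1 ⊆ ρ.1.erase j := h₂ ▸ h₃
        exact ⟨fun _ => ⟨j, hj, h₁, fun h => Finset.notMem_erase j _ (h₃' h)⟩,
          h₃'.trans (Finset.erase_subset _ _)⟩
      · rintro ⟨h, h'⟩
        obtain ⟨j, hj, h₁, h₂⟩ := h h'
        have h₃ : τ.1 ⊆ ρ.1.erase j := Finset.subset_erase.2 ⟨h', h₂⟩
        exact ⟨⟨ρ.1.erase j, τ.2.mono h₃⟩, ⟨j, hj, h₁, rfl⟩, h₃⟩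
    constructor
    · intro h b hb hbn hab
      obtain ⟨ρ, rfl⟩ := exists_starWord hab
      rw [cubeZeros_starWord] at hbn
      have h₁ : τ.1 ⊆ ρ := cubeSub_starWord.1 hab
      refine ((key ⟨ρ, τ.2.mono h₁⟩).1 (h ⟨ρ, τ.2.mono h₁⟩ (cubeSub_starWord.1 hb) ?_ h₁)).1 h₁
      change ρ.card - 1 = k + 1
      omega
    · intro h ρ hρ hρn hτρ
      have h₁ := ρ.2.card_pos
      refine (key ρ).2 ⟨fun _ => h _ (cubeSub_starWord.2 hρ) ?_ (cubeSub_starWord.2 hτρ), hτρ⟩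
      rw [cubeZeros_starWord]
      change ρ.1.card - 1 = k + 1 at hρn
      omega

/-! ### The simplex as an iterated cone. -/

/-- A set of vertices, without the new last vertex. -/
def up (τ : Finset (Fin N)) : Finset (Fin (N + 1)) := τ.map Fin.castSuccEmb

/-- A set of vertices, with the new last vertex. -/
def upLast (τ : Finset (Fin N)) : Finset (Fin (N + 1)) := insert (Fin.last N) (up τ)

theorem castSucc_mem_up {τ : Finset (Fin N)} {i : Fin N} : i.castSucc ∈ up τ ↔ i ∈ τ := by
  simp [up]

theorem last_notMem_up (τ : Finset (Fin N)) : Fin.last N ∉ up τ := by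
  simp [up, Fin.castSucc_ne_last]

theorem castSucc_mem_upLast {τ : Finset (Fin N)} {i : Fin N} : i.castSucc ∈ upLast τ ↔ i ∈ τ := by
  simp [upLast, castSucc_mem_up, Fin.castSucc_ne_last]

theorem last_mem_upLast (τ : Finset (Fin N)) : Fin.last N ∈ upLast τ := Finset.mem_insert_self _ _

theorem star_up (τ : Finset (Fin N)) : star (up τ) = snoc (star τ) (-1) := by
  refine funext fun i => ?_
  induction i using Fin.lastCases with
  | last => rw [snoc_last]; exact starWord_eq_neg_one.2 (last_notMem_up τ)
  | cast i =>
    rw [snoc_castSucc]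
    change (if _ then _ else _) = if _ then _ else _
    simp only [castSucc_mem_up]

theorem star_upLast (τ : Finset (Fin N)) : star (upLast τ) = snoc (star τ) 0 := by
  refine funext fun i => ?_
  induction i using Fin.lastCases with
  | last => rw [snoc_last]; exact starWord_eq_zero.2 (last_mem_upLast τ)
  | cast i =>
    rw [snoc_castSucc]
    change (if _ then _ else _) = if _ then _ else _
    simp only [castSucc_mem_upLast]

theorem up_injective : Function.Injective (up (N := N)) := Finset.map_injective _

theorem upLast_injective : Function.Injective (upLast (N := N)) := fun τ σ h => by
  ext i
  rw [← castSucc_mem_upLast, h, castSucc_mem_upLast]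

theorem up_ne_upLast (τ σ : Finset (Fin N)) : up τ ≠ upLast σ := fun h =>
  last_notMem_up τ (h ▸ last_mem_upLast σ)

theorem exists_up (σ : Finset (Fin (N + 1))) : ∃ τ, σ = up τ ∨ σ = upLast τ := by
  refine ⟨Finset.univ.filter fun i : Fin N => i.castSucc ∈ σ, ?_⟩
  by_cases h : Fin.last N ∈ σ
  · right
    ext i
    induction i using Fin.lastCases with
    | last => simp [h, last_mem_upLast]
    | cast i => simp [castSucc_mem_upLast]
  · left
    ext i
    induction i using Fin.lastCases with
    | last => simp [h, last_notMem_up]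
    | cast i => simp [castSucc_mem_up]

theorem card_up (τ : Finset (Fin N)) : (up τ).card = τ.card := Finset.card_map _

theorem card_upLast (τ : Finset (Fin N)) : (upLast τ).card = τ.card + 1 := by
  rw [upLast, Finset.card_insert_of_notMem (last_notMem_up τ), card_up]

theorem up_nonempty {τ : Finset (Fin N)} : (up τ).Nonempty ↔ τ.Nonempty := Finset.map_nonempty

theorem corner_star_src (τ : Finset (Fin N)) : corner .src (star τ) = botFace N := by
  refine funext fun i : Fin N => ?_
  change (if starWord τ i = 0 then cubeSign .src 0 else starWord τ i) = -1
  rw [cubeSign_src_zero]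
  split_ifs with h
  · rfl
  · rw [starWord_eq_zero] at h
    exact starWord_eq_neg_one.2 h

theorem corner_star_tgt_ne {τ : Finset (Fin N)} (h : τ.Nonempty) :
    corner .tgt (star τ) ≠ botFace N := by
  obtain ⟨i, hi⟩ := h
  intro e
  have e' : (if starWord τ i = 0 then cubeSign .tgt 0 else starWord τ i) = -1 := congrFun e i
  rw [if_pos (starWord_eq_zero.2 hi), cubeSign_tgt_zero] at e'
  exact absurd e' (by decide)

theorem up_singleton (i : Fin N) : up {i} = {i.castSucc} := Finset.map_singleton _ _

theorem upLast_empty : upLast (∅ : Finset (Fin N)) = {Fin.last N} := rfl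

theorem mem_atom_snoc_of_ne {x b : (cubeFaces N).face} {c e : SignType} (hc : c ≠ 0) {k : ℕ}
    {α : Dir} : snoc b e ∈ ((cubeFaces (N + 1)).atom (snoc x c)).lvl k α ↔
      e = c ∧ b ∈ ((cubeFaces N).atom x).lvl k α := by
  rw [← endMap_atom hc, mem_endMap]

theorem bot_mem_atom_star (τ : Finset (Fin N)) :
    botFace N ∈ ((cubeFaces N).atom (star τ)).lvl 0 .src := by
  rw [atom_lvl_zero, corner_star_src]
  rfl

/-- Recursion on the last vertex. The end vertex of a simplex is its last vertex, except for targets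
of simplices with further vertices, where it is found in the base. The dimension shift makes this a
statement about level `0` of a simplex. -/
theorem exists_star_singleton : ∀ {N : ℕ} {τ : Finset (Fin N)}, τ.Nonempty → ∀ α : Dir,
    ∃ v, star {v} ∈ ((cubeFaces N).atom (star τ)).lvl 1 α
  | 0, _, ⟨i, _⟩, _ => i.elim0
  | N + 1, σ, hσ, α => by
    obtain ⟨τ, rfl | rfl⟩ := exists_up σ
    · obtain ⟨v, hv⟩ := exists_star_singleton (up_nonempty.1 hσ) α
      refine ⟨v.castSucc, ?_⟩
      rw [← up_singleton, star_up, star_up, mem_atom_snoc_of_ne (by decide)]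
      exact ⟨rfl, hv⟩
    · rw [star_upLast]
      by_cases h : α = .tgt ∧ τ.Nonempty
      · obtain ⟨rfl, hτ⟩ := h
        obtain ⟨v, hv⟩ := exists_star_singleton hτ .tgt
        refine ⟨v.castSucc, ?_⟩
        rw [← up_singleton, star_up, mem_atom_snoc_zero]
        exact .inl ⟨by decide, hv⟩
      · refine ⟨Fin.last N, ?_⟩
        rw [← upLast_empty, star_upLast, mem_atom_snoc_zero, star_empty]
        refine .inr ⟨Nat.one_pos, ?_⟩
        cases α
        · exact bot_mem_atom_star τ
        · obtain rfl : τ = ∅ := Finset.not_nonempty_iff_eq_empty.1 fun h' => h ⟨rfl, h'⟩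
          rw [atom_lvl_zero, star_empty]
          rfl

theorem simplex_atom_nonempty (σ : (simplexFaces N).face) (k : ℕ) (α : Dir) :
    (((simplexFaces N).atom σ).lvl k α).Nonempty := by
  obtain ⟨v, hv⟩ := exists_star_singleton σ.2 α
  have h : (⟨{v}, Finset.singleton_nonempty v⟩ : (simplexFaces N).face) ∈
      ((simplexFaces N).atom σ).lvl 0 α := mem_simplex_atom.2 hv
  rcases Nat.eq_zero_or_pos k with rfl | hk
  · exact ⟨_, h⟩
  · exact ⟨_, mono_le _ hk h⟩

/-- The identification of the cone on a simplex with a quotient of the cylinder. -/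
def ConeRel (w : (simplexFaces (N + 1)).face) (q : (simplexFaces N).prodSign.face) : Prop :=
  ∃ (τ : (simplexFaces N).face) (c : SignType), q = pair τ c ∧
    ((c = 1 ∧ w.1 = up τ.1) ∨ (c = 0 ∧ w.1 = upLast τ.1) ∨ (c = -1 ∧ w.1 = {Fin.last (N + 1)}))

/-- The image of a table on a cylinder in the cone. -/
def toSimplex (z : (simplexFaces N).prodSign.Table) : (simplexFaces (N + 1)).Table :=
  Table.rel ConeRel z

theorem mem_toSimplex {z : (simplexFaces N).prodSign.Table} {k : ℕ} {α : Dir}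
    {w : (simplexFaces (N + 1)).face} : w ∈ (toSimplex z).lvl k α ↔
      ∃ τ : (simplexFaces N).face, (pair τ 1 ∈ z.lvl k α ∧ w.1 = up τ.1) ∨
        (pair τ 0 ∈ z.lvl k α ∧ w.1 = upLast τ.1) ∨
        (pair τ (-1) ∈ z.lvl k α ∧ w.1 = {Fin.last (N + 1)}) := by
  refine mem_rel.trans ⟨?_, ?_⟩
  · rintro ⟨_, h, τ, c, rfl, ⟨rfl, h'⟩ | ⟨rfl, h'⟩ | ⟨rfl, h'⟩⟩
    exacts [⟨τ, .inl ⟨h, h'⟩⟩, ⟨τ, .inr (.inl ⟨h, h'⟩)⟩, ⟨τ, .inr (.inr ⟨h, h'⟩)⟩]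
  · rintro ⟨τ, ⟨h, h'⟩ | ⟨h, h'⟩ | ⟨h, h'⟩⟩
    exacts [⟨_, h, τ, 1, rfl, .inl ⟨rfl, h'⟩⟩, ⟨_, h, τ, 0, rfl, .inr (.inl ⟨rfl, h'⟩)⟩,
      ⟨_, h, τ, -1, rfl, .inr (.inr ⟨rfl, h'⟩)⟩]

theorem up_mem_toSimplex {z : (simplexFaces N).prodSign.Table} {k : ℕ} {α : Dir}
    {w : (simplexFaces (N + 1)).face} {τ : (simplexFaces N).face} (hw : w.1 = up τ.1) :
    w ∈ (toSimplex z).lvl k α ↔ pair τ 1 ∈ z.lvl k α := by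
  rw [mem_toSimplex]
  constructor
  · rintro ⟨ρ, ⟨h, h'⟩ | ⟨h, h'⟩ | ⟨h, h'⟩⟩
    · obtain rfl : τ = ρ := Subtype.ext (up_injective (hw.symm.trans h'))
      exact h
    · exact absurd (hw.symm.trans h') (up_ne_upLast _ _)
    · rw [← upLast_empty] at h'
      exact absurd (hw.symm.trans h') (up_ne_upLast _ _)
  · exact fun h => ⟨τ, .inl ⟨h, hw⟩⟩

theorem upLast_mem_toSimplex {z : (simplexFaces N).prodSign.Table} {k : ℕ} {α : Dir}
    {w : (simplexFaces (N + 1)).face} {τ : (simplexFaces N).face} (hw : w.1 = upLast τ.1) :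
    w ∈ (toSimplex z).lvl k α ↔ pair τ 0 ∈ z.lvl k α := by
  rw [mem_toSimplex]
  constructor
  · rintro ⟨ρ, ⟨h, h'⟩ | ⟨h, h'⟩ | ⟨h, h'⟩⟩
    · exact absurd (h'.symm.trans hw) (up_ne_upLast _ _)
    · obtain rfl : τ = ρ := Subtype.ext (upLast_injective (hw.symm.trans h'))
      exact h
    · rw [← upLast_empty] at h'
      exact absurd (upLast_injective (hw.symm.trans h')) τ.2.ne_empty
  · exact fun h => ⟨τ, .inr (.inl ⟨h, hw⟩)⟩

theorem last_mem_toSimplex {z : (simplexFaces N).prodSign.Table} {k : ℕ} {α : Dir}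
    {w : (simplexFaces (N + 1)).face} (hw : w.1 = {Fin.last (N + 1)}) :
    w ∈ (toSimplex z).lvl k α ↔ ∃ τ : (simplexFaces N).face, pair τ (-1) ∈ z.lvl k α := by
  rw [mem_toSimplex]
  constructor
  · rintro ⟨ρ, ⟨h, h'⟩ | ⟨h, h'⟩ | ⟨h, h'⟩⟩
    · rw [← upLast_empty] at hw
      exact absurd (h'.symm.trans hw) (up_ne_upLast _ _)
    · rw [← upLast_empty] at hw
      exact absurd (upLast_injective (h'.symm.trans hw)) ρ.2.ne_empty
    · exact ⟨ρ, h⟩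
  · exact fun ⟨τ, h⟩ => ⟨τ, .inr (.inr ⟨h, hw⟩)⟩

theorem exists_up_face (w : (simplexFaces (N + 1)).face) :
    (∃ τ : (simplexFaces N).face, w.1 = up τ.1) ∨
      (∃ τ : (simplexFaces N).face, w.1 = upLast τ.1) ∨ w.1 = {Fin.last (N + 1)} := by
  obtain ⟨τ, h | h⟩ := exists_up w.1
  · exact .inl ⟨⟨τ, up_nonempty.1 (h ▸ w.2)⟩, h⟩
  · rcases τ.eq_empty_or_nonempty with rfl | hτ
    · exact .inr (.inr h)
    · exact .inr (.inl ⟨⟨τ, hτ⟩, h⟩)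

theorem star_notMem_lvl_zero {τ : Finset (Fin N)} (h : τ.Nonempty) (x : (cubeFaces N).face)
    (α : Dir) : star τ ∉ ((cubeFaces N).atom x).lvl 0 α := by
  intro h'
  have h₁ : (cubeZeros (starWord τ)).card ≤ 0 := (mem_cube_atom.1 h').2.1
  rw [cubeZeros_starWord] at h₁
  exact absurd h.card_pos (by omega)

/-- The cone on an atom. -/
theorem toSimplex_cyl_atom {σ : (simplexFaces N).face} {σ' : (simplexFaces (N + 1)).face}
    (hσ : σ'.1 = upLast σ.1) :
    toSimplex (Table.cyl ((simplexFaces N).atom σ)) = (simplexFaces (N + 1)).atom σ' := by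
  apply ext_mem
  intro k α w
  rw [mem_simplex_atom, hσ, star_upLast]
  rcases exists_up_face w with ⟨τ, h⟩ | ⟨τ, h⟩ | h
  · rw [up_mem_toSimplex h, h, star_up, mem_atom_snoc_zero, mem_cyl, mem_simplex_atom,
      mem_simplex_atom, neg_one_eq_cubeSign_succ]
    refine or_congr Iff.rfl ?_
    rcases Nat.eq_zero_or_pos k with rfl | hk
    · simp [star_notMem_lvl_zero τ.2]
    · rw [Nat.sub_add_cancel hk]
      simp [hk]
  · rw [upLast_mem_toSimplex h, h, star_upLast, mem_atom_snoc_zero, mem_cyl, mem_simplex_atom,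
      mem_simplex_atom]
    have h₀ : ∀ k, ¬ (0 : SignType) = cubeSign α k := fun k h => cubeSign_ne_zero _ _ h.symm
    rcases Nat.eq_zero_or_pos k with rfl | hk
    · simp [star_notMem_lvl_zero τ.2, h₀]
    · rw [Nat.sub_add_cancel hk]
      simp [hk, h₀]
  -- The new vertex comes from the collapsed end -. It is present in every level except the
  -- `0`-target, where the end has sign +.
  · rw [last_mem_toSimplex h, h, ← upLast_empty, star_upLast, star_empty, mem_atom_snoc_zero]
    have h₀ : ∀ k, ¬ (0 : SignType) = cubeSign α k := fun k h => cubeSign_ne_zero _ _ h.symm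
    rcases Nat.eq_zero_or_pos k with rfl | hk
    · cases α
      · obtain ⟨τ, hτ⟩ := simplex_atom_nonempty σ 0 .src
        exact ⟨fun _ => .inr ⟨Nat.one_pos, bot_mem_atom_star _⟩,
          fun _ => ⟨τ, mem_cyl.2 (.inl ⟨cubeSign_src_zero.symm, hτ⟩)⟩⟩
      · constructor
        · rintro ⟨τ, hτ⟩
          rw [mem_cyl, cubeSign_tgt_zero] at hτ
          simp at hτ
        · rintro (⟨h, -⟩ | ⟨-, h⟩)
          · exact absurd h (h₀ _)
          · have h' := (atom_lvl_zero (star σ.1) .tgt).subset h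
            exact absurd h'.symm (corner_star_tgt_ne σ.2)
    · obtain ⟨τ, hτ⟩ := simplex_atom_nonempty σ (k - 1) α
      exact ⟨fun _ => .inr ⟨by omega, mono_le _ hk (bot_mem_atom_star _)⟩,
        fun _ => ⟨τ, mem_cyl.2 (.inr ⟨hk, hτ⟩)⟩⟩

theorem up_mem_simplex_atom {σ : (simplexFaces N).face} {σ' : (simplexFaces (N + 1)).face}
    (hσ : σ'.1 = up σ.1) {w : (simplexFaces (N + 1)).face} {k : ℕ} {α : Dir} :
    w ∈ ((simplexFaces (N + 1)).atom σ').lvl k α ↔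
      ∃ τ ∈ ((simplexFaces N).atom σ).lvl k α, w.1 = up τ.1 := by
  rw [mem_simplex_atom, hσ, star_up]
  constructor
  · intro h
    rcases exists_up w.1 with ⟨τ, h' | h'⟩
    · rw [h', star_up, mem_atom_snoc_of_ne (by decide)] at h
      have hτ : τ.Nonempty := up_nonempty.1 (h' ▸ w.2)
      exact ⟨⟨τ, hτ⟩, mem_simplex_atom.2 h.2, h'⟩
    · rw [h', star_upLast, mem_atom_snoc_of_ne (by decide)] at h
      exact absurd h.1 (by decide)
  · rintro ⟨τ, hτ, h⟩
    rw [h, star_up, mem_atom_snoc_of_ne (by decide)]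
    exact ⟨rfl, mem_simplex_atom.1 hτ⟩

theorem mem_atom_last {σ w : (simplexFaces N).face} {i : Fin (N + 1)} (hσ : σ.1 = {i}) {k : ℕ}
    {α : Dir} : w ∈ ((simplexFaces N).atom σ).lvl k α ↔ w.1 = {i} := by
  rw [mem_atom, atomLvl_of_dim_le]
  · change w.1 ⊆ σ.1 ↔ _
    rw [hσ, w.2.subset_singleton_iff]
  · change σ.1.card - 1 ≤ k
    rw [hσ, Finset.card_singleton]
    omega

/-- The embedding of the simplex as the base of the cone. -/
def upMap (x : (simplexFaces N).Table) : (simplexFaces (N + 1)).Table :=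
  Table.rel (fun (w : (simplexFaces (N + 1)).face) (τ : (simplexFaces N).face) => w.1 = up τ.1) x

theorem upMap_atom {σ : (simplexFaces N).face} {σ' : (simplexFaces (N + 1)).face}
    (hσ : σ'.1 = up σ.1) : upMap ((simplexFaces N).atom σ) = (simplexFaces (N + 1)).atom σ' := by
  apply ext_mem
  intro k α w
  rw [up_mem_simplex_atom hσ]
  exact mem_rel

theorem toSimplex_whisk_tgt (x : (simplexFaces N).Table) :
    toSimplex (Table.whisk .tgt 0 x) = upMap x := by
  apply ext_mem
  intro k α w
  rw [mem_toSimplex]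
  simp only [mem_whisk, cubeSign_tgt_zero]
  refine (exists_congr fun τ => ?_).trans mem_rel.symm
  have h : (-1 : SignType) ≠ 1 := by decide
  simp [h]

theorem toSimplex_whisk_src_atom (σ : (simplexFaces N).face) {σ' : (simplexFaces (N + 1)).face}
    (hσ : σ'.1 = {Fin.last (N + 1)}) :
    toSimplex (Table.whisk .src 0 ((simplexFaces N).atom σ)) = (simplexFaces (N + 1)).atom σ' := by
  apply ext_mem
  intro k α w
  rw [mem_atom_last hσ, mem_toSimplex]
  simp only [mem_whisk, cubeSign_src_zero]
  have h : (1 : SignType) ≠ -1 := by decide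
  obtain ⟨τ, hτ⟩ := simplex_atom_nonempty σ k α
  constructor
  · rintro ⟨ρ, h'⟩
    simp [h] at h'
    exact h'.2
  · intro hw
    exact ⟨τ, .inr (.inr ⟨by simp [hτ], hw⟩)⟩

theorem dim_of_up {σ : (simplexFaces N).face} {σ' : (simplexFaces (N + 1)).face}
    (h : σ'.1 = up σ.1) : (simplexFaces (N + 1)).dim σ' = (simplexFaces N).dim σ := by
  change σ'.1.card - 1 = σ.1.card - 1
  rw [h, card_up]

theorem dim_of_upLast {σ : (simplexFaces N).face} {σ' : (simplexFaces (N + 1)).face}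
    (h : σ'.1 = upLast σ.1) : (simplexFaces (N + 1)).dim σ' = (simplexFaces N).dim σ + 1 := by
  have := σ.2.card_pos
  change σ'.1.card - 1 = σ.1.card - 1 + 1
  rw [h, card_upLast]
  omega

/-- The last vertex of a simplex. -/
def lastFace (N : ℕ) : (simplexFaces N).face := ⟨{Fin.last N}, Finset.singleton_nonempty _⟩

/-- The end + goes to the base of the cone and the end - to its apex. This is why `CylMap` only
bounds the dimension in the case of ends. -/
theorem cylMap_simplex (N : ℕ) : CylMap (simplexFaces N) (simplexFaces (N + 1)) ConeRel where
  cyl σ := ⟨⟨upLast σ.1, _, last_mem_upLast _⟩, toSimplex_cyl_atom rfl, dim_of_upLast rfl⟩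
  whisk α σ := by
    cases α
    · refine ⟨lastFace (N + 1), toSimplex_whisk_src_atom σ rfl, ?_⟩
      change ({Fin.last (N + 1)} : Finset _).card - 1 ≤ _
      simp
    · exact ⟨⟨up σ.1, up_nonempty.2 σ.2⟩, (toSimplex_whisk_tgt _).trans (upMap_atom rfl),
        (dim_of_up rfl).le⟩

theorem CGen.upMap {d : ℕ} {x : (simplexFaces N).Table} (hx : CGen (simplexFaces N) d x) :
    CGen (simplexFaces (N + 1)) d (upMap x) := by
  induction hx with
  | atom a ha =>
    rw [upMap_atom (σ' := ⟨up a.1, up_nonempty.2 a.2⟩) rfl]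
    exact .atom _ ((dim_of_up rfl).trans_le ha)
  | comp _ _ hz ihx ihy => exact .comp ihx ihy (hz.rel _)

/-- A face of the cone is a face of the base, a cone on such a face, or the apex. -/
theorem closed_simplex : ∀ N, Closed (simplexFaces N)
  | 0 => fun a j α hj => by
    have h := Finset.card_le_univ a.1
    rw [Fintype.card_fin] at h
    change j < a.1.card - 1 at hj
    omega
  | N + 1 => fun w j α hj => by
    have hN := closed_simplex N
    rcases exists_up_face w with ⟨σ, h⟩ | ⟨σ, h⟩ | h
    · rw [dim_of_up h] at hj
      rw [← upMap_atom h, FaceSystem.upMap, ← rel_d]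
      exact (hN σ j α hj).upMap
    · rw [dim_of_upLast h] at hj
      rw [← toSimplex_cyl_atom h]
      exact (cylMap_simplex N).cGen_d_cyl_atom hN σ (Nat.lt_succ_iff.1 hj) α
    · change j < w.1.card - 1 at hj
      rw [h, Finset.card_singleton] at hj
      omega

theorem IsCell.upMap {x : (simplexFaces N).Table} (hx : IsCell (simplexFaces N) x) :
    IsCell (simplexFaces (N + 1)) (upMap x) := by
  obtain ⟨d, hd⟩ := hx.exists_cGen (closed_simplex N)
  exact hd.upMap.isCell

theorem IsCell.toSimplex_cyl {x : (simplexFaces N).Table} (hx : IsCell (simplexFaces N) x) :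
    IsCell (simplexFaces (N + 1)) (toSimplex (Table.cyl x)) :=
  (cylMap_simplex N).isCell_cyl (closed_simplex N) hx

end FaceSystem

/-! ### The section from a simplex to the paths in a cube. -/

namespace FaceSystem
open Table

namespace Table

variable {K : FaceSystem}

/-- The suspension of a table, with the given `0`-source and `0`-target. -/
def susp (S : Dir → Set K.face) (y : K.Table) : K.Table where
  lvl m α := match m with
    | 0 => S α
    | m + 1 => {b | (∃ β, b ∈ S β) ∨ b ∈ y.lvl m α}
  mono m α β b hb := by
    cases m with
    | zero => exact .inl ⟨α, hb⟩
    | succ m => exact hb.imp_right fun h => y.mono m α β h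
  stable := by
    obtain ⟨N, hN⟩ := y.stable
    refine ⟨N + 1, fun n hn α => ?_⟩
    obtain ⟨k, rfl⟩ : ∃ k, n = k + 1 := ⟨n - 1, by omega⟩
    simp only [hN k (by omega) α]

theorem mem_susp_succ {S : Dir → Set K.face} {y : K.Table} {m : ℕ} {α : Dir} {b : K.face} :
    b ∈ (susp S y).lvl (m + 1) α ↔ (∃ β, b ∈ S β) ∨ b ∈ y.lvl m α := Iff.rfl

theorem susp_lvl_zero (S : Dir → Set K.face) (y : K.Table) (α : Dir) :
    (susp S y).lvl 0 α = S α := rfl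

theorem susp_d (S : Dir → Set K.face) (y : K.Table) (α : Dir) (n : ℕ) :
    susp S (Table.d α n y) = Table.d α (n + 1) (susp S y) := by
  apply ext_mem
  intro k β b
  cases k with
  | zero => simp [mem_d, susp_lvl_zero]
  | succ k =>
    simp only [mem_d, mem_susp_succ, Nat.add_lt_add_iff_right, Nat.add_le_add_iff_right]
    rcases lt_or_ge k n with h | h
    · simp [h, h.not_ge]
    · simp [h, h.not_gt]

theorem IsComp.susp {n : ℕ} {x y z : K.Table} (h : IsComp n x y z) (S : Dir → Set K.face) :
    IsComp (n + 1) (susp S x) (susp S y) (susp S z) := by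
  rw [isComp_iff] at h ⊢
  obtain ⟨h₁, h₂, h₃, h₄, h₅⟩ := h
  refine ⟨fun k hk α b => ?_, fun b => or_congr_right (h₂ b), fun b => or_congr_right (h₃ b),
    fun b => or_congr_right (h₄ b), fun k hk α b => ?_⟩
  · cases k with
    | zero => exact ⟨Iff.rfl, Iff.rfl⟩
    | succ k =>
      have := h₁ k (by omega) α b
      exact ⟨or_congr_right this.1, or_congr_right this.2⟩
  · obtain ⟨k, rfl⟩ : ∃ j, k = j + 1 := ⟨k - 1, by omega⟩
    simp only [mem_susp_succ, h₅ k (by omega)]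
    tauto

end Table

section

variable {N : ℕ}

theorem snoc_botFace : snoc (botFace N) (-1) = botFace (N + 1) := by
  refine funext fun i => ?_
  induction i using Fin.lastCases with
  | last => rw [snoc_last]; rfl
  | cast i => rw [snoc_castSucc]; rfl

theorem snoc_topFace : snoc (topFace N) 1 = topFace (N + 1) := by
  refine funext fun i => ?_
  induction i using Fin.lastCases with
  | last => rw [snoc_last]; rfl
  | cast i => rw [snoc_castSucc]; rfl

/-- A set of vertices, with the last vertex if there is one. -/
def addLast : ∀ {N : ℕ}, Finset (Fin N) → Finset (Fin N)
  | 0, τ => τ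
  | _ + 1, τ => insert (Fin.last _) τ

theorem addLast_up (τ : Finset (Fin N)) : addLast (up τ) = upLast τ := rfl

theorem addLast_upLast (τ : Finset (Fin N)) : addLast (upLast τ) = upLast τ :=
  Finset.insert_eq_of_mem (last_mem_upLast τ)

theorem addLast_empty : addLast (∅ : Finset (Fin (N + 1))) = {Fin.last N} := rfl

theorem addLast_nonempty (τ : Finset (Fin (N + 1))) : (addLast τ).Nonempty :=
  ⟨_, Finset.mem_insert_self _ _⟩

/-- The faces of a sum of paths from the initial vertex to the final vertex, which starts with the
star face `τ`. -/
def OnPath : ∀ {N : ℕ}, Finset (Fin N) → (cubeFaces N).face → Prop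
  | 0, _, _ => True
  | N + 1, σ, w => ∃ (τ : Finset (Fin N)) (b : (cubeFaces N).face) (c : SignType), w = snoc b c ∧
      ((σ = upLast τ ∧ (OnPath τ b ∨ (c = 1 ∧ OnPath (addLast τ) b))) ∨
        (σ = up τ ∧ ((τ = ∅ ∧ c = -1 ∧ b = botFace N) ∨
          (τ.Nonempty ∧ ((c = -1 ∧ OnPath τ b) ∨ b = topFace N)))))

/-- Geometrically: the cylinder on the path of `τ`, together with a cone in the end +, which is the
path of `addLast τ`. -/
theorem onPath_upLast {τ : Finset (Fin N)} {b : (cubeFaces N).face} {c : SignType} :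
    OnPath (upLast τ) (snoc b c) ↔ OnPath τ b ∨ (c = 1 ∧ OnPath (addLast τ) b) := by
  constructor
  · rintro ⟨ρ, b', c', h, ⟨hρ, h'⟩ | ⟨hρ, -⟩⟩
    · obtain ⟨rfl, rfl⟩ := snoc_inj.1 h
      rwa [upLast_injective hρ]
    · exact absurd hρ.symm (up_ne_upLast _ _)
  · exact fun h => ⟨τ, b, c, rfl, .inl ⟨rfl, h⟩⟩

/-- Geometrically: the path of `τ` in the end -, followed by the edge from its final vertex to the
top of the cube. -/
theorem onPath_up {τ : Finset (Fin N)} (hτ : τ.Nonempty) {b : (cubeFaces N).face} {c : SignType} :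
    OnPath (up τ) (snoc b c) ↔ (c = -1 ∧ OnPath τ b) ∨ b = topFace N := by
  constructor
  · rintro ⟨ρ, b', c', h, ⟨hρ, -⟩ | ⟨hρ, h'⟩⟩
    · exact absurd hρ (up_ne_upLast _ _)
    · obtain ⟨rfl, rfl⟩ := snoc_inj.1 h
      obtain rfl := up_injective hρ
      exact (h'.resolve_left fun h => hτ.ne_empty h.1).2
  · exact fun h => ⟨τ, b, c, rfl, .inr ⟨rfl, .inr ⟨hτ, h⟩⟩⟩

theorem onPath_empty : ∀ {N : ℕ} {b : (cubeFaces N).face}, OnPath ∅ b ↔ b = botFace N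
  | 0, b => ⟨fun _ => funext fun i : Fin 0 => i.elim0, fun _ => trivial⟩
  | N + 1, w => by
    obtain ⟨b, c, rfl⟩ := exists_snoc w
    rw [← snoc_botFace, snoc_inj]
    constructor
    · rintro ⟨ρ, b', c', h, ⟨hρ, -⟩ | ⟨hρ, h'⟩⟩
      · exact absurd hρ (up_ne_upLast ∅ ρ)
      · obtain ⟨rfl, rfl⟩ := snoc_inj.1 h
        obtain rfl : ∅ = ρ := up_injective hρ
        rcases h' with h' | h'
        · exact ⟨h'.2.2, h'.2.1⟩
        · exact absurd rfl h'.1.ne_empty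
    · rintro ⟨rfl, rfl⟩
      exact ⟨∅, _, _, rfl, .inr ⟨rfl, .inl ⟨rfl, rfl, rfl⟩⟩⟩

theorem onPath_bot : ∀ {N : ℕ} (τ : Finset (Fin N)), OnPath τ (botFace N)
  | 0, _ => trivial
  | N + 1, σ => by
    obtain ⟨τ, rfl | rfl⟩ := exists_up σ
    · rcases τ.eq_empty_or_nonempty with rfl | hτ
      · exact onPath_empty.2 rfl
      · rw [← snoc_botFace, onPath_up hτ]
        exact .inl ⟨rfl, onPath_bot τ⟩
    · rw [← snoc_botFace, onPath_upLast]
      exact .inl (onPath_bot τ)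

theorem onPath_top {τ : Finset (Fin N)} (hτ : τ.Nonempty) : OnPath τ (topFace N) := by
  induction N with
  | zero => trivial
  | succ N ih =>
    obtain ⟨τ, rfl | rfl⟩ := exists_up τ
    · rw [← snoc_topFace, onPath_up (up_nonempty.1 hτ)]
      exact .inr rfl
    · rw [← snoc_topFace, onPath_upLast]
      rcases N with _ | N
      · exact .inl trivial
      · exact .inr ⟨rfl, ih (addLast_nonempty τ)⟩

/-- The cylinder contains the end - and the edge over the top vertex, which make up the path without
the last vertex. -/
theorem OnPath.addLast : ∀ {N : ℕ} {τ : Finset (Fin N)} {b : (cubeFaces N).face},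
    OnPath τ b → OnPath (addLast τ) b
  | 0, _, _, _ => trivial
  | N + 1, σ, w, h => by
    obtain ⟨τ, rfl | rfl⟩ := exists_up σ
    · rw [addLast_up]
      rcases τ.eq_empty_or_nonempty with rfl | hτ
      · obtain rfl := onPath_empty.1 h
        exact onPath_bot _
      · obtain ⟨b, c, rfl⟩ := exists_snoc w
        rw [onPath_up hτ] at h
        rw [onPath_upLast]
        rcases h with h | rfl
        · exact .inl h.2
        · exact .inl (onPath_top hτ)
    · rwa [addLast_upLast]

/-- Both paths have a cone in their end +, and recursion compares these cones; the rest of the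
smaller path is an edge at the bottom vertex. -/
theorem onPath_addLast_of_empty : ∀ {N : ℕ} {τ : Finset (Fin N)} {b : (cubeFaces N).face},
    OnPath (addLast ∅) b → OnPath (addLast τ) b
  | 0, _, _, _ => trivial
  | N + 1, σ, w, h => by
    obtain ⟨b, c, rfl⟩ := exists_snoc w
    obtain ⟨τ, e⟩ : ∃ τ, FaceSystem.addLast σ = upLast τ := by
      obtain ⟨τ, rfl | rfl⟩ := exists_up σ
      exacts [⟨τ, addLast_up τ⟩, ⟨τ, addLast_upLast τ⟩]
    rw [addLast_empty, ← upLast_empty, onPath_upLast, onPath_empty] at h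
    rw [e, onPath_upLast]
    rcases h with rfl | h
    · exact .inl (onPath_bot τ)
    · exact .inr ⟨h.1, onPath_addLast_of_empty h.2⟩

/-- The initial vertex and the final vertex of a cube. -/
def endFace (N : ℕ) : Dir → (cubeFaces N).face
  | .src => botFace N
  | .tgt => topFace N

/-- The section of the projection of the paths in a cube onto the simplex at the initial vertex. -/
def sect (x : (simplexFaces N).Table) : (cubeFaces (N + 1)).Table :=
  susp (fun α => {endFace (N + 1) α})
    (Table.rel (fun (b : (cubeFaces (N + 1)).face) (τ : (simplexFaces N).face) => OnPath τ.1 b) x)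

theorem sect_lvl_zero (x : (simplexFaces N).Table) (α : Dir) :
    (sect x).lvl 0 α = {endFace (N + 1) α} := rfl

/-- The end vertices added by `susp` already lie on every path of a nonempty simplex, so they are
invisible once the level is nonempty. -/
theorem mem_sect {x : (simplexFaces N).Table} {m : ℕ} {α : Dir} (hx : (x.lvl m α).Nonempty)
    {b : (cubeFaces (N + 1)).face} :
    b ∈ (sect x).lvl (m + 1) α ↔ ∃ τ ∈ x.lvl m α, OnPath τ.1 b := by
  refine mem_susp_succ.trans ⟨?_, .inr⟩
  obtain ⟨τ, hτ⟩ := hx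
  rintro (⟨_ | _, rfl⟩ | h)
  · exact ⟨τ, hτ, onPath_bot _⟩
  · exact ⟨τ, hτ, onPath_top τ.2⟩
  · exact h

theorem sect_d (x : (simplexFaces N).Table) (α : Dir) (n : ℕ) :
    sect (Table.d α n x) = Table.d α (n + 1) (sect x) := by
  unfold sect
  rw [rel_d, susp_d]

theorem IsComp.sect {n : ℕ} {x y z : (simplexFaces N).Table} (h : IsComp n x y z) :
    IsComp (n + 1) (sect x) (sect y) (sect z) := (h.rel _).susp _

/-- The faces of the cone on the end of the cylinder on `sect x`. -/
def coneEnd (x : (simplexFaces N).Table) : (cubeFaces (N + 1)).Table :=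
  susp (fun α => match α with
      | .src => {b | OnPath {Fin.last N} b}
      | .tgt => {topFace (N + 1)})
    (Table.rel (fun (b : (cubeFaces (N + 1)).face) (τ : (simplexFaces N).face) =>
      OnPath (addLast τ.1) b) x)

theorem mem_coneEnd_src {x : (simplexFaces N).Table} {b : (cubeFaces (N + 1)).face} :
    b ∈ (coneEnd x).lvl 0 .src ↔ OnPath {Fin.last N} b := Iff.rfl

theorem mem_coneEnd_tgt {x : (simplexFaces N).Table} {b : (cubeFaces (N + 1)).face} :
    b ∈ (coneEnd x).lvl 0 .tgt ↔ b = topFace (N + 1) := Iff.rfl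

theorem mem_coneEnd {x : (simplexFaces N).Table} {m : ℕ} {α : Dir} (hx : (x.lvl m α).Nonempty)
    {b : (cubeFaces (N + 1)).face} :
    b ∈ (coneEnd x).lvl (m + 1) α ↔ ∃ τ ∈ x.lvl m α, OnPath (addLast τ.1) b := by
  refine mem_susp_succ.trans ⟨?_, .inr⟩
  obtain ⟨τ, hτ⟩ := hx
  rintro (⟨_ | _, h⟩ | h)
  · exact ⟨τ, hτ, onPath_addLast_of_empty h⟩
  · exact ⟨τ, hτ, h ▸ onPath_top (addLast_nonempty _)⟩
  · exact h

theorem coneEnd_d (x : (simplexFaces N).Table) (α : Dir) (n : ℕ) :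
    coneEnd (Table.d α n x) = Table.d α (n + 1) (coneEnd x) := by
  unfold coneEnd
  rw [rel_d, susp_d]

/-- Adding the last vertex enlarges a path, and the path of the last vertex alone contains both the
bottom and the top vertex. -/
theorem under_sect {x : (simplexFaces N).Table} (hx : ∀ m α, (x.lvl m α).Nonempty) :
    Under (sect x) (coneEnd x) where
  le m α b := by
    cases m with
    | zero =>
      cases α
      · rintro rfl
        exact onPath_bot _
      · exact id
    | succ m =>
      rw [mem_sect (hx m α), mem_coneEnd (hx m α)]
      rintro ⟨τ, hτ, h⟩
      exact ⟨τ, hτ, h.addLast⟩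
  tgt_le b := by
    rintro rfl
    exact onPath_top (Finset.singleton_nonempty _)
  le_tgt b := id

theorem snoc_eq_endFace {b : (cubeFaces N).face} {c : SignType} {α : Dir} :
    snoc b c = endFace (N + 1) α ↔ c = cubeSign α 0 ∧ b = endFace N α := by
  cases α
  · rw [endFace, ← snoc_botFace, snoc_inj, cubeSign_src_zero, and_comm]
    rfl
  · rw [endFace, ← snoc_topFace, snoc_inj, cubeSign_tgt_zero, and_comm]
    rfl

theorem cubeSign_cases (α : Dir) (k : ℕ) :
    (cubeSign α k = 1 ∧ cubeSign α (k + 1) = -1 ∧ cubeSign α (k + 2) = 1 ∧ α ≠ posDir (k + 1) ∧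
      α = posDir k) ∨
      (cubeSign α k = -1 ∧ cubeSign α (k + 1) = 1 ∧ cubeSign α (k + 2) = -1 ∧
        α = posDir (k + 1) ∧ α ≠ posDir k) := by
  have h₁ := posDir_cases k
  have h₂ := posDir_cases (k + 1)
  have h₃ : cubeSign α (k + 2) = cubeSign α k := by cases α <;> simp [cubeSign, pow_succ]
  rw [h₃]
  have h : (1 : SignType) ≠ -1 := by decide
  cases α <;> grind

theorem toSimplex_cyl_nonempty {x : (simplexFaces N).Table} (hx : ∀ m α, (x.lvl m α).Nonempty)
    (k : ℕ) (α : Dir) : ((toSimplex (Table.cyl x)).lvl k α).Nonempty := by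
  obtain ⟨τ, hτ⟩ := hx k α
  rcases cubeSign_cases α k with h | h
  · exact ⟨⟨up τ.1, up_nonempty.2 τ.2⟩, (up_mem_toSimplex rfl).2
      (mem_cyl.2 (.inl ⟨h.1.symm, hτ⟩))⟩
  · exact ⟨lastFace (N + 1), (last_mem_toSimplex rfl).2 ⟨τ, mem_cyl.2 (.inl ⟨h.1.symm, hτ⟩)⟩⟩

theorem mem_sect_toSimplex {x : (simplexFaces N).Table} (hx : ∀ m α, (x.lvl m α).Nonempty)
    {k : ℕ} {α : Dir} {b : (cubeFaces (N + 2)).face} :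
    b ∈ (sect (toSimplex (Table.cyl x))).lvl (k + 1) α ↔ ∃ τ : (simplexFaces N).face,
      (((cubeSign α k = 1 ∧ τ ∈ x.lvl k α) ∨ (0 < k ∧ τ ∈ x.lvl (k - 1) α)) ∧
          OnPath (up τ.1) b) ∨
        ((0 < k ∧ τ ∈ x.lvl (k - 1) α) ∧ OnPath (upLast τ.1) b) ∨
        (((cubeSign α k = -1 ∧ τ ∈ x.lvl k α) ∨ (0 < k ∧ τ ∈ x.lvl (k - 1) α)) ∧
          OnPath {Fin.last (N + 1)} b) := by
  have h₀ : ¬ (0 : SignType) = cubeSign α k := fun h => cubeSign_ne_zero _ _ h.symm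
  rw [mem_sect (toSimplex_cyl_nonempty hx k α)]
  simp only [mem_toSimplex, mem_cyl, h₀, false_and, false_or, eq_comm (b := cubeSign α k)]
  constructor
  · rintro ⟨w, ⟨τ, ⟨h, e⟩ | ⟨h, e⟩ | ⟨h, e⟩⟩, hw⟩ <;> rw [e] at hw
    exacts [⟨τ, .inl ⟨h, hw⟩⟩, ⟨τ, .inr (.inl ⟨h, hw⟩)⟩, ⟨τ, .inr (.inr ⟨h, hw⟩)⟩]
  · rintro ⟨τ, ⟨h, hw⟩ | ⟨h, hw⟩ | ⟨h, hw⟩⟩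
    exacts [⟨⟨_, up_nonempty.2 τ.2⟩, ⟨τ, .inl ⟨h, rfl⟩⟩, hw⟩,
      ⟨⟨_, _, last_mem_upLast _⟩, ⟨τ, .inr (.inl ⟨h, rfl⟩)⟩, hw⟩,
      ⟨lastFace _, ⟨τ, .inr (.inr ⟨h, rfl⟩)⟩, hw⟩]

theorem onPath_last {b : (cubeFaces N).face} {c : SignType} :
    OnPath {Fin.last N} (snoc b c) ↔ b = botFace N ∨ (c = 1 ∧ OnPath (addLast ∅) b) := by
  rw [← upLast_empty, onPath_upLast, onPath_empty]

/-- The section is compatible with cones. -/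
theorem toCube_glue_sect {x : (simplexFaces N).Table} (hx : ∀ m α, (x.lvl m α).Nonempty) :
    toCube (glue (sect x) (coneEnd x) (under_sect hx)) = sect (toSimplex (Table.cyl x)) := by
  apply ext_snoc
  intro m α b c
  rw [mem_toCube, mem_glue]
  have p₁ : ∀ τ : (simplexFaces N).face, b = topFace _ → OnPath τ.1 b := fun τ h =>
    h ▸ onPath_top τ.2
  have p₂ : ∀ τ : (simplexFaces N).face, b = botFace _ → OnPath τ.1 b := fun τ h =>
    h ▸ onPath_bot τ.1
  have p₃ : ∀ τ : (simplexFaces N).face, OnPath τ.1 b → OnPath (addLast τ.1) b := fun τ h =>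
    h.addLast
  have p₄ : ∀ τ : (simplexFaces N).face, OnPath {Fin.last N} b → OnPath (addLast τ.1) b :=
    fun τ h => onPath_addLast_of_empty h
  have p₅ : b = botFace _ → OnPath {Fin.last N} b := fun h => h ▸ onPath_bot _
  have up' : ∀ τ : (simplexFaces N).face, OnPath (up τ.1) (snoc b c) ↔
      (c = -1 ∧ OnPath τ.1 b) ∨ b = topFace _ := fun τ => onPath_up τ.2
  have hc : c = -1 ∨ c = 0 ∨ c = 1 := by clear up'; revert c; decide
  have h₀ : (1 : SignType) ≠ -1 := by decide
  have h₁ : (0 : SignType) ≠ -1 := by decide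
  have h₂ : (0 : SignType) ≠ 1 := by decide
  -- Levels `0` and `1` are separate: `susp` prescribes level `0` of both `sect` and `coneEnd`, and
  -- the cone is glued with a shift by one.
  rcases m with _ | _ | m
  · rw [sect_lvl_zero, sect_lvl_zero, Set.mem_singleton_iff, Set.mem_singleton_iff,
      snoc_eq_endFace]
    simp
  · rw [mem_sect_toSimplex hx]
    simp only [up', onPath_upLast, onPath_last, addLast_empty]
    obtain ⟨ρ, hρ⟩ := hx 0 α
    cases α
    · have e : cubeSign .src (0 + 1) = 1 := by decide
      simp only [mem_coneEnd_src, sect_lvl_zero, endFace, Set.mem_singleton_iff, e,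
        cubeSign_src_zero, Nat.add_sub_cancel]
      grind
    · have e : cubeSign .tgt (0 + 1) = -1 := by decide
      simp only [mem_coneEnd_tgt, sect_lvl_zero, endFace, Set.mem_singleton_iff, e,
        cubeSign_tgt_zero, Nat.add_sub_cancel, mem_sect (hx _ _)]
      grind
  · rw [mem_sect_toSimplex hx]
    simp only [up', onPath_upLast, onPath_last, addLast_empty,
      mem_coneEnd (hx _ _), mem_sect (hx _ _), Nat.add_sub_cancel]
    obtain ⟨ρ, hρ⟩ := hx m α
    have e := cubeSign_cases α m
    grind

theorem upMap_nonempty {z : (simplexFaces N).Table} (hz : ∀ m α, (z.lvl m α).Nonempty) (m : ℕ)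
    (α : Dir) : ((upMap z).lvl m α).Nonempty := by
  obtain ⟨τ, hτ⟩ := hz m α
  exact ⟨⟨up τ.1, up_nonempty.2 τ.2⟩, τ, hτ, rfl⟩

theorem exists_mem_upMap {z : (simplexFaces N).Table} {m : ℕ} {α : Dir}
    {p : Finset (Fin (N + 2)) → Prop} :
    (∃ w ∈ (upMap z).lvl m α, p w.1) ↔ ∃ τ ∈ z.lvl m α, p (up τ.1) := by
  constructor
  · rintro ⟨w, ⟨τ, hτ, e⟩, hw⟩
    exact ⟨τ, hτ, e ▸ hw⟩
  · rintro ⟨τ, hτ, h⟩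
    exact ⟨⟨up τ.1, up_nonempty.2 τ.2⟩, ⟨τ, hτ, rfl⟩, h⟩

/-- Over the facet without the last vertex, the cone to be glued is itself a section, over the cone
on `z` in a simplex of the same dimension. This is how the cones are recognized as cells in the
induction. -/
theorem coneOver_sect_upMap {z : (simplexFaces N).Table} (hz : ∀ m α, (z.lvl m α).Nonempty)
    (h : Under (sect (upMap z)) (coneEnd (upMap z))) :
    coneOver (sect (upMap z)) (coneEnd (upMap z)) h = sect (toSimplex (Table.cyl z)) := by
  have hz' := upMap_nonempty hz
  apply ext_mem
  intro m α b
  rw [mem_coneOver]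
  have p₁ : ∀ τ : (simplexFaces N).face, OnPath (up τ.1) b → OnPath (upLast τ.1) b := fun τ h =>
    h.addLast
  have p₂ : ∀ τ : (simplexFaces N).face, OnPath {Fin.last (N + 1)} b → OnPath (upLast τ.1) b :=
    fun τ h => onPath_addLast_of_empty (τ := up τ.1) h
  have p₃ : ∀ τ : (simplexFaces N).face, b = topFace _ → OnPath (up τ.1) b := fun τ h =>
    h ▸ onPath_top (up_nonempty.2 τ.2)
  rcases m with _ | _ | m
  · simp [sect_lvl_zero]
  · rw [mem_sect_toSimplex hz]
    obtain ⟨ρ, hρ⟩ := hz 0 α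
    cases α
    · simp [mem_coneEnd_src, cubeSign_src_zero, posDir]
      grind
    · simp [mem_coneEnd_tgt, cubeSign_tgt_zero, posDir, mem_sect (hz' _ _),
        exists_mem_upMap (p := fun s => OnPath s b)]
      grind
  · rw [mem_sect_toSimplex hz]
    simp only [mem_coneEnd (hz' _ _), mem_sect (hz' _ _), Nat.add_sub_cancel,
      exists_mem_upMap (p := fun s => OnPath s b),
      exists_mem_upMap (p := fun s => OnPath (addLast s) b), addLast_up]
    obtain ⟨ρ, hρ⟩ := hz m α
    have e := cubeSign_cases α m
    have e' := cubeSign_cases α (m + 1)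
    have h₀ : (1 : SignType) ≠ -1 := by decide
    grind

section LastMem

variable {σ : (simplexFaces N).face} {σ₀ : Finset (Fin N)}
  {τ : (simplexFaces N).face} {ρ : Finset (Fin N)} {k : ℕ} {α : Dir}

theorem up_mem_atom_of_last (hσ : σ.1 = upLast σ₀) (hτ : τ.1 = up ρ) :
    τ ∈ ((simplexFaces N).atom σ).lvl k α ↔
      (cubeSign α k = 1 ∧ star ρ ∈ ((cubeFaces N).atom (star σ₀)).lvl (k + 1) α) ∨
        star ρ ∈ ((cubeFaces N).atom (star σ₀)).lvl k α := by
  rw [mem_simplex_atom, hσ, hτ, star_up, star_upLast, mem_atom_snoc_zero,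
    neg_one_eq_cubeSign_succ, eq_comm (a := (1 : SignType))]
  simp

theorem upLast_mem_atom_of_last (hσ : σ.1 = upLast σ₀) (hτ : τ.1 = upLast ρ) :
    τ ∈ ((simplexFaces N).atom σ).lvl k α ↔
      star ρ ∈ ((cubeFaces N).atom (star σ₀)).lvl k α := by
  have h₀ : ¬ (0 : SignType) = cubeSign α (k + 1) := fun h => cubeSign_ne_zero _ _ h.symm
  rw [mem_simplex_atom, hσ, hτ, star_upLast, star_upLast, mem_atom_snoc_zero]
  simp [h₀]

/-- Adding the last vertex raises the dimension by at most one. The result stays in level `k`,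
unless `τ` belongs to the part of level `k` at the boundary sign; then `τ` with the last vertex is
found one level higher. -/
theorem exists_addLast_mem (hσ : σ.1 = upLast σ₀) (hτ : τ ∈ ((simplexFaces N).atom σ).lvl k α) :
    ∃ ρ : (simplexFaces N).face, ρ.1 = addLast τ.1 ∧
      (ρ ∈ ((simplexFaces N).atom σ).lvl k α ∨
        (cubeSign α k = 1 ∧ ρ ∈ ((simplexFaces N).atom σ).lvl (k + 1) α)) := by
  obtain ⟨ρ, h | h⟩ := exists_up τ.1
  · obtain ⟨ρ', hρ'⟩ : ∃ ρ' : (simplexFaces N).face, ρ'.1 = upLast ρ :=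
      ⟨⟨upLast ρ, _, last_mem_upLast ρ⟩, rfl⟩
    refine ⟨ρ', by rw [h, addLast_up, hρ'], ?_⟩
    rw [upLast_mem_atom_of_last hσ hρ', upLast_mem_atom_of_last hσ hρ']
    exact ((up_mem_atom_of_last hσ h).1 hτ).symm
  · exact ⟨τ, by rw [h, addLast_upLast], .inl hτ⟩

/-- The converse comparison of levels: a face of level `k + 1` lies in level `k`, or is made to do
so by removing the last vertex, up to enlarging its path. The last vertex alone can be replaced by
any face of level `k`. -/
theorem exists_mem_of_mem_succ (hσ : σ.1 = upLast σ₀) (hk : cubeSign α k = 1)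
    (hτ : τ ∈ ((simplexFaces N).atom σ).lvl (k + 1) α) :
    ∃ ρ ∈ ((simplexFaces N).atom σ).lvl k α, ∀ b : (cubeFaces (N + 1)).face,
      OnPath τ.1 b → OnPath (addLast ρ.1) b := by
  obtain ⟨ρ, h | h⟩ := exists_up τ.1
  · refine ⟨τ, (up_mem_atom_of_last hσ h).2 ?_, fun b hb => hb.addLast⟩
    refine ((up_mem_atom_of_last hσ h).1 hτ).elim (fun h' => ?_) (fun h' => .inl ⟨hk, h'⟩)
    have := cubeSign_cases α k
    have h₀ : (1 : SignType) ≠ -1 := by decide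
    grind
  · rcases ρ.eq_empty_or_nonempty with rfl | hρ
    · obtain ⟨ρ', hρ'⟩ := simplex_atom_nonempty σ k α
      refine ⟨ρ', hρ', fun b hb => onPath_addLast_of_empty ?_⟩
      rwa [h] at hb
    · refine ⟨⟨up ρ, up_nonempty.2 hρ⟩, (up_mem_atom_of_last hσ rfl).2 (.inl ⟨hk, ?_⟩),
        fun b hb => ?_⟩
      · exact (upLast_mem_atom_of_last hσ h).1 hτ
      · rwa [h] at hb

theorem mem_atom_zero_src_of_last (hσ : σ.1 = upLast σ₀) :
    τ ∈ ((simplexFaces N).atom σ).lvl 0 .src ↔ τ.1 = {Fin.last N} := by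
  have h₀ : ¬ (-1 : SignType) = 1 := by decide
  obtain ⟨ρ, h | h⟩ := exists_up τ.1
  · rw [up_mem_atom_of_last hσ h, cubeSign_src_zero, h, ← upLast_empty]
    have h₁ := star_notMem_lvl_zero (up_nonempty.1 (h ▸ τ.2)) (star σ₀) .src
    simp [h₀, h₁, up_ne_upLast]
  · rw [upLast_mem_atom_of_last hσ h, h, ← upLast_empty, upLast_injective.eq_iff]
    constructor
    · intro h'
      by_contra hρ
      exact star_notMem_lvl_zero (Finset.nonempty_iff_ne_empty.2 hρ) _ _ h'
    · rintro rfl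
      rw [star_empty]
      exact bot_mem_atom_star _

/-- If `σ` contains the last vertex, its path already contains the path of `addLast`; the cone lies
in the end of the cylinder and nothing is glued. -/
theorem glue_sect_of_last (hσ : σ.1 = upLast σ₀)
    (h : Under (sect ((simplexFaces N).atom σ)) (coneEnd ((simplexFaces N).atom σ))) :
    glue (sect ((simplexFaces N).atom σ)) (coneEnd ((simplexFaces N).atom σ)) h =
      Table.cyl (sect ((simplexFaces N).atom σ)) := by
  have hx := simplex_atom_nonempty σ
  apply ext_pair
  intro m γ b c
  rw [mem_glue, mem_cyl]
  by_cases hc : c ≠ 1 ∨ m = 0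
  · rcases hc with hc | rfl
    · simp [hc]
    · simp
  · obtain ⟨rfl, hm⟩ : c = 1 ∧ m ≠ 0 := by simpa using hc
    obtain ⟨k, rfl⟩ := Nat.exists_eq_succ_of_ne_zero hm
    simp only [ne_eq, not_true_eq_false, Nat.succ_ne_zero, or_self, false_and, or_false,
      Nat.succ_pos, true_and, Nat.succ_sub_one, Nat.succ_eq_add_one]
    rcases k with _ | k
    · cases γ
      · have e : cubeSign .src (0 + 1) = 1 := by decide
        rw [mem_coneEnd_src, e, mem_sect (hx _ _), sect_lvl_zero]
        simp only [mem_atom_zero_src_of_last hσ]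
        constructor
        · exact fun hb => .inl ⟨trivial, lastFace N, rfl, hb⟩
        · rintro (⟨-, τ, hτ, hb⟩ | rfl)
          · rwa [hτ] at hb
          · exact onPath_bot _
      · have e : ¬ (1 : SignType) = cubeSign .tgt (0 + 1) := by decide
        rw [mem_coneEnd_tgt, sect_lvl_zero]
        simp only [e, false_and, false_or]
        rfl
    · have e : cubeSign γ (k + 1 + 1) = cubeSign γ k := by cases γ <;> simp [cubeSign, pow_succ]
      rw [mem_coneEnd (hx _ _), mem_sect (hx _ _), mem_sect (hx _ _), e]
      constructor
      · rintro ⟨τ, hτ, hb⟩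
        obtain ⟨ρ, hρ, h' | ⟨h', h''⟩⟩ := exists_addLast_mem hσ hτ
        · exact .inr ⟨ρ, h', hρ ▸ hb⟩
        · exact .inl ⟨h'.symm, ρ, h'', hρ ▸ hb⟩
      · rintro (⟨h', τ, hτ, hb⟩ | ⟨τ, hτ, hb⟩)
        · obtain ⟨ρ, hρ, h''⟩ := exists_mem_of_mem_succ hσ h'.symm hτ
          exact ⟨ρ, hρ, h'' b hb⟩
        · exact ⟨τ, hτ, hb.addLast⟩

end LastMem

end
end FaceSystem

/-! ### The section sends atoms to cells congruent to atoms. -/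

namespace FaceSystem
open Table

section

variable {N : ℕ}

theorem mem_atom_vertex {a b : (cubeFaces N).face} (ha : (cubeFaces N).dim a = 0) {k : ℕ}
    {α : Dir} : b ∈ ((cubeFaces N).atom a).lvl k α ↔ b = a := by
  have h : cubeZeros a = ∅ := Finset.card_eq_zero.1 ha
  rw [mem_atom, atomLvl_of_dim_le _ (ha.trans_le (Nat.zero_le k))]
  constructor
  · intro hb
    funext i
    refine hb i fun hi => ?_
    have : i ∈ cubeZeros a := mem_cubeZeros.2 hi
    simp [h] at this
  · rintro rfl
    exact (cubeFaces N).sub_refl b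

theorem dim_endFace (α : Dir) : (cubeFaces N).dim (endFace N α) = 0 := by
  have e : cubeZeros (endFace N α) = ∅ := by
    refine Finset.eq_empty_of_forall_notMem fun i hi => ?_
    replace hi := mem_cubeZeros.1 hi
    cases α
    · exact absurd (show (-1 : SignType) = 0 from hi) (by decide)
    · exact absurd (show (1 : SignType) = 0 from hi) (by decide)
  exact Finset.card_eq_zero.2 e

theorem mem_atom_botFace {b : (cubeFaces N).face} {k : ℕ} {α : Dir} :
    b ∈ ((cubeFaces N).atom (botFace N)).lvl k α ↔ b = botFace N :=
  mem_atom_vertex (dim_endFace .src)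

theorem mem_atom_topFace {b : (cubeFaces N).face} {k : ℕ} {α : Dir} :
    b ∈ ((cubeFaces N).atom (topFace N)).lvl k α ↔ b = topFace N :=
  mem_atom_vertex (dim_endFace .tgt)

theorem IsCell.simplex_nonempty {x : (simplexFaces N).Table} (hx : IsCell (simplexFaces N) x) :
    ∀ k α, (x.lvl k α).Nonempty := by
  refine IsCell.induction (closed_simplex N) (p := fun x => ∀ k α, (x.lvl k α).Nonempty)
    simplex_atom_nonempty (fun n x y z _ _ h hx hy k α => ?_) hx
  obtain ⟨a, ha⟩ := hx k α
  obtain ⟨b, hb⟩ := hy k α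
  rcases lt_trichotomy k n with hk | rfl | hk
  · exact ⟨a, (h.mem k α a).2 (.inl ⟨hk, ha⟩)⟩
  · cases α
    · exact ⟨a, (h.mem k _ a).2 (.inr (.inl ⟨rfl, rfl, ha⟩))⟩
    · exact ⟨b, (h.mem k _ b).2 (.inr (.inr (.inl ⟨rfl, rfl, hb⟩)))⟩
  · exact ⟨a, (h.mem k α a).2 (.inr (.inr (.inr ⟨hk, .inl ha⟩)))⟩

/-- The section respects composition, so atoms suffice. -/
theorem isCell_sect (h : ∀ σ, IsCell _ (sect ((simplexFaces N).atom σ)))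
    {x : (simplexFaces N).Table} (hx : IsCell (simplexFaces N) x) : IsCell _ (sect x) :=
  IsCell.induction (closed_simplex N) (p := fun x => IsCell _ (sect x)) h
    (fun _ _ _ _ _ _ h hx hy => hx.comp hy (IsComp.sect h)) hx

theorem proper_atom_snoc_zero (a : (cubeFaces N).face) :
    Proper ((cubeFaces (N + 1)).atom (snoc a 0)) := by
  rw [atom_snoc_zero]
  exact .toCube_cyl (.atom a)

theorem botFace_ne_topFace : botFace (N + 1) ≠ topFace (N + 1) := fun h => by
  have e : (-1 : SignType) = 1 := congrFun h (0 : Fin (N + 1))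
  exact absurd e (by decide)

theorem Proper.of_isCell_sect {x : (simplexFaces N).Table} (h : IsCell _ (sect x)) :
    Proper (sect x) where
  isCell := h
  ne e := botFace_ne_topFace (Set.singleton_injective e)

theorem sect_atom_zero (σ : (simplexFaces 0).face) :
    sect ((simplexFaces 0).atom σ) = (cubeFaces 1).atom (star σ.1) := by
  obtain ⟨τ, h | h⟩ := exists_up σ.1
  · obtain ⟨i, -⟩ := up_nonempty.1 (h ▸ σ.2)
    exact i.elim0
  · have e : ∀ a b : (cubeFaces 0).face, a = b := fun a b => funext fun i : Fin 0 => i.elim0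
    have hb : ∀ b k α, b ∈ ((cubeFaces 0).atom (star τ)).lvl k α := fun b k α => by
      rw [e (star τ) (botFace 0), mem_atom_botFace]
      exact e _ _
    apply ext_snoc
    intro k α b c
    rw [h, star_upLast, mem_atom_snoc_zero]
    cases k with
    | zero =>
      rw [sect_lvl_zero, Set.mem_singleton_iff, snoc_eq_endFace]
      simp [hb, e b (endFace 0 α)]
    | succ k =>
      obtain ⟨ρ, hρ⟩ := simplex_atom_nonempty σ k α
      rw [mem_sect ⟨ρ, hρ⟩]
      refine iff_of_true ⟨ρ, hρ, ?_⟩ (.inr ⟨Nat.succ_pos k, hb _ _ _⟩)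
      obtain ⟨ρ₀, h' | h'⟩ := exists_up ρ.1
      · obtain ⟨i, -⟩ := up_nonempty.1 (h' ▸ ρ.2)
        exact i.elim0
      · rw [h', onPath_upLast]
        exact .inl trivial

/-- A path over the base runs in the end - and then along the last edge at the top, so that the
congruence discards this edge. -/
theorem isComp_sect_up {σ : (simplexFaces N).face} {σ' : (simplexFaces (N + 1)).face}
    (hσ : σ'.1 = up σ.1) :
    IsComp 0 (endMap (-1) (sect ((simplexFaces N).atom σ)))
      ((cubeFaces (N + 2)).atom (snoc (topFace (N + 1)) 0))
      (sect ((simplexFaces (N + 1)).atom σ')) := by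
  have hx := simplex_atom_nonempty σ
  rw [← upMap_atom hσ]
  refine isComp_iff.2 ⟨fun k hk => absurd hk (Nat.not_lt_zero k), ?_, ?_, ?_, ?_⟩ <;>
    intro a
  rotate_right
  · intro hk α w
    obtain ⟨k, rfl⟩ := Nat.exists_eq_succ_of_ne_zero hk.ne'
    obtain ⟨b, c, rfl⟩ := exists_snoc w
    have h₁ : ∀ τ : (simplexFaces N).face, OnPath (up τ.1) (snoc b c) ↔
        (c = -1 ∧ OnPath τ.1 b) ∨ b = topFace (N + 1) := fun τ => onPath_up τ.2
    rw [mem_sect (upMap_nonempty hx _ _), mem_endMap, mem_sect (hx _ _), mem_atom_snoc_zero,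
      exists_mem_upMap (p := fun s => OnPath s (snoc b c)), mem_atom_topFace, mem_atom_topFace]
    obtain ⟨τ, hτ⟩ := hx k α
    simp only [h₁]
    grind
  all_goals obtain ⟨b, c, rfl⟩ := exists_snoc a
  · rw [mem_endMap, sect_lvl_zero, mem_atom_snoc_zero, mem_atom_topFace, cubeSign_src_zero]
    simp [endFace]
  · rw [mem_endMap, sect_lvl_zero, sect_lvl_zero, Set.mem_singleton_iff, snoc_eq_endFace,
      cubeSign_src_zero]
    rfl
  · rw [sect_lvl_zero, mem_atom_snoc_zero, Set.mem_singleton_iff, snoc_eq_endFace,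
      mem_atom_topFace]
    simp [endFace]

/-- The path of the apex starts with the last edge at the bottom vertex. Everything after that edge
is discarded by the congruence, leaving the atom of the apex. -/
theorem isComp_sect_last {σ : (simplexFaces (N + 1)).face} (hσ : σ.1 = {Fin.last (N + 1)}) :
    IsComp 0 ((cubeFaces (N + 2)).atom (snoc (botFace (N + 1)) 0))
      (endMap 1 (sect ((simplexFaces N).atom (lastFace N))))
      (sect ((simplexFaces (N + 1)).atom σ)) := by
  have hx := simplex_atom_nonempty (lastFace N)
  refine isComp_iff.2 ⟨fun k hk => absurd hk (Nat.not_lt_zero k), ?_, ?_, ?_, ?_⟩ <;>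
    intro a
  rotate_right
  · intro hk α w
    obtain ⟨k, rfl⟩ := Nat.exists_eq_succ_of_ne_zero hk.ne'
    obtain ⟨b, c, rfl⟩ := exists_snoc w
    have e₁ : ∀ τ : (simplexFaces (N + 1)).face,
        τ ∈ ((simplexFaces (N + 1)).atom σ).lvl k α ↔ τ.1 = {Fin.last (N + 1)} :=
      fun τ => mem_atom_last hσ
    have e₂ : ∀ τ : (simplexFaces N).face,
        τ ∈ ((simplexFaces N).atom (lastFace N)).lvl k α ↔ τ.1 = {Fin.last N} :=
      fun τ => mem_atom_last rfl
    rw [mem_sect (simplex_atom_nonempty _ _ _), mem_endMap, mem_sect (hx _ _), mem_atom_snoc_zero,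
      mem_atom_botFace, mem_atom_botFace]
    simp only [e₁, e₂]
    have h₁ : (∃ τ : (simplexFaces (N + 1)).face, τ.1 = {Fin.last (N + 1)} ∧
        OnPath τ.1 (snoc b c)) ↔ b = botFace (N + 1) ∨ (c = 1 ∧ OnPath {Fin.last N} b) := by
      refine Iff.trans ⟨?_, fun h => ⟨σ, hσ, hσ ▸ h⟩⟩ onPath_last
      rintro ⟨τ, hτ, h⟩
      rwa [hτ] at h
    have h₂ : (∃ τ : (simplexFaces N).face, τ.1 = {Fin.last N} ∧ OnPath τ.1 b) ↔
        OnPath {Fin.last N} b := by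
      refine ⟨?_, fun h => ⟨lastFace N, rfl, h⟩⟩
      rintro ⟨τ, hτ, h⟩
      rwa [hτ] at h
    rw [h₁, h₂]
    have := onPath_bot {Fin.last N}
    grind
  all_goals obtain ⟨b, c, rfl⟩ := exists_snoc a
  · rw [mem_endMap, sect_lvl_zero, mem_atom_snoc_zero, mem_atom_botFace, cubeSign_tgt_zero]
    simp [endFace]
  · rw [sect_lvl_zero, mem_atom_snoc_zero, Set.mem_singleton_iff, snoc_eq_endFace,
      mem_atom_botFace]
    simp [endFace]
  · rw [mem_endMap, sect_lvl_zero, sect_lvl_zero, Set.mem_singleton_iff, snoc_eq_endFace,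
      cubeSign_tgt_zero]
    rfl

theorem upMap_d (α : Dir) (n : ℕ) (x : (simplexFaces N).Table) :
    upMap (Table.d α n x) = Table.d α n (upMap x) := rel_d _ _ _ _

/-- Every cone required by `ConeCell` is a section over a cell of the `(N + 1)`-simplex by
`coneOver_sect_upMap`, hence a cell by `hN`. -/
theorem coneCell_sect_upMap (hN : ∀ σ, IsCell _ (sect ((simplexFaces (N + 1)).atom σ)))
    {z : (simplexFaces N).Table} (hz : IsCell _ z)
    (h : Under (sect (upMap z)) (coneEnd (upMap z))) : ConeCell _ _ h where
  proper := .of_isCell_sect (isCell_sect hN hz.upMap)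
  cone β j := by
    have hz' := hz.d β j
    have e := coneOver_congr (t := sect (upMap (Table.d β j z)))
      (H := coneEnd (upMap (Table.d β j z))) (by rw [upMap_d, sect_d]) (by rw [upMap_d, coneEnd_d])
      (under_sect (upMap_nonempty hz'.simplex_nonempty)) (h.d β j)
    rw [← e, coneOver_sect_upMap hz'.simplex_nonempty]
    exact isCell_sect hN hz'.toSimplex_cyl

/-- The section of the projection onto a simplex sends an atom to an atom, up to equivalence. -/
theorem sect_atom_eqv : ∀ {N : ℕ} (σ : (simplexFaces N).face),
    NegEqv (sect ((simplexFaces N).atom σ)) ((cubeFaces (N + 1)).atom (star σ.1))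
  | 0, σ => by
    rw [sect_atom_zero]
    obtain ⟨τ, h | h⟩ := exists_up σ.1
    · obtain ⟨i, -⟩ := up_nonempty.1 (h ▸ σ.2)
      exact i.elim0
    · rw [h, star_upLast]
      exact .refl (proper_atom_snoc_zero _)
  | N + 1, σ' => by
    -- Congruence is only defined between cells, so the recursive statement also says that the
    -- sections are cells.
    have hN : ∀ σ, IsCell _ (sect ((simplexFaces N).atom σ)) := fun σ =>
      (sect_atom_eqv σ).proper.1.isCell
    obtain ⟨σ, h | h | h⟩ : ∃ σ : (simplexFaces N).face,
        σ'.1 = up σ.1 ∨ σ'.1 = upLast σ.1 ∨ σ'.1 = {Fin.last (N + 1)} := by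
      rcases exists_up_face σ' with ⟨τ, h⟩ | ⟨τ, h⟩ | h
      · exact ⟨τ, .inl h⟩
      · exact ⟨τ, .inr (.inl h)⟩
      · exact ⟨lastFace N, .inr (.inr h)⟩
    · have ih := sect_atom_eqv σ
      have e := ih.endMap (c := -1) (by decide)
      have hc := isComp_sect_up h
      rw [h, star_up, ← endMap_atom (by decide)]
      refine NegEqv.trans (.symm (.step e.proper.1 (proper_atom_snoc_zero _) ?_ hc)) e
      exact .of_isCell_sect (e.proper.1.isCell.comp (.atom _) hc)
    · have ih := sect_atom_eqv σ
      have hx := simplex_atom_nonempty σ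
      rw [← toSimplex_cyl_atom h, ← toCube_glue_sect hx, h, star_upLast, atom_snoc_zero]
      refine NegEqv.trans ?_ ih.cyl
      -- It remains to remove the glued cone. It is a genuine cone if `σ` omits the last vertex of
      -- the base, and it is empty otherwise.
      obtain ⟨σ₀, h₀ | h₀⟩ := exists_up σ.1
      · cases N with
        | zero =>
          obtain ⟨i, -⟩ := up_nonempty.1 (h₀ ▸ σ.2)
          exact i.elim0
        | succ N =>
          obtain ⟨ρ, hρ⟩ : ∃ ρ : (simplexFaces N).face, ρ.1 = σ₀ :=
            ⟨⟨σ₀, up_nonempty.1 (h₀ ▸ σ.2)⟩, rfl⟩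
          subst hρ
          have e := upMap_atom h₀
          have hc : ConeCell _ _ (under_sect hx) := by
            have := coneCell_sect_upMap hN (.atom ρ)
            rw [e] at this
            exact this _
          exact hc.glue_eqv
      · rw [glue_sect_of_last h₀]
        exact .refl (.toCube_cyl (hN σ))
    · have e := (sect_atom_eqv (lastFace N)).proper.1.endMap (c := 1) (by decide)
      have hc := isComp_sect_last h
      rw [h, ← upLast_empty, star_upLast, star_empty]
      refine .symm (.step (proper_atom_snoc_zero _) e ?_ hc)
      exact .of_isCell_sect (.comp (.atom _) e.isCell hc)

theorem Proper.sect {x : (simplexFaces N).Table} (hx : IsCell _ x) :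
    Proper (sect x) :=
  .of_isCell_sect (isCell_sect (fun σ => (sect_atom_eqv σ).proper.1.isCell) hx)

end
end FaceSystem

/-! ### The universal property of the negative semi-path omega-category. -/

namespace OmegaCat

section NegSemiPath

variable {C : OmegaCat.{u}} {hC : C.NonContracting}

/-- The generators of a free omega-category. -/
noncomputable def freeOf {G : GlobSet.{u}} (n : ℕ) (x : G.cells n) : (free.obj G).carrier :=
  presOf (FreeRel G) (fun x => ⟨x.1, fun α => .top α x.1 x.2⟩) ⟨n, x⟩

theorem free_hom_ext {G : GlobSet.{u}} {D : OmegaCat.{u}} {f g : free.obj G ⟶ D}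
    (h : ∀ n x, f.toFun (freeOf n x) = g.toFun (freeOf n x)) : f = g :=
  presHom_ext _ fun x => h x.1 x.2

theorem free_map_of {G H : GlobSet.{u}} (f : G ⟶ H) (n : ℕ) (x : G.cells n) :
    (free.map f).toFun (freeOf n x) = freeOf n (f.toFun n x) :=
  freeLift_of _ ⟨n, x⟩

theorem freeAdj_counit_of (D : OmegaCat.{u}) (n : ℕ) (x : (toGlob.obj D).cells n) :
    (freeAdj.counit.app D).toFun (freeOf n x) = x.1 :=
  freeLift_of _ ⟨n, x⟩

/-- The canonical omega-functor from the path omega-category. -/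
noncomputable def toNegSemiPath (hC : C.NonContracting) : C.path hC ⟶ C.negSemiPath hC :=
  pushout.inr _ _

/-- The canonical omega-functor from the free omega-category on the quotient by `R^-`. -/
noncomputable def fromNegQuot (hC : C.NonContracting) :
    free.obj (negQuot hC) ⟶ C.negSemiPath hC :=
  pushout.inl _ _

theorem fromNegQuot_condition (hC : C.NonContracting) :
    free.map (negProj hC) ≫ fromNegQuot hC =
      freeAdj.counit.app (C.path hC) ≫ toNegSemiPath hC := pushout.condition

theorem fromNegQuot_of {n : ℕ} (y : (toGlob.obj (C.path hC)).cells n) :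
    (fromNegQuot hC).toFun (freeOf n ((negProj hC).toFun n y)) = (toNegSemiPath hC).toFun y.1 := by
  have e := congrArg (fun k => Hom.toFun k (freeOf n y)) (fromNegQuot_condition hC)
  rw [← free_map_of]
  exact e.trans (congrArg _ (freeAdj_counit_of _ n y))

theorem exists_d_eq_pair (D : OmegaCat.{u}) (x z : D.carrier) :
    ∃ n, (∀ α, D.d α n x = x) ∧ ∀ α, D.d α n z = z := by
  obtain ⟨n, hn⟩ := D.finite x
  obtain ⟨m, hm⟩ := D.finite z
  have key : ∀ (y : D.carrier) (k l : ℕ), k ≤ l → (∀ α, D.d α k y = y) → ∀ α, D.d α l y = y := by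
    intro y k l hkl h α
    have e := D.d_d_ge .src α l k y hkl
    rwa [h .src] at e
  exact ⟨max n m, key x _ _ (le_max_left _ _) hn, key z _ _ (le_max_right _ _) hm⟩

/-- The quotient is formed dimension by dimension, so both morphisms are first viewed as cells of a
common dimension. -/
theorem toNegSemiPath_eq {x z : (C.path hC).carrier} (h : NegStep hC x z) :
    (toNegSemiPath hC).toFun x = (toNegSemiPath hC).toFun z := by
  obtain ⟨n, hx, hz⟩ := exists_d_eq_pair _ x z
  let x' : (toGlob.obj (C.path hC)).cells n := ⟨x, hx⟩
  let z' : (toGlob.obj (C.path hC)).cells n := ⟨z, hz⟩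
  have e : (negProj hC).toFun n x' = (negProj hC).toFun n z' :=
    Quotient.sound (s := negSetoid hC n) (.rel _ _ h)
  exact (fromNegQuot_of x').symm.trans ((congrArg (fun y => (fromNegQuot hC).toFun (freeOf n y)) e).trans
    (fromNegQuot_of z'))

theorem NegRel.map_eq {D : OmegaCat.{u}} (f : C.path hC ⟶ D)
    (hf : ∀ x z, NegStep hC x z → f.toFun x = f.toFun z) {x z : (C.path hC).carrier}
    (h : NegRel hC x z) : f.toFun x = f.toFun z := by
  induction h with
  | rel x z h => exact hf x z h
  | refl x => rfl
  | symm _ _ _ ih => exact ih.symm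
  | trans _ _ _ _ _ ih ih' => exact ih.trans ih'

/-- The morphism out of the quotient by `R^-` given by a compatible omega-functor. -/
def negQuotLift {D : OmegaCat.{u}} (f : C.path hC ⟶ D)
    (hf : ∀ x z, NegStep hC x z → f.toFun x = f.toFun z) : negQuot hC ⟶ toGlob.obj D where
  toFun n := Quotient.lift ((toGlob.map f).toFun n) fun _ _ h => Subtype.ext (NegRel.map_eq f hf h)
  map_s n x := by
    induction x using Quotient.inductionOn with
    | h x => exact (toGlob.map f).map_s n x
  map_t n x := by
    induction x using Quotient.inductionOn with
    | h x => exact (toGlob.map f).map_t n x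

/-- A compatible functor gives a map on the quotient globular set, hence on its free omega-category;
the two legs agree on generators. -/
theorem negSemiPath_exists_desc {D : OmegaCat.{u}} (f : C.path hC ⟶ D)
    (hf : ∀ x z, NegStep hC x z → f.toFun x = f.toFun z) :
    ∃ g : C.negSemiPath hC ⟶ D, toNegSemiPath hC ≫ g = f := by
  refine ⟨pushout.desc (freeLift (negQuotLift f hf)) f ?_, pushout.inr_desc _ _ _⟩
  refine free_hom_ext fun n x => ?_
  exact ((congrArg _ (free_map_of _ n x)).trans (freeLift_of _ _)).trans
    (congrArg _ (freeAdj_counit_of _ n x).symm)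

/-- The generators on the free side are classes of paths, so the other leg of the pushout determines
everything. -/
theorem negSemiPath_hom_ext {D : OmegaCat.{u}} {g h : C.negSemiPath hC ⟶ D}
    (e : toNegSemiPath hC ≫ g = toNegSemiPath hC ≫ h) : g = h := by
  refine pushout.hom_ext (free_hom_ext fun n x => ?_) e
  obtain ⟨y, rfl⟩ := Quotient.exists_rep x
  have h₁ : ∀ k : C.negSemiPath hC ⟶ D, (pushout.inl _ _ ≫ k).toFun
      (freeOf n ((negProj hC).toFun n y)) = (toNegSemiPath hC ≫ k).toFun y.1 := fun k =>
    congrArg k.toFun (fromNegQuot_of y)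
  exact (h₁ g).trans ((congrArg (fun k => Hom.toFun k y.1) e).trans (h₁ h).symm)

/-- A direct sum of omega-categories is isomorphic to the negative semi-path omega-category of `C`
if it is a retract of the path omega-category, up to the equivalence relation `R^-`. -/
theorem negSemiPath_iso {ι : Type u} {D : ι → OmegaCat.{u}} (g : C.path hC ⟶ directSum D)
    (hg : ∀ x z, NegStep hC x z → g.toFun x = g.toFun z) (s : ∀ i, D i ⟶ C.path hC)
    (h₁ : ∀ i, s i ≫ g = directSumIncl D i)
    (h₂ : ∀ k : directSum D ⟶ C.negSemiPath hC,
      (∀ i, directSumIncl D i ≫ k = s i ≫ toNegSemiPath hC) → g ≫ k = toNegSemiPath hC) :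
    Nonempty (C.negSemiPath hC ≅ directSum D) := by
  obtain ⟨a, ha⟩ := negSemiPath_exists_desc g hg
  let c := Cofan.mk _ fun i => s i ≫ toNegSemiPath hC
  let k : directSum D ⟶ C.negSemiPath hC := (directSumIsColimit D).desc c
  have hk : ∀ i, directSumIncl D i ≫ k = s i ≫ toNegSemiPath hC := fun i =>
    (directSumIsColimit D).fac c ⟨i⟩
  -- The inverse of the induced functor is given by the sections on the summands. One composite is
  -- checked on paths, the other on each summand.
  refine ⟨a, k, negSemiPath_hom_ext ?_, (directSumIsColimit D).hom_ext fun ⟨i⟩ => ?_⟩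
  · rw [← Category.assoc, ha, h₂ k hk, Category.comp_id]
  · change directSumIncl D i ≫ k ≫ a = directSumIncl D i ≫ 𝟙 _
    rw [← Category.assoc, hk, Category.assoc, ha, h₁, Category.comp_id]

end NegSemiPath

end OmegaCat

/-! ### Functors determined by atoms, and vertex figures of tables. -/

namespace FaceSystem
open Table OmegaCat

/-- Two omega-functors agreeing on the atoms are equal. -/
theorem omegaCat_hom_ext {K : FaceSystem} (hK : Closed K) {D : OmegaCat.{0}}
    {f g : K.omegaCat ⟶ D}
    (h : ∀ a, f.toFun ⟨K.atom a, IsCell.atom a⟩ = g.toFun ⟨K.atom a, IsCell.atom a⟩) : f = g := by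
  refine OmegaCat.hom_ext fun x => ?_
  refine IsCell.induction hK (p := fun x => ∀ hx : IsCell K x, f.toFun ⟨x, hx⟩ = g.toFun ⟨x, hx⟩)
    (fun a _ => h a) ?_ x.2 x.2
  intro n x y z hx hy hz ihx ihy hz'
  obtain ⟨e, rfl⟩ := hz
  have e' : K.omegaCat.d .tgt n ⟨x, hx⟩ = K.omegaCat.d .src n ⟨y, hy⟩ := Subtype.ext e
  refine (f.map_comp n _ _ e' (f.compat e')).trans (Eq.trans ?_
    (g.map_comp n _ _ e' (g.compat e')).symm)
  exact D.comp_congr n (ihx hx) (ihy hy) _ _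

section

variable {N : ℕ}

/-- The path omega-category of a cube. -/
abbrev cubePath (N : ℕ) : OmegaCat.{0} := (cube N).path (cube_nonContracting N)

theorem Proper.one_le_dim {x : (cubeFaces N).Table} (hx : Proper x) :
    1 ≤ (cube N).dim ⟨x, hx.isCell⟩ := by
  refine (one_le_dim_iff _).2 fun h => ?_
  have e : Table.d .src 0 x = x := congrArg Subtype.val (h .src)
  have e' : (Table.d .src 0 x).lvl 0 .tgt = x.lvl 0 .src := rfl
  rw [e] at e'
  exact hx.ne e'.symm

/-- The element of the path omega-category given by a proper table. -/
def pathCell (x : (cubeFaces N).Table) (hx : Proper x) : (cubePath N).carrier :=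
  ⟨⟨x, hx.isCell⟩, hx.one_le_dim⟩

theorem proper_of_path (x : (cubePath N).carrier) : Proper x.1.1 where
  isCell := x.1.2
  ne e := (one_le_dim_iff x.1).1 x.2 fun α => Subtype.ext (IsCell.d_zero x.1.2 e α)

theorem pathCell_congr {x y : (cubeFaces N).Table} (h : x = y) (hx : Proper x) (hy : Proper y) :
    pathCell x hx = pathCell y hy := by
  subst h
  rfl

theorem pathCell_comp {n : ℕ} {x y z : (cubeFaces N).Table} (h : IsComp (n + 1) x y z)
    (hx : Proper x) (hy : Proper y) (hz : Proper z) :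
    ∃ e, pathCell z hz = (cubePath N).comp n (pathCell x hx) (pathCell y hy) e := by
  obtain ⟨h, rfl⟩ := h
  exact ⟨Subtype.ext (Subtype.ext h), rfl⟩

theorem negStep_pathCell {x y z : (cubeFaces N).Table} (h : IsComp 0 x y z)
    (hx : Proper x) (hy : Proper y) (hz : Proper z) :
    NegStep (cube_nonContracting N) (pathCell x hx) (pathCell z hz) := by
  obtain ⟨h, rfl⟩ := h
  exact ⟨pathCell y hy, Subtype.ext h, rfl⟩

/-- A functor respecting the steps respects the congruence they generate, since it preserves the
higher compositions. -/
theorem NegEqv.map_eq {D : OmegaCat.{0}} (f : cubePath N ⟶ D)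
    (hf : ∀ x z, NegStep (cube_nonContracting N) x z → f.toFun x = f.toFun z)
    {x y : (cubeFaces N).Table} (h : NegEqv x y) :
    ∀ (hx : Proper x) (hy : Proper y), f.toFun (pathCell x hx) = f.toFun (pathCell y hy) := by
  induction h with
  | refl _ => exact fun _ _ => rfl
  | symm _ ih => exact fun hx hy => (ih hy hx).symm
  | trans h _ ih ih' => exact fun hx hy => (ih hx h.proper.2).trans (ih' h.proper.2 hy)
  | comp hx hy h h' ihx ihy =>
    intro hz hz'
    obtain ⟨e, e₁⟩ := pathCell_comp h hx.proper.1 hy.proper.1 hz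
    obtain ⟨e', e₂⟩ := pathCell_comp h' hx.proper.2 hy.proper.2 hz'
    rw [e₁, e₂, f.map_comp _ _ _ e (f.compat e), f.map_comp _ _ _ e' (f.compat e')]
    exact D.comp_congr _ (ihx _ _) (ihy _ _) _ _
  | step hx hy hz h => exact fun _ _ => hf _ _ (negStep_pathCell h hx hy hz)

theorem eq_of_isComp_of_not_proper {n : ℕ} {x y z : (cubeFaces N).Table} (hx : IsCell _ x)
    (h : IsComp n x y z) (hx' : ¬ Proper x) : z = y := by
  have e : ∀ α, Table.d α 0 x = x := hx.d_zero (by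
    by_contra e
    exact hx' ⟨hx, e⟩)
  obtain ⟨h, rfl⟩ := h
  exact (cubeFaces N).tables.comp_of_zero_left e n h

theorem eq_of_isComp_of_not_proper' {n : ℕ} {x y z : (cubeFaces N).Table} (hy : IsCell _ y)
    (h : IsComp n x y z) (hy' : ¬ Proper y) : z = x := by
  have e : ∀ α, Table.d α 0 y = y := hy.d_zero (by
    by_contra e
    exact hy' ⟨hy, e⟩)
  obtain ⟨h, rfl⟩ := h
  exact (cubeFaces N).tables.comp_of_zero_right e n h

/-- Two omega-functors on the path omega-category of a cube which are compatible with the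
equivalence relation and which agree on the atoms are equal. -/
theorem cubePath_hom_ext {D : OmegaCat.{0}} {f g : cubePath N ⟶ D}
    (hf : ∀ x z, NegStep (cube_nonContracting N) x z → f.toFun x = f.toFun z)
    (hg : ∀ x z, NegStep (cube_nonContracting N) x z → g.toFun x = g.toFun z)
    (h : ∀ a (ha : Proper ((cubeFaces N).atom a)),
      f.toFun (pathCell _ ha) = g.toFun (pathCell _ ha)) : f = g := by
  refine OmegaCat.hom_ext fun x => ?_
  refine IsCell.induction (closed_cube N) (p := fun x => ∀ hx : Proper x,
    f.toFun (pathCell x hx) = g.toFun (pathCell x hx)) h ?_ x.1.2 (proper_of_path x)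
  intro n x y z hx hy hz ihx ihy hz'
  -- A factor of dimension zero is an identity, so the composite equals the other factor; otherwise
  -- both factors are paths.
  by_cases hpx : Proper x
  · by_cases hpy : Proper y
    · cases n with
      | zero =>
        have e := negStep_pathCell hz hpx hpy hz'
        rw [← hf _ _ e, ← hg _ _ e, ihx]
      | succ n =>
        obtain ⟨e, e₁⟩ := pathCell_comp hz hpx hpy hz'
        rw [e₁, f.map_comp _ _ _ e (f.compat e), g.map_comp _ _ _ e (g.compat e)]
        exact D.comp_congr _ (ihx _) (ihy _) _ _
    · obtain rfl := eq_of_isComp_of_not_proper' hy hz hpy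
      exact ihx _
  · obtain rfl := eq_of_isComp_of_not_proper hx hz hpx
    exact ihy _

/-- The section of the projection onto a simplex, in the position of a cube given by `e` and `u`. -/
noncomputable def sectHom {p : ℕ} (e : Fin (p + 1) ↪o Fin N) (u : (cubeFaces N).face)
    (hu : ∀ i ∉ Set.range e, u i ≠ 0) : simplex p ⟶ cubePath N where
  toFun x := pathCell (faceMap e u (sect x.1)) ((Proper.sect x.2).faceMap hu)
  map_d α n x := by
    refine pathCell_congr ?_ _ ((proper_of_path _).d _ _)
    exact (congrArg (faceMap e u) (sect_d x.1 α n)).trans (faceMap_d _ _ _)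
  map_comp n x y h h' := by
    have hc : IsComp n x.1 y.1 ((simplex p).comp n x y h).1 := ⟨congrArg Subtype.val h, rfl⟩
    have hc' : IsComp (n + 1) (faceMap e u (sect x.1)) (faceMap e u (sect y.1))
        (faceMap e u (sect ((simplex p).comp n x y h).1)) := (IsComp.sect hc).rel _
    exact (pathCell_comp hc' _ _ _).choose_spec

/-- The faces of a table on a cube at a vertex. -/
def link {p : ℕ} (e : Fin (p + 1) ↪o Fin N) (u : (cubeFaces N).face)
    (x : (cubeFaces N).Table) : (simplexFaces p).Table where
  lvl k α := {τ | emb e u (star τ.1) ∈ x.lvl (k + 1) α}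
  mono k α β _ h := x.mono (k + 1) α β h
  stable := by
    obtain ⟨M, hM⟩ := x.stable
    refine ⟨M, fun n hn α => ?_⟩
    rw [hM (n + 1) (by omega), hM (M + 1) (by omega)]

section Link

variable {p : ℕ} {e : Fin (p + 1) ↪o Fin N} {u : (cubeFaces N).face}

theorem mem_link {x : (cubeFaces N).Table} {k : ℕ} {α : Dir} {τ : (simplexFaces p).face} :
    τ ∈ (link e u x).lvl k α ↔ emb e u (star τ.1) ∈ x.lvl (k + 1) α := Iff.rfl

theorem link_d (α : Dir) (n : ℕ) (x : (cubeFaces N).Table) :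
    link e u (Table.d α (n + 1) x) = Table.d α n (link e u x) := by
  apply ext_mem
  intro k β τ
  simp only [mem_link, mem_d]
  simp

theorem IsComp.link {n : ℕ} {x y z : (cubeFaces N).Table} (h : IsComp (n + 1) x y z) :
    IsComp n (link e u x) (link e u y) (link e u z) := by
  obtain ⟨h₁, h₂, h₃, h₄, h₅⟩ := isComp_iff.1 h
  exact isComp_iff.2 ⟨fun k hk α τ => h₁ (k + 1) (by omega) α _, fun τ => h₂ _, fun τ => h₃ _,
    fun τ => h₄ _, fun k hk α τ => h₅ (k + 1) (by omega) α _⟩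

theorem link_atom (hu : ∀ i ∉ Set.range e, u i ≠ 0) (σ : (simplexFaces p).face) :
    link e u ((cubeFaces N).atom (emb e u (star σ.1))) = (simplexFaces p).atom σ := by
  apply ext_mem
  intro k α τ
  rw [mem_link, ← faceMap_atom hu, emb_mem_faceMap, mem_simplex_atom]

end Link

end
end FaceSystem

/-! ### The projection of a path to the vertex figure of its initial vertex. -/

namespace FaceSystem
open Table OmegaCat

section

variable {N : ℕ}

/-- The vertex of a cube with the coordinates `-` in `S` and `+` outside of `S`. -/
def baseWord (S : Finset (Fin N)) : (cubeFaces N).face := fun i : Fin N => if i ∈ S then -1 else 1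

theorem baseWord_of_mem {S : Finset (Fin N)} {i : Fin N} (h : i ∈ S) : baseWord S i = -1 :=
  if_pos h

theorem baseWord_of_notMem {S : Finset (Fin N)} {i : Fin N} (h : i ∉ S) : baseWord S i = 1 :=
  if_neg h

theorem baseWord_injective : Function.Injective (baseWord (N := N)) := fun S T h => by
  ext i
  have e := congrFun h i
  by_cases hS : i ∈ S <;> by_cases hT : i ∈ T <;> simp_all [baseWord]

theorem exists_eq_baseWord {v : Fin N → SignType} (hv : ∀ i, v i ≠ 0) :
    ∃ S, v = baseWord S := by
  refine ⟨Finset.univ.filter fun i : Fin N => v i = -1, funext fun i : Fin N => ?_⟩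
  have h := hv i
  simp only [baseWord, Finset.mem_filter, Finset.mem_univ, true_and]
  generalize v i = s at h
  revert s
  decide

theorem exists_eq_star {v : Fin N → SignType} (hv : ∀ i, v i ≠ 1) : ∃ τ, v = star τ := by
  refine ⟨Finset.univ.filter fun i : Fin N => v i = 0, funext fun i : Fin N => ?_⟩
  have h := hv i
  change _ = starWord _ i
  simp only [starWord, Finset.mem_filter, Finset.mem_univ, true_and]
  generalize v i = s at h
  revert s
  decide

theorem IsCell.vertex_ne_zero {x : (cubeFaces N).Table} (hx : IsCell _ x) {α : Dir}
    {v : (cubeFaces N).face} (hv : v ∈ x.lvl 0 α) (i : Fin N) : v i ≠ 0 := by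
  have e : (cubeFaces N).dim v = 0 := (gen_cube x hx).1 α v hv
  intro hi
  have : i ∈ cubeZeros v := mem_cubeZeros.2 hi
  exact absurd (Finset.card_pos.2 ⟨i, this⟩) e.not_gt

/-- With all letters + at the initial vertex, the final vertex could only be the same vertex. -/
theorem Proper.exists_baseWord {x : (cubeFaces N).Table} (hx : Proper x) :
    ∃ S : Finset (Fin N), S.Nonempty ∧ x.lvl 0 .src = {baseWord S} := by
  obtain ⟨v, w, h⟩ := hx.isCell.oriented
  obtain ⟨S, rfl⟩ := exists_eq_baseWord (hx.isCell.vertex_ne_zero (α := .src) (v := v)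
    (by rw [h.src]; rfl))
  refine ⟨S, Finset.nonempty_iff_ne_empty.2 ?_, h.src⟩
  rintro rfl
  refine hx.ne ?_
  rw [h.src, h.tgt, Set.singleton_eq_singleton_iff]
  funext i
  have := (h.le 0 .tgt w (by rw [h.tgt]; rfl) i).1
  rw [baseWord_of_notMem (Finset.notMem_empty i)] at this ⊢
  exact le_antisymm this (SignType.le_one' _)

section Base

variable {p : ℕ} {S : Finset (Fin N)} (hS : S.card = p + 1)

theorem baseWord_ne_zero : ∀ i ∉ Set.range (S.orderEmbOfFin hS), baseWord S i ≠ 0 := by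
  intro i _
  unfold baseWord
  split_ifs <;> decide

theorem emb_base_of_notMem {b : (cubeFaces (p + 1)).face} {i : Fin N} (hi : i ∉ S) :
    emb (S.orderEmbOfFin hS) (baseWord S) b i = 1 := by
  refine (embFace_of_notMem _ _ b ?_).trans (baseWord_of_notMem hi)
  rwa [Finset.range_orderEmbOfFin]

theorem exists_orderEmbOfFin {i : Fin N} (hi : i ∈ S) : ∃ j, S.orderEmbOfFin hS j = i := by
  rwa [← Finset.mem_coe, ← Finset.range_orderEmbOfFin S hS] at hi

theorem emb_base_ne_one {τ : Finset (Fin (p + 1))} {i : Fin N} (hi : i ∈ S) :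
    emb (S.orderEmbOfFin hS) (baseWord S) (star τ) i ≠ 1 := by
  obtain ⟨j, rfl⟩ := exists_orderEmbOfFin hS hi
  refine (embFace_apply _ _ (star τ) j).trans_ne ?_
  change starWord τ j ≠ 1
  unfold starWord
  split_ifs <;> decide

theorem emb_botFace :
    emb (S.orderEmbOfFin hS) (baseWord S) (botFace (p + 1)) = baseWord S := by
  funext i
  by_cases hi : i ∈ S
  · obtain ⟨j, rfl⟩ := exists_orderEmbOfFin hS hi
    exact (embFace_apply _ _ (botFace (p + 1)) j).trans (baseWord_of_mem hi).symm
  · rw [emb_base_of_notMem hS hi, baseWord_of_notMem hi]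

/-- The initial vertex of a face has its zeros replaced by -. Hence the face has only letters - and
0 in `S` and only + outside, and positive dimension makes its set of zeros nonempty. -/
theorem exists_eq_emb_star {a : (cubeFaces N).face} (ha : Proper ((cubeFaces N).atom a))
    (h : ((cubeFaces N).atom a).lvl 0 .src = {baseWord S}) :
    ∃ σ : (simplexFaces p).face, a = emb (S.orderEmbOfFin hS) (baseWord S) (star σ.1) := by
  rw [atom_lvl_zero, Set.singleton_eq_singleton_iff] at h
  have hi : ∀ i : Fin N, (if a i = 0 then (-1 : SignType) else a i) = baseWord S i := fun i => by
    rw [← h, ← cubeSign_src_zero]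
    rfl
  have h₁ : ∀ j, a (S.orderEmbOfFin hS j) ≠ (1 : SignType) := fun j hj => by
    have hi' := hi (S.orderEmbOfFin hS j)
    rw [hj, baseWord_of_mem (S.orderEmbOfFin_mem hS j)] at hi'
    exact absurd hi' (by decide)
  obtain ⟨τ, hτ⟩ := exists_eq_star h₁
  have e : a = emb (S.orderEmbOfFin hS) (baseWord S) (star τ) := by
    funext i
    by_cases hiS : i ∈ S
    · obtain ⟨j, rfl⟩ := exists_orderEmbOfFin hS hiS
      exact (congrFun hτ j).trans (embFace_apply _ _ (star τ) j).symm
    · have hi' := hi i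
      rw [emb_base_of_notMem hS hiS]
      rw [baseWord_of_notMem hiS] at hi'
      split_ifs at hi' with h₀
      exact hi'
  refine ⟨⟨τ, ?_⟩, e⟩
  rw [Finset.nonempty_iff_ne_empty]
  rintro rfl
  refine ha.ne ?_
  rw [atom_lvl_zero, atom_lvl_zero, Set.singleton_eq_singleton_iff]
  have key : ∀ i : Fin N, a i ≠ 0 := fun i hai => by
    by_cases hiS : i ∈ S
    · obtain ⟨j, rfl⟩ := exists_orderEmbOfFin hS hiS
      have := (congrFun hτ j).symm.trans hai
      exact absurd (starWord_eq_zero.1 this) (Finset.notMem_empty j)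
    · rw [e, emb_base_of_notMem hS hiS] at hai
      exact absurd hai one_ne_zero
  funext i
  simp [corner, key]

/-- The projection of a table onto the simplex at a vertex. -/
noncomputable def baseLink (x : (cubeFaces N).Table) : (simplexFaces p).Table :=
  link (S.orderEmbOfFin hS) (baseWord S) x

theorem baseLink_step {x y z : (cubeFaces N).Table} (hx : Proper x) (hy : IsCell _ y)
    (h : IsComp 0 x y z) (hb : x.lvl 0 .src = {baseWord S}) :
    baseLink hS z = baseLink hS x := by
  obtain ⟨v, w, hv⟩ := hx.isCell.oriented
  obtain ⟨w', v', hw⟩ := hy.oriented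
  obtain rfl : baseWord S = v := Set.singleton_injective (hb.symm.trans hv.src)
  obtain rfl : w = w' := Set.singleton_injective (hv.tgt.symm.trans (h.lvl_mid.trans hw.src))
  -- Some coordinate `i` of `S` has moved from - to + at the end of `x`. All faces of `y` have +
  -- there, and faces of the vertex figure do not.
  obtain ⟨i, hi⟩ : ∃ i : Fin N, baseWord S i ≠ w i := by
    by_contra! hcon
    exact hx.ne (by rw [hv.src, hv.tgt, funext hcon])
  have hw₁ : w ∈ x.lvl 0 .tgt := by rw [hv.tgt]; rfl
  have hw₀ := hx.isCell.vertex_ne_zero hw₁ i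
  have hle := (hv.le 0 .tgt w hw₁ i).1
  have hiS : i ∈ S := by
    by_contra hiS
    rw [baseWord_of_notMem hiS] at hi hle
    exact hi (le_antisymm hle (SignType.le_one' _))
  rw [baseWord_of_mem hiS] at hi
  have hwi : w i = 1 := by
    generalize w i = s at hi hw₀
    revert s
    decide
  apply ext_mem
  intro k α τ
  change emb _ _ _ ∈ z.lvl (k + 1) α ↔ emb _ _ _ ∈ x.lvl (k + 1) α
  rw [h.mem]
  simp only [Nat.not_lt_zero, Nat.succ_ne_zero, false_and, Nat.succ_pos, true_and, false_or,
    or_iff_left_iff_imp]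
  intro hy'
  have := (hw.le _ _ _ hy' i).1
  rw [hwi] at this
  exact absurd (le_antisymm (SignType.le_one' _) this) (emb_base_ne_one hS hiS)

/-- Higher composites keep the initial vertex and pass to composites of the vertex figures; a
composite `*_0` has the vertex figure of its first proper factor. -/
theorem Proper.isCell_baseLink {x : (cubeFaces N).Table} (hx : Proper x)
    (hb : x.lvl 0 .src = {baseWord S}) : IsCell _ (baseLink hS x) := by
  refine IsCell.induction (closed_cube N) (p := fun x => Proper x → x.lvl 0 .src = {baseWord S} →
    IsCell _ (baseLink hS x)) ?_ ?_ hx.isCell hx hb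
  · intro a ha hb
    obtain ⟨σ, rfl⟩ := exists_eq_emb_star hS ha hb
    rw [FaceSystem.baseLink, link_atom (baseWord_ne_zero hS)]
    exact .atom σ
  · intro n x y z hx hy h ihx ihy hz hb
    by_cases hpx : Proper x
    · cases n with
      | zero =>
        rw [h.lvl_src] at hb
        rw [baseLink_step hS hpx hy h hb]
        exact ihx hpx hb
      | succ n =>
        have e := h.lvl_lt_left (Nat.succ_pos n)
        have e' := h.lvl_lt_right (Nat.succ_pos n)
        have hpy : Proper y := ⟨hy, by rw [← e', ← e']; exact hz.ne⟩
        exact (ihx hpx (by rw [← e, hb])).comp (ihy hpy (by rw [← e', hb])) (IsComp.link h)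
    · obtain rfl := eq_of_isComp_of_not_proper hx h hpx
      exact ihy hz hb

end Base
end
end FaceSystem

/-! ### Indexing by nonempty sets of coordinates, and the isomorphism. -/

namespace FaceSystem
open Table OmegaCat

section

variable {n : ℕ}

/-- The subset of the coordinates indexed by an element of the index set of the direct sum. -/
noncomputable def subsetOf (i : (p : Finset.Icc 1 (n + 1)) × Fin ((n + 1).choose p)) :
    Finset (Fin (n + 1)) :=
  ((Finset.equivFinOfCardEq (s := Finset.powersetCard i.1 (Finset.univ : Finset (Fin (n + 1))))
    (by simp)).symm i.2).1

theorem card_subsetOf (i : (p : Finset.Icc 1 (n + 1)) × Fin ((n + 1).choose p)) :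
    (subsetOf i).card = i.1 := (Finset.mem_powersetCard.1 (Subtype.prop _)).2

theorem card_subsetOf' (i : (p : Finset.Icc 1 (n + 1)) × Fin ((n + 1).choose p)) :
    (subsetOf i).card = i.1 - 1 + 1 := by
  have := (Finset.mem_Icc.1 i.1.2).1
  rw [card_subsetOf]
  omega

theorem subsetOf_injective : Function.Injective (subsetOf (n := n)) := by
  rintro ⟨p, i⟩ ⟨q, j⟩ h
  have hpq := (card_subsetOf _).symm.trans ((congrArg Finset.card h).trans (card_subsetOf _))
  obtain rfl : p = q := Subtype.ext hpq
  exact congrArg (Sigma.mk p) ((Finset.equivFinOfCardEq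
    (s := Finset.powersetCard p (Finset.univ : Finset (Fin (n + 1)))) (by simp)).symm.injective
    (Subtype.ext h))

theorem exists_subsetOf {S : Finset (Fin (n + 1))} (hS : S.Nonempty) : ∃ i, subsetOf i = S := by
  have hc : S.card ≤ n + 1 := by simpa using S.card_le_univ
  refine ⟨⟨⟨S.card, Finset.mem_Icc.2 ⟨hS.card_pos, hc⟩⟩, Finset.equivFinOfCardEq (by simp)
    ⟨S, Finset.mem_powersetCard.2 ⟨Finset.subset_univ S, rfl⟩⟩⟩, ?_⟩
  simp [subsetOf]

theorem exists_base (x : (cubePath (n + 1)).carrier) :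
    ∃ i, x.1.1.lvl 0 .src = {baseWord (subsetOf (n := n) i)} := by
  obtain ⟨S, hS, h⟩ := (proper_of_path x).exists_baseWord
  obtain ⟨i, rfl⟩ := exists_subsetOf hS
  exact ⟨i, h⟩

/-- The direct sum of simplices. -/
abbrev simplexSum (n : ℕ) : OmegaCat.{0} := directSum
  (fun i : (p : Finset.Icc 1 (n + 1)) × Fin ((n + 1).choose p) => simplex (i.1 - 1))

/-- The coprojections of the direct sum of simplices. -/
def simplexIncl (i : (p : Finset.Icc 1 (n + 1)) × Fin ((n + 1).choose p)) :
    simplex (i.1 - 1) ⟶ simplexSum n :=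
  directSumIncl
    (fun i : (p : Finset.Icc 1 (n + 1)) × Fin ((n + 1).choose p) => simplex (i.1 - 1)) i

/-- The projection of a path in a cube onto the simplex at its initial vertex. -/
noncomputable def baseProj (x : (cubePath (n + 1)).carrier) : (simplexSum n).carrier :=
  ⟨(exists_base x).choose, baseLink (card_subsetOf' _) x.1.1,
    (proper_of_path x).isCell_baseLink _ (exists_base x).choose_spec⟩

/-- The index chosen in `baseProj` is unique, because the initial vertex determines the set of its
letters -. -/
theorem baseProj_eq (x : (cubePath (n + 1)).carrier)
    {i : (p : Finset.Icc 1 (n + 1)) × Fin ((n + 1).choose p)}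
    (h : x.1.1.lvl 0 .src = {baseWord (subsetOf i)}) :
    baseProj x = ⟨i, baseLink (card_subsetOf' i) x.1.1, (proper_of_path x).isCell_baseLink _ h⟩ := by
  obtain rfl : (exists_base x).choose = i := subsetOf_injective (baseWord_injective
    (Set.singleton_injective ((exists_base x).choose_spec.symm.trans h)))
  rfl

theorem baseProj_step {x z : (cubePath (n + 1)).carrier}
    (h : NegStep (cube_nonContracting (n + 1)) x z) : baseProj x = baseProj z := by
  obtain ⟨y, e, e'⟩ := h
  have hc : IsComp 0 x.1.1 y.1.1 z.1.1 := ⟨congrArg Subtype.val e, congrArg Subtype.val e'⟩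
  obtain ⟨i, hi⟩ := exists_base x
  rw [baseProj_eq x hi, baseProj_eq z (hc.lvl_src.trans hi)]
  exact congrArg (Sigma.mk i) (Subtype.ext
    (baseLink_step _ (proper_of_path x) y.1.2 hc hi).symm)

/-- The omega-functor from the paths in a cube to the direct sum of the simplices at its
vertices. -/
noncomputable def baseHom (n : ℕ) : cubePath (n + 1) ⟶ simplexSum n where
  toFun := baseProj
  map_d α k x := by
    obtain ⟨i, hi⟩ := exists_base x
    refine (baseProj_eq ((cubePath (n + 1)).d α k x)
      ((lvl_d_of_lt x.1.1 (Nat.succ_pos k) α .src).trans hi)).trans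
      (Eq.trans ?_ (congrArg ((simplexSum n).d α k) (baseProj_eq x hi)).symm)
    exact congrArg (Sigma.mk i) (Subtype.ext (link_d α k x.1.1))
  map_comp k x y h h' := by
    have hc : IsComp (k + 1) x.1.1 y.1.1 ((cubePath (n + 1)).comp k x y h).1.1 :=
      ⟨congrArg (fun z => z.1.1) h, rfl⟩
    obtain ⟨i, hi⟩ := exists_base x
    have hz := (hc.lvl_lt_left (Nat.succ_pos k) .src).trans hi
    have hy := (hc.lvl_lt_right (Nat.succ_pos k) .src).symm.trans hz
    have ex := baseProj_eq x hi
    have ey := baseProj_eq y hy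
    have hl := IsComp.link (e := (subsetOf i).orderEmbOfFin (card_subsetOf' i))
      (u := baseWord (subsetOf i)) hc
    obtain ⟨hl₁, hl₂⟩ := hl
    have h'' := h'
    rw [ex, ey] at h''
    rw [baseProj_eq _ hz, comp_congr _ k ex ey h' h'']
    exact congrArg (Sigma.mk i) (Subtype.ext hl₂)

theorem baseHom_atom (i : (p : Finset.Icc 1 (n + 1)) × Fin ((n + 1).choose p))
    (σ : (simplexFaces (i.1 - 1)).face)
    (h : Proper ((cubeFaces (n + 1)).atom (emb ((subsetOf i).orderEmbOfFin (card_subsetOf' i))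
      (baseWord (subsetOf i)) (star σ.1)))) :
    (baseHom n).toFun (pathCell _ h) = ⟨i, (simplexFaces (i.1 - 1)).atom σ, IsCell.atom σ⟩ := by
  have hb : (pathCell _ h).1.1.lvl 0 .src = {baseWord (subsetOf i)} := by
    have e := (emb_mem_faceMap (e := (subsetOf i).orderEmbOfFin (card_subsetOf' i))
      (u := baseWord (subsetOf i))).2 (bot_mem_atom_star σ.1)
    rw [faceMap_atom (baseWord_ne_zero _), emb_botFace] at e
    exact (atom_lvl_zero _ _).trans (congrArg _
      (Set.mem_singleton_iff.1 (atom_lvl_zero _ _ ▸ e)).symm)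
  refine (baseProj_eq _ hb).trans (congrArg (Sigma.mk i) (Subtype.ext ?_))
  exact link_atom (baseWord_ne_zero _) σ

/-- The section over the simplex of index `i`. -/
noncomputable def baseSect (i : (p : Finset.Icc 1 (n + 1)) × Fin ((n + 1).choose p)) :
    simplex (i.1 - 1) ⟶ cubePath (n + 1) :=
  sectHom ((subsetOf i).orderEmbOfFin (card_subsetOf' i)) (baseWord (subsetOf i))
    (baseWord_ne_zero _)

/-- The section sends an atom only to a cell congruent to the corresponding atom of the cube; a
functor compatible with the steps does not see the difference. -/
theorem map_baseSect_atom {D : OmegaCat.{0}} (f : cubePath (n + 1) ⟶ D)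
    (hf : ∀ x z, NegStep (cube_nonContracting (n + 1)) x z → f.toFun x = f.toFun z)
    (i : (p : Finset.Icc 1 (n + 1)) × Fin ((n + 1).choose p)) (σ : (simplexFaces (i.1 - 1)).face)
    (h : Proper ((cubeFaces (n + 1)).atom (emb ((subsetOf i).orderEmbOfFin (card_subsetOf' i))
      (baseWord (subsetOf i)) (star σ.1)))) :
    f.toFun ((baseSect i).toFun ⟨(simplexFaces (i.1 - 1)).atom σ, IsCell.atom σ⟩) =
      f.toFun (pathCell _ h) := by
  have e := (sect_atom_eqv σ).faceMap (baseWord_ne_zero (card_subsetOf' i))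
  rw [faceMap_atom (baseWord_ne_zero _)] at e
  exact e.map_eq f hf e.proper.1 h

theorem proper_emb_star (i : (p : Finset.Icc 1 (n + 1)) × Fin ((n + 1).choose p))
    (σ : (simplexFaces (i.1 - 1)).face) :
    Proper ((cubeFaces (n + 1)).atom (emb ((subsetOf i).orderEmbOfFin (card_subsetOf' i))
      (baseWord (subsetOf i)) (star σ.1))) := by
  rw [← faceMap_atom (baseWord_ne_zero _)]
  exact (sect_atom_eqv σ).proper.2.faceMap (baseWord_ne_zero _)

theorem baseSect_baseHom (i : (p : Finset.Icc 1 (n + 1)) × Fin ((n + 1).choose p)) :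
    baseSect i ≫ baseHom n = simplexIncl i :=
  omegaCat_hom_ext (closed_simplex _) fun σ =>
    (map_baseSect_atom _ (fun _ _ => baseProj_step) i σ (proper_emb_star i σ)).trans
      (baseHom_atom i σ _)

/-- Both functors respect the steps, so it suffices to compare them on proper atoms. Each of these
is a star face at its initial vertex, where projection and section cancel. -/
theorem baseHom_comp_eq {D : OmegaCat.{0}} (f : cubePath (n + 1) ⟶ D)
    (hf : ∀ x z, NegStep (cube_nonContracting (n + 1)) x z → f.toFun x = f.toFun z)
    (k : simplexSum n ⟶ D) (hk : ∀ i, simplexIncl i ≫ k = baseSect i ≫ f) :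
    baseHom n ≫ k = f := by
  refine cubePath_hom_ext (fun x z h => congrArg k.toFun (baseProj_step h)) hf fun a ha => ?_
  obtain ⟨i, hi⟩ := exists_base (pathCell _ ha)
  obtain ⟨σ, rfl⟩ := exists_eq_emb_star (card_subsetOf' i) ha hi
  refine Eq.trans (congrArg k.toFun (baseHom_atom i σ ha)) ?_
  exact (congrArg (fun g : simplex (i.1 - 1) ⟶ D =>
    Hom.toFun g ⟨(simplexFaces (i.1 - 1)).atom σ, IsCell.atom σ⟩) (hk i)).trans
      (map_baseSect_atom f hf i σ ha)

end
end FaceSystem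

theorem mainTheorem6 (n : ℕ) :
    Nonempty ((cube (n + 1)).negSemiPath (cube_nonContracting (n + 1)) ≅
      OmegaCat.directSum
        (fun i : (p : Finset.Icc 1 (n + 1)) × Fin ((n + 1).choose p) => simplex (i.1 - 1))) :=
  OmegaCat.negSemiPath_iso (FaceSystem.baseHom n) (fun _ _ => FaceSystem.baseProj_step)
    FaceSystem.baseSect FaceSystem.baseSect_baseHom fun k hk =>
      FaceSystem.baseHom_comp_eq _ (fun _ _ => OmegaCat.toNegSemiPath_eq) k hk
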